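/- **Theorem 2 (Excavation form of the octahedron recurrence).** Let $n\ge 2$ and $T=\{(i,j)\in\mathbb Z^2: 0\le i\le j\le n\}$. A *Gelfand–Tsetlin pattern* is a real array $g=(g_{j,k})_{1\le j\le k\le n}$ with $g_{j,k+1}\ge g_{j,k}\ge g_{j+1,k+1}$ for $1\le j\le k\le n-1$; its diagonal $\mathrm{diag}(g)\in\mathbb R^n$ is the tuple $b$ with $b_1+\dots+b_k=g_{1,k}+\dots+g_{k,k}$ for all $k$. For $\Lambda\in\mathbb R^n$ put $h_{\Lambda,g}(i,j)=\Lambda_1+\dots+\Lambda_j+g_{1,j}+\dots+g_{i,j}$ on $T$. *The octahedron recurrence.* Let $g_1,g_2$ be Gelfand–Tsetlin patterns with top rows ($k=n$) $\lambda,\mu$, and let $\gamma\in\mathbb R^n$ have large gaps: $\gamma_l-\gamma_{l+1}>(\lambda_1-\lambda_n)+(\mu_1-\mu_n)$ for $1\le l<n$. Put $k'=h_{\gamma,g_1}$, $k=h_{\gamma+\mathrm{diag}(g_1),\,g_2}$, and define $\tilde k$ on $\{0,\dots,n\}^2$ by $\tilde k(i,j)=k(i+j-n,j)-\sum_l\gamma_l$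 on $U=\{i+j\ge n\}$ and $\tilde k(i,j)=k'(j,n-i)-\sum_l\gamma_l$ on $U'=\{i+j\le n\}$ (these agree if $i+j=n$). Let $o$ be the unique real function on $\{[x,y,z,w]\in\mathbb Z_{\ge0}^4:x+y+z+w=n\}$ with $o[n-j,n-i,0,i+j-n]=\tilde k(i,j)$ on $U$, $o[i,j,n-i-j,0]=\tilde k(i,j)$ on $U'$, and $$o[x,y,z+1,w+1]=\max\bigl(o[x+1,y,z+1,w]+o[x,y+1,z,w+1],\ o[x+1,y,z,w+1]+o[x,y+1,z+1,w]\bigr)-o[x+1,y+1,z,w]$$ whenever $x,y,z,w\ge0$ and $x+y+z+w=n-2$. Put $\tilde h(i,j)=o[0,j-i,n-j,i]$ if $i\le j$ and $\tilde h(i,j)=o[i-j,0,n-i,j]$ if $j\le i$. Then $(h,g)=\mathbf{oct}(g_1,g_2)$ means that, for some such $\gamma$, $h=\tilde h|_T$ and $g_{a,b}=h'(a,b)-h'(a-1,b)$, where $h'(a,b)=\tilde h(n-b+a,a)+\sum_l\gamma_l$. *Tilings.* A *lozenge* is a quadruple $ABCD$ of one of the forms $((i,j),(i+1,j-1),(i+2,j-1),(i+1,j))$,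 $((i,j),(i,j+1),(i-1,j+2),(i-1,j+1))$, $((i,j),(i+1,j),(i+1,j+1),(i,j+1))$ that lies in $U$ or in $U'$; its weight is $\frac13(\tilde k(A)+\tilde k(C)-\tilde k(B)-\tilde k(D))$. A *border edge* is $(A,C)=((i,n-i),(i+1,n-i-1))$, $0\le i<n$; its two *border triangles* $ABC$ have $B=(i+1,n-i)$ and $B=(i,n-i-1)$, and weight $\frac13(\tilde k(B)-\tilde k(A))$. For $v=(i,j)\in T$ in the interior of $\{0,\dots,n\}^2$, the *excavation hexagon* $\hexagon_v=ABCDEF$ has vertices $(0,n),(0,j),(i,j-i),(n+i-j,j-i),(n+i-j,j),(i,n)$ and weight $\frac13(\tilde k(B)+\tilde k(C)-\tilde k(D)+\tilde k(E)+\tilde k(F))$. A *lozenge tiling* $\Xi$ of $\hexagon_v$ is a partition of the solid hexagon into solid lozenges and solid border triangles in which each border edge on the segment $AD$ is adjacent to exactly one border triangle of the tiling. Let $w_\Xi$ be the sum of the weights of all lozenges and border triangles of $\Xi$ and of the weight of $\hexagon_v$. *Statement.* Let $v\in T$. If $v$ is in the interior of $\{0,\dots,n\}^2$, then $\hexagon_v$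 has finitely many lozenge tilings, and for each of them $w_\Xi$, as a function of $(g_1,g_2)$, does not depend on $\gamma$ and is a linear functional; let $\mathcal W_v$ be the finite family of these functionals. If $v$ is on the boundary of $\{0,\dots,n\}^2$, then $\tilde k(v)$ is a linear functional of $(g_1,g_2)$ that does not depend on $\gamma$; let $\mathcal W_v$ consist of it alone. Then, whenever $g_1,g_2$ are Gelfand–Tsetlin patterns and $(h,g)=\mathbf{oct}(g_1,g_2)$, $$h(v)=\max_{w\in\mathcal W_v}w(g_1,g_2).$$ -/

import Mathlib

namespace Excavation

noncomputable section

/-! ### Gelfand–Tsetlin patterns and hives -/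

/-- The index set `{(j, k) : 1 ≤ j ≤ k ≤ n}` of a triangular array of depth `n`. -/
abbrev GTIndex (n : ℕ) : Type := {p : ℕ × ℕ // 1 ≤ p.1 ∧ p.1 ≤ p.2 ∧ p.2 ≤ n}

/-- The triangle `T = {(i, j) : 0 ≤ i ≤ j ≤ n}`. -/
abbrev Triangle (n : ℕ) : Type := {p : ℕ × ℕ // p.1 ≤ p.2 ∧ p.2 ≤ n}

/-- The real vector space of triangular arrays `(g_{j,k})_{1 ≤ j ≤ k ≤ n}`. -/
abbrev GTArray (n : ℕ) : Type := GTIndex n → ℝ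

/-- The entry `g_{j,k}` of a triangular array (only used for `1 ≤ j ≤ k ≤ n`). -/
def entry {n : ℕ} (g : GTArray n) (j k : ℕ) : ℝ :=
  if h : 1 ≤ j ∧ j ≤ k ∧ k ≤ n then g ⟨(j, k), h⟩ else 0

/-- The array `g` is a Gelfand–Tsetlin pattern: the interlacing inequalities
`g_{j,k+1} ≥ g_{j,k} ≥ g_{j+1,k+1}` hold for `1 ≤ j ≤ k ≤ n - 1`. -/
def IsGT {n : ℕ} (g : GTArray n) : Prop :=
  ∀ j k : ℕ, 1 ≤ j → j ≤ k → k < n →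
    entry g j k ≤ entry g j (k + 1) ∧ entry g (j + 1) (k + 1) ≤ entry g j k

/-- `g_{1,k} + ⋯ + g_{i,k}`. -/
def rowSum {n : ℕ} (g : GTArray n) (i k : ℕ) : ℝ := ∑ m ∈ Finset.Icc 1 i, entry g m k

/-- The diagonal `a ∈ ℝⁿ` of an array with boundary condition `diag(⋆) → a`, that is
`a_1 + ⋯ + a_k = g_{1,k} + ⋯ + g_{k,k}` for all `k` (coordinates are indexed from `0`). -/
def diagOf {n : ℕ} (g : GTArray n) : Fin n → ℝ := fun l =>
  rowSum g (l + 1) (l + 1) - rowSum g l l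

/-- `Λ_1 + ⋯ + Λ_j`. -/
def partialSum {n : ℕ} (Λ : Fin n → ℝ) (j : ℕ) : ℝ :=
  ∑ l ∈ Finset.univ.filter (fun l : Fin n => (l : ℕ) < j), Λ l

/-- The hive `(i, j) ↦ Λ_1 + ⋯ + Λ_j + g_{1,j} + ⋯ + g_{i,j}` on `T` which is attached to the
Gelfand–Tsetlin pattern `g` and to a tuple `Λ` (with large gaps). -/
def hiveOf {n : ℕ} (Λ : Fin n → ℝ) (g : GTArray n) (i j : ℕ) : ℝ :=
  partialSum Λ j + rowSum g i j

/-- `γ` has large gaps relative to the top rows `λ`, `μ` of `g₁`, `g₂`: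
`γ_l - γ_{l+1} > (λ_1 - λ_n) + (μ_1 - μ_n)` for `1 ≤ l < n`. -/
def LargeGaps {n : ℕ} (γ : Fin n → ℝ) (g₁ g₂ : GTArray n) : Prop :=
  ∀ (l : ℕ) (hl : l + 1 < n),
    (entry g₁ 1 n - entry g₁ n n) + (entry g₂ 1 n - entry g₂ n n)
      < γ ⟨l, Nat.lt_of_succ_lt hl⟩ - γ ⟨l + 1, hl⟩

/-! ### The octahedron recurrence -/

/-- The function `k̃` on the square `{0, …, n}²`. The patterns `g₁`, `g₂` (with `diag g₁ = b`) give
the hive `k'` of `γ`, `g₁` and the hive `k` of `σ = γ + b`, `g₂`. Then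
`k̃(i,j) = k(i+j-n, j) - ∑ γ` on the upper triangle `U = {i + j ≥ n}` and
`k̃(i,j) = k'(j, n-i) - ∑ γ` on the lower triangle `U' = {i + j ≤ n}`;
both formulas agree for `i + j = n`. -/
def squareData {n : ℕ} (γ : Fin n → ℝ) (g₁ g₂ : GTArray n) (p : ℕ × ℕ) : ℝ :=
  if n ≤ p.1 + p.2 then
    hiveOf (γ + diagOf g₁) g₂ (p.1 + p.2 - n) p.2 - ∑ l, γ l
  else
    hiveOf γ g₁ p.2 (n - p.1) - ∑ l, γ l

/-- The function `o` on the tetrahedron of all `[x,y,z,w]` with `x + y + z + w = n`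
which solves the octahedron rule
`o[x,y,z+1,w+1] = max (o[x+1,y,z+1,w] + o[x,y+1,z,w+1]) (o[x+1,y,z,w+1] + o[x,y+1,z+1,w])`
`                   - o[x+1,y+1,z,w]`
with the values `f` on the two faces `U` (`z = 0`) and `U'` (`w = 0`). Here
`(i,j) ∈ U` is identified with `[n-j, n-i, 0, i+j-n]` and `(i,j) ∈ U'` with `[i, j, n-i-j, 0]`;
in both cases the point `[x,y,z,w]` comes from `(i,j) = (x+w, y+w)`. -/
def octahedronExtension (f : ℕ × ℕ → ℝ) : ℕ → ℕ → ℕ → ℕ → ℝ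
  | x, y, 0, w => f (x + w, y + w)
  | x, y, _ + 1, 0 => f (x, y)
  | x, y, z + 1, w + 1 =>
      max
        (octahedronExtension f (x + 1) y (z + 1) w + octahedronExtension f x (y + 1) z (w + 1))
        (octahedronExtension f (x + 1) y z (w + 1) + octahedronExtension f x (y + 1) (z + 1) w)
      - octahedronExtension f (x + 1) (y + 1) z w
  termination_by _ _ z w => z + w

/-- The function `h̃` on the square `{0, …, n}²` obtained from `f = k̃`: the restriction of the
octahedron extension to the faces `T` and `T'` of the tetrahedron, where `(i,j) ∈ T` (`i ≤ j`) is
identified with `[0, j-i, n-j, i]` and `(i,j) ∈ T'` (`j ≤ i`) with `[i-j, 0, n-i, j]`. -/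
def octahedronOutput (n : ℕ) (f : ℕ × ℕ → ℝ) (i j : ℕ) : ℝ :=
  if i ≤ j then octahedronExtension f 0 (j - i) (n - j) i
  else octahedronExtension f (i - j) 0 (n - i) j

/-- The octahedron recurrence, carried out with the auxiliary tuple `γ`: it produces the hive
`h(i,j) = h̃(i,j)` on `T`, and the pattern `g` whose attached hive `h'` satisfies
`h̃(i,j) = h'(j, n-i+j) - ∑ γ` on `T'`; so `h'(a,b) = h̃(n-b+a, a) + ∑ γ` and
`g_{a,b} = h'(a,b) - h'(a-1,b)`. -/
def octWith {n : ℕ} (γ : Fin n → ℝ) (g₁ g₂ : GTArray n) : (Triangle n → ℝ) × GTArray n :=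
  let hTilde := octahedronOutput n (squareData γ g₁ g₂)
  let h' : ℕ → ℕ → ℝ := fun a b => hTilde (n - b + a) a + ∑ l, γ l
  (fun v => hTilde v.1.1 v.1.2, fun q => h' q.1.1 q.1.2 - h' (q.1.1 - 1) q.1.2)

/-- `(h, g) = oct(g₁, g₂)`, for some choice of the auxiliary tuple `γ` with large gaps. -/
def IsOct {n : ℕ} (g₁ g₂ : GTArray n) (h : Triangle n → ℝ) (g : GTArray n) : Prop :=
  ∃ γ : Fin n → ℝ, LargeGaps γ g₁ g₂ ∧ (h, g) = octWith γ g₁ g₂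

/-! ### Lozenges, border triangles and tilings -/

/-- Unit triangles of the triangular lattice:
`up p q` has vertices `(p,q+1), (p+1,q+1), (p+1,q)`, and
`down p q` has vertices `(p,q+1), (p,q), (p+1,q)`. -/
inductive UnitTriangle : Type
  | up (p q : ℕ)
  | down (p q : ℕ)
  deriving DecidableEq

/-- The set of vertices of a unit triangle. -/
def UnitTriangle.verts : UnitTriangle → Finset (ℕ × ℕ)
  | .up p q => {(p, q + 1), (p + 1, q + 1), (p + 1, q)}
  | .down p q => {(p, q + 1), (p, q), (p + 1, q)}

/-- Tiles: lozenges of the three types `ABCD` (the union of two adjacent unit triangles) and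
triangles. The lozenges are
* `loz₁ p q`: `(A,B,C,D) = ((p,q+1), (p+1,q), (p+2,q), (p+1,q+1))`,
* `loz₂ p q`: `(A,B,C,D) = ((p+1,q), (p+1,q+1), (p,q+2), (p,q+1))`,
* `loz₃ p q`: `(A,B,C,D) = ((p,q), (p+1,q), (p+1,q+1), (p,q+1))`. -/
inductive Tile : Type
  | loz₁ (p q : ℕ)
  | loz₂ (p q : ℕ)
  | loz₃ (p q : ℕ)
  | tri (s : UnitTriangle)
  deriving DecidableEq

/-- The set of vertices of a tile. -/
def Tile.verts : Tile → Finset (ℕ × ℕ)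
  | .loz₁ p q => {(p, q + 1), (p + 1, q), (p + 2, q), (p + 1, q + 1)}
  | .loz₂ p q => {(p + 1, q), (p + 1, q + 1), (p, q + 2), (p, q + 1)}
  | .loz₃ p q => {(p, q), (p + 1, q), (p + 1, q + 1), (p, q + 1)}
  | .tri s => s.verts

/-- The finite set of points lies in the upper triangle `U` or in the lower triangle `U'`. -/
def InHalf (n : ℕ) (S : Finset (ℕ × ℕ)) : Prop :=
  (∀ p ∈ S, n ≤ p.1 + p.2) ∨ (∀ p ∈ S, p.1 + p.2 ≤ n)

/-- The tiles allowed in a tiling: lozenges that lie in `U` or in `U'`, and the upward and the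
downward border triangle of each border edge `((p,q+1), (p+1,q))`, `p + q + 1 = n`. -/
def Tile.Allowed (n : ℕ) : Tile → Prop
  | .tri (.up p q) => p + q + 1 = n
  | .tri (.down p q) => p + q + 1 = n
  | t => InHalf n t.verts

/-- The lattice points of the solid excavation hexagon with vertices
`A = (0,n)`, `B = (0,j)`, `C = (i,j-i)`, `D = (n+i-j,j-i)`, `E = (n+i-j,j)`, `F = (i,n)`
centered at the interior point `v = (i,j) ∈ T`. -/
def hexagon (n : ℕ) (v : ℕ × ℕ) : Set (ℕ × ℕ) :=
  {p | p.1 ≤ n + v.1 - v.2 ∧ v.2 - v.1 ≤ p.2 ∧ p.2 ≤ n ∧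
    v.2 ≤ p.1 + p.2 ∧ p.1 + p.2 ≤ n + v.1}

/-- `Ξ` is a lozenge tiling of the excavation hexagon of `v`: the tiles are allowed and lie in the
hexagon, each unit triangle in the hexagon lies in exactly one tile, and each border edge
`((p,q+1), (p+1,q))` on the equator is adjacent to exactly one border triangle in the tiling. -/
structure IsLozengeTiling (n : ℕ) (v : ℕ × ℕ) (Ξ : Finset Tile) : Prop where
  allowed : ∀ t ∈ Ξ, t.Allowed n
  subset : ∀ t ∈ Ξ, ∀ p ∈ t.verts, p ∈ hexagon n v
  cover : ∀ s : UnitTriangle, (∀ p ∈ s.verts, p ∈ hexagon n v) →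
    ∃! t : Tile, t ∈ Ξ ∧ s.verts ⊆ t.verts
  border : ∀ p q : ℕ, p + q + 1 = n → (p, q + 1) ∈ hexagon n v → (p + 1, q) ∈ hexagon n v →
    Xor (Tile.tri (.up p q) ∈ Ξ) (Tile.tri (.down p q) ∈ Ξ)

/-! ### Weights -/

section Weights

variable {M : Type*} [AddCommGroup M] [Module ℝ M]

/-- The weight `(f(A) + f(C) - f(B) - f(D)) / 3` of a lozenge `ABCD`, and the weight
`(f(B) - f(A)) / 3` of a border triangle `ABC` with border edge `AC`. -/
def Tile.weight (f : ℕ × ℕ → M) : Tile → M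
  | .loz₁ p q => (1 / 3 : ℝ) • (f (p, q + 1) + f (p + 2, q) - f (p + 1, q) - f (p + 1, q + 1))
  | .loz₂ p q => (1 / 3 : ℝ) • (f (p + 1, q) + f (p, q + 2) - f (p + 1, q + 1) - f (p, q + 1))
  | .loz₃ p q => (1 / 3 : ℝ) • (f (p, q) + f (p + 1, q + 1) - f (p + 1, q) - f (p, q + 1))
  | .tri (.up p q) => (1 / 3 : ℝ) • (f (p + 1, q + 1) - f (p, q + 1))
  | .tri (.down p q) => (1 / 3 : ℝ) • (f (p, q) - f (p, q + 1))

/-- The weight `(f(B) + f(C) - f(D) + f(E) + f(F)) / 3` of the excavation hexagon `ABCDEF`. -/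
def hexagonWeight (n : ℕ) (v : ℕ × ℕ) (f : ℕ × ℕ → M) : M :=
  (1 / 3 : ℝ) • (f (0, v.2) + f (v.1, v.2 - v.1) - f (n + v.1 - v.2, v.2 - v.1)
    + f (n + v.1 - v.2, v.2) + f (v.1, n))

/-- The weight `w_Ξ` of a tiling. -/
def tilingWeight (n : ℕ) (v : ℕ × ℕ) (Ξ : Finset Tile) (f : ℕ × ℕ → M) : M :=
  ∑ t ∈ Ξ, t.weight f + hexagonWeight n v f

end Weights

/-! ### The family of linear functionals -/

theorem entry_add {n : ℕ} (g g' : GTArray n) (j k : ℕ) :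
    entry (g + g') j k = entry g j k + entry g' j k := by
  unfold entry; split_ifs <;> simp

theorem entry_smul {n : ℕ} (c : ℝ) (g : GTArray n) (j k : ℕ) :
    entry (c • g) j k = c * entry g j k := by
  unfold entry; split_ifs <;> simp

/-- The value of `k̃` at `p`, computed with `γ = 0`, as a linear functional of `(g₁, g₂)`. -/
def squareFunctional (n : ℕ) (p : ℕ × ℕ) : (GTArray n × GTArray n) →ₗ[ℝ] ℝ where
  toFun g := squareData 0 g.1 g.2 p
  map_add' g g' := by
    simp only [squareData, hiveOf, partialSum, rowSum, diagOf, Prod.fst_add, Prod.snd_add,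
      entry_add, Pi.add_apply, Pi.zero_apply, Finset.sum_add_distrib, Finset.sum_sub_distrib,
      Finset.sum_const_zero]
    split_ifs <;> ring
  map_smul' c g := by
    simp only [squareData, hiveOf, partialSum, rowSum, diagOf, Prod.smul_fst, Prod.smul_snd,
      entry_smul, Pi.add_apply, Pi.zero_apply, Finset.sum_add_distrib, Finset.sum_sub_distrib,
      Finset.sum_const_zero, ← Finset.mul_sum, RingHom.id_apply, smul_eq_mul]
    split_ifs <;> ring

/-- `v = (i,j)` lies in the interior of the square `{0, …, n}²`. -/
def IsInterior (n : ℕ) (v : ℕ × ℕ) : Prop := 0 < v.1 ∧ v.1 < n ∧ 0 < v.2 ∧ v.2 < n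

/-- The linear functional `w_Ξ` on pairs of triangular arrays. -/
def tilingFunctional (n : ℕ) (v : ℕ × ℕ) (Ξ : Finset Tile) : (GTArray n × GTArray n) →ₗ[ℝ] ℝ :=
  tilingWeight n v Ξ (squareFunctional n)

open Classical in
/-- The family `W_v`: for `v` in the interior of the square it consists of the `w_Ξ`, where `Ξ` runs
over the lozenge tilings of the excavation hexagon of `v`; for `v` on the boundary of the square it
consists of the single functional `k̃(v)`. -/
def excavationFamily (n : ℕ) (v : ℕ × ℕ) : Set ((GTArray n × GTArray n) →ₗ[ℝ] ℝ) :=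
  if IsInterior n v then {w | ∃ Ξ : Finset Tile, IsLozengeTiling n v Ξ ∧ w = tilingFunctional n v Ξ}
  else {squareFunctional n v}

end

end Excavation

namespace Excavation

/-! ### Surfaces and their matchings -/

/-! Place the point `[x,y,z,w]` of the tetrahedron at height `z + w` above `(x + w, y + w)`. The
rule then says that the two values at heights `t` and `t + 2` above `(a, b)` add up to the maximum
of north plus south and east plus west at height `t + 1`. The data `k̃` lie on the surface `|a + b -
n|`, the number `h(v)` is the value at height `n + i - j` above `v = (i, j)`, and the excavation
hexagon is the region where the downward light cone of this point is not below the initial surface.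

The proof is a tropical version of Speyer's matching method. A lattice surface `H` has a dual graph:
a unit square with two level diagonals is one vertex, any other square is two vertices joined across
its level diagonal. A perfect matching is recorded by the horizontal and vertical lattice edges that
it crosses, with fixed values outside the hexagon. Its exponent at an interior lattice point is half
the number of unmatched minus matched edges around that point, minus one; at four corners of the
hexagon there is a correction. The weight is the sum of value times exponent (the code doubles
exponents and weights to stay in `ℤ`).

The maximal weight is the same for all surfaces between the initial surface and the light cone.
Raising `H` by 2 at a local minimum changes only the four lattice edges there, and the recurrence is
exactly what makes the best weights agree (`exists_raise`, `exists_lower`, `IsMaxWeight.of_raise`).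
Any surface can be raised in this way up to the envelope `topHeight`. There only the frozen matching
is left (`IsMatched.eq_frozen`), and it has exponent one at `v` and zero elsewhere
(`exponent_topHeight`), so the maximum is `h(v)`.

Matchings of the initial surface are lozenge tilings: a crossed lattice edge or level diagonal is
the short diagonal of a lozenge, and a square on the equator is a single vertex, so that one of its
triangles lies in a lozenge and the other is a border triangle. Weights correspond by
`IsTilingIndicator.exponent_eq`. The result is `isGreatest_tilingWeight`, valid for arbitrary data
on the square.

Applied to the contribution of `γ` alone, for which the recurrence is linear and returns 0 at `v`,
this bound also shows that all tiling weights of that contribution vanish (`tilingWeight_gapData`),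
which is the independence of `γ`. -/

/-- The height `|a + b - n|` of the initial surface of the octahedron recurrence. -/
noncomputable def startHeight (n a b : ℤ) : ℤ := max (a + b - n) (n - a - b)

/-- The height of the downward light cone of the point above `(i, j)`. -/
noncomputable def coneHeight (n i j a b : ℤ) : ℤ :=
  n + i - j - max (a - i) (i - a) - max (b - j) (j - b)

/-- Membership in the excavation hexagon, in integer coordinates. -/
def InHex (n i j a b : ℤ) : Prop :=
  0 ≤ a ∧ a ≤ n + i - j ∧ j - i ≤ b ∧ b ≤ n ∧ j ≤ a + b ∧ a + b ≤ n + i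

instance (n i j a b : ℤ) : Decidable (InHex n i j a b) := by unfold InHex; infer_instance

/-- The horizontal lattice edge from `(a, b)` to `(a + 1, b)` lies inside the hexagon. -/
def HorizontalInner (n i j a b : ℤ) : Prop :=
  0 ≤ a ∧ a + 1 ≤ n + i - j ∧ j - i < b ∧ b < n ∧ j ≤ a + b ∧ a + 1 + b ≤ n + i

/-- The vertical lattice edge from `(a, b)` to `(a, b + 1)` lies inside the hexagon. -/
def VerticalInner (n i j a b : ℤ) : Prop :=
  0 < a ∧ a < n + i - j ∧ j - i ≤ b ∧ b + 1 ≤ n ∧ j ≤ a + b ∧ a + b + 1 ≤ n + i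

instance (n i j a b : ℤ) : Decidable (HorizontalInner n i j a b) := by
  unfold HorizontalInner; infer_instance

instance (n i j a b : ℤ) : Decidable (VerticalInner n i j a b) := by
  unfold VerticalInner; infer_instance

/-- The frozen values of a matching on the vertical lattice edges outside the hexagon. -/
def frozenVertical (n i j a b : ℤ) : ℤ :=
  if (a + b = j - 1 ∧ 0 ≤ a ∧ a < i) ∨ (a + b = n + i ∧ i < a ∧ a ≤ n + i - j) then 1 else 0

/-- The unit square with lower left corner `(a, b)` has a triangle inside the hexagon. -/
def MeetsHex (n i j a b : ℤ) : Prop :=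
  InHex n i j (a + 1) b ∧ InHex n i j a (b + 1) ∧ (InHex n i j a b ∨ InHex n i j (a + 1) (b + 1))

/-- The matching condition in a unit square with the given heights of its corners and the given
indicators of its bottom, right, top and left edge. If opposite corners have equal heights, the
square is one vertex of the graph dual to the surface; otherwise it consists of two vertices joined
by the edge dual to the level diagonal. -/
def SquareMatched (hsw hse hne hnw s e t w : ℤ) : Prop :=
  (hsw = hne → hse = hnw → s + e + t + w = 1) ∧
  (hsw ≠ hne → s + w = t + e ∧ s + w ≤ 1) ∧
  (hse ≠ hnw → s + e = t + w ∧ s + e ≤ 1)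

/-- `X` and `Y` are the indicators of the horizontal and vertical lattice edges crossed by a perfect
matching of the graph dual to the surface `H` inside the hexagon. -/
structure IsMatched (n i j : ℤ) (H X Y : ℤ → ℤ → ℤ) : Prop where
  bitX : ∀ a b, X a b = 0 ∨ X a b = 1
  bitY : ∀ a b, Y a b = 0 ∨ Y a b = 1
  outerX : ∀ a b, ¬ HorizontalInner n i j a b → X a b = 0
  outerY : ∀ a b, ¬ VerticalInner n i j a b → Y a b = frozenVertical n i j a b
  square : ∀ a b, MeetsHex n i j a b →
    SquareMatched (H a b) (H (a + 1) b) (H (a + 1) (b + 1)) (H a (b + 1))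
      (X a b) (Y (a + 1) b) (X a (b + 1)) (Y a b)

/-- The number of matched lattice edges of the unit square with lower left corner `(a, b)`. -/
def squareTotal (X Y : ℤ → ℤ → ℤ) (a b : ℤ) : ℤ := X a b + X a (b + 1) + Y a b + Y (a + 1) b

/-- The correction of the exponents in four corners of the hexagon. -/
def cornerTerm (n i j a b : ℤ) : ℤ :=
  (if (a = 0 ∧ b = j) ∨ (a = n + i - j ∧ b = j) then 2 else 0) -
  (if (a = 0 ∧ b = n) ∨ (a = n + i - j ∧ b = j - i) then 2 else 0)

/-- Twice the exponent with which a matching contributes to the point `(a, b)`. -/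
def exponent (n i j : ℤ) (H X Y : ℤ → ℤ → ℤ) (a b : ℤ) : ℤ :=
  cornerTerm n i j a b + 2 - 2 * X a b - 2 * X (a - 1) b - 2 * Y a b - 2 * Y a (b - 1)
  + (if H (a + 1) b = H a (b + 1) then 0 else squareTotal X Y a b - 1)
  + (if H (a - 1) b = H a (b + 1) then 0 else squareTotal X Y (a - 1) b - 1)
  + (if H (a - 1) b = H a (b - 1) then 0 else squareTotal X Y (a - 1) (b - 1) - 1)
  + (if H (a + 1) b = H a (b - 1) then 0 else squareTotal X Y a (b - 1) - 1)

/-- The lattice points of the hexagon. -/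
noncomputable def hexFinset (n i j : ℤ) : Finset (ℤ × ℤ) :=
  (Finset.Icc 0 n ×ˢ Finset.Icc 0 n).filter fun p => InHex n i j p.1 p.2

theorem mem_hexFinset {n i j : ℤ} (hij : i ≤ j) {a b : ℤ} :
    (a, b) ∈ hexFinset n i j ↔ InHex n i j a b := by
  simp only [hexFinset, Finset.mem_filter, Finset.mem_product, Finset.mem_Icc,
      and_iff_right_iff_imp]
  unfold InHex
  omega

/-- Twice the weight of a matching. -/
noncomputable def matchingWeight (n i j : ℤ) (F : ℤ → ℤ → ℝ) (H X Y : ℤ → ℤ → ℤ) : ℝ :=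
  ∑ p ∈ hexFinset n i j, F p.1 p.2 * exponent n i j H X Y p.1 p.2

/-- `H` is a surface between the initial surface and the light cone of the point above `(i, j)`. -/
structure IsSurface (n i j : ℤ) (H : ℤ → ℤ → ℤ) : Prop where
  lower : ∀ a b, startHeight n a b ≤ H a b
  upper : ∀ a b, H a b ≤ max (startHeight n a b) (coneHeight n i j a b)
  parity : ∀ a b, 2 ∣ H a b - (a + b - n)
  stepX : ∀ a b, H (a + 1) b = H a b + 1 ∨ H (a + 1) b = H a b - 1
  stepY : ∀ a b, H a (b + 1) = H a b + 1 ∨ H a (b + 1) = H a b - 1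

/-- `(a, b)` lies in the interior of the hexagon. -/
def InHexInterior (n i j a b : ℤ) : Prop :=
  0 < a ∧ a < n + i - j ∧ j - i < b ∧ b < n ∧ j < a + b ∧ a + b < n + i

/-- Room to raise at a point means that the cone exceeds the initial surface there by at least 2.
This forces the point strictly inside the hexagon, so that a move never touches the frozen edges. -/
theorem IsSurface.interior {n i j : ℤ} (hi : 0 < i) (hj : j < n) {H : ℤ → ℤ → ℤ}
    (hH : IsSurface n i j H) {a b : ℤ}
    (h : H a b + 2 ≤ max (startHeight n a b) (coneHeight n i j a b)) :
    InHexInterior n i j a b := by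
  have := hH.lower a b
  unfold startHeight coneHeight at *
  unfold InHexInterior
  omega

/-! ### Raising a surface at a local minimum -/

/-- The configurations `(H, X, Y)` and `(H', X', Y')` differ at most in the height of `(a, b)` and
in the four lattice edges at `(a, b)`. -/
structure AgreeOff (a b : ℤ) (H X Y H' X' Y' : ℤ → ℤ → ℤ) : Prop where
  height : ∀ c d, ¬ (c = a ∧ d = b) → H' c d = H c d
  horizontal : ∀ c d, ¬ (d = b ∧ (c = a ∨ c = a - 1)) → X' c d = X c d
  vertical : ∀ c d, ¬ (c = a ∧ (d = b ∨ d = b - 1)) → Y' c d = Y c d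

/-- The matching conditions in the four squares at `(a, b)`. -/
structure StarMatched (H X Y : ℤ → ℤ → ℤ) (a b : ℤ) : Prop where
  ne : SquareMatched (H a b) (H (a + 1) b) (H (a + 1) (b + 1)) (H a (b + 1))
    (X a b) (Y (a + 1) b) (X a (b + 1)) (Y a b)
  nw : SquareMatched (H (a - 1) b) (H a b) (H a (b + 1)) (H (a - 1) (b + 1))
    (X (a - 1) b) (Y a b) (X (a - 1) (b + 1)) (Y (a - 1) b)
  sw : SquareMatched (H (a - 1) (b - 1)) (H a (b - 1)) (H a b) (H (a - 1) b)
    (X (a - 1) (b - 1)) (Y a (b - 1)) (X (a - 1) b) (Y (a - 1) (b - 1))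
  se : SquareMatched (H a (b - 1)) (H (a + 1) (b - 1)) (H (a + 1) b) (H a b)
    (X a (b - 1)) (Y (a + 1) (b - 1)) (X a b) (Y a (b - 1))

theorem IsMatched.star {n i j : ℤ} {H X Y : ℤ → ℤ → ℤ} (h : IsMatched n i j H X Y) {a b : ℤ}
    (hab : InHexInterior n i j a b) : StarMatched H X Y a b := by
  have h1 := h.square a b (by unfold MeetsHex InHex; unfold InHexInterior at hab; omega)
  have h2 := h.square (a - 1) b (by unfold MeetsHex InHex; unfold InHexInterior at hab; omega)
  have h3 := h.square (a - 1) (b - 1) (by unfold MeetsHex InHex; unfold InHexInterior at hab; omega)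
  have h4 := h.square a (b - 1) (by unfold MeetsHex InHex; unfold InHexInterior at hab; omega)
  simp only [sub_add_cancel] at h2 h3 h4
  exact ⟨h1, h2, h3, h4⟩

/-- Only the four squares at `(a, b)` see the change, and all four edges at an interior point are
inner edges, so the outer conditions survive. -/
theorem IsMatched.transfer {n i j : ℤ} {H X Y H' X' Y' : ℤ → ℤ → ℤ} (h : IsMatched n i j H X Y)
    {a b : ℤ} (hab : InHexInterior n i j a b) (hag : AgreeOff a b H X Y H' X' Y')
    (hst : StarMatched H' X' Y' a b)
    (he : X' a b = 0 ∨ X' a b = 1) (hw : X' (a - 1) b = 0 ∨ X' (a - 1) b = 1)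
    (hn : Y' a b = 0 ∨ Y' a b = 1) (hs : Y' a (b - 1) = 0 ∨ Y' a (b - 1) = 1) :
    IsMatched n i j H' X' Y' := by
  refine ⟨fun c d => ?_, fun c d => ?_, fun c d hcd => ?_, fun c d hcd => ?_, fun c d hcd => ?_⟩
  · by_cases hc : d = b ∧ (c = a ∨ c = a - 1)
    · obtain ⟨rfl, rfl | rfl⟩ := hc <;> assumption
    · rw [hag.horizontal c d hc]; exact h.bitX c d
  · by_cases hc : c = a ∧ (d = b ∨ d = b - 1)
    · obtain ⟨rfl, rfl | rfl⟩ := hc <;> assumption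
    · rw [hag.vertical c d hc]; exact h.bitY c d
  · rw [hag.horizontal c d, h.outerX c d hcd]
    unfold HorizontalInner at hcd; unfold InHexInterior at hab; omega
  · rw [hag.vertical c d, h.outerY c d hcd]
    unfold VerticalInner at hcd; unfold InHexInterior at hab; omega
  · by_cases h1 : c = a ∧ d = b
    · obtain ⟨rfl, rfl⟩ := h1; exact hst.ne
    by_cases h2 : c = a - 1 ∧ d = b
    · obtain ⟨rfl, rfl⟩ := h2; simpa only [sub_add_cancel] using hst.nw
    by_cases h3 : c = a - 1 ∧ d = b - 1
    · obtain ⟨rfl, rfl⟩ := h3; simpa only [sub_add_cancel] using hst.sw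
    by_cases h4 : c = a ∧ d = b - 1
    · obtain ⟨rfl, rfl⟩ := h4; simpa only [sub_add_cancel] using hst.se
    rw [hag.height c d (by omega), hag.height (c + 1) d (by omega),
      hag.height (c + 1) (d + 1) (by omega), hag.height c (d + 1) (by omega),
      hag.horizontal c d (by omega), hag.horizontal c (d + 1) (by omega),
      hag.vertical c d (by omega), hag.vertical (c + 1) d (by omega)]
    exact h.square c d hcd

/-- The height of `(a, b)` is smaller by one than the heights of its neighbours. -/
structure IsLocalMin (H : ℤ → ℤ → ℤ) (a b : ℤ) : Prop where
  east : H (a + 1) b = H a b + 1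
  west : H (a - 1) b = H a b + 1
  north : H a (b + 1) = H a b + 1
  south : H a (b - 1) = H a b + 1

/-- The heights of the corner points opposite to a local minimum of a surface. -/
structure CornerHeights (H : ℤ → ℤ → ℤ) (a b : ℤ) : Prop where
  ne : H (a + 1) (b + 1) = H a b ∨ H (a + 1) (b + 1) = H a b + 2
  nw : H (a - 1) (b + 1) = H a b ∨ H (a - 1) (b + 1) = H a b + 2
  sw : H (a - 1) (b - 1) = H a b ∨ H (a - 1) (b - 1) = H a b + 2
  se : H (a + 1) (b - 1) = H a b ∨ H (a + 1) (b - 1) = H a b + 2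

theorem IsSurface.cornerHeights {n i j : ℤ} {H : ℤ → ℤ → ℤ} (hH : IsSurface n i j H) {a b : ℤ}
    (hm : IsLocalMin H a b) : CornerHeights H a b := by
  obtain ⟨h1, h2, h3, h4⟩ := hm
  have e1 := hH.stepY (a + 1) b
  have e2 := hH.stepY (a - 1) b
  have e3 := hH.stepY (a + 1) (b - 1)
  have e4 := hH.stepY (a - 1) (b - 1)
  simp only [sub_add_cancel] at e3 e4
  constructor <;> omega

/-- The four squares at `(a, b)` also meet the diagonally adjacent points, but they enter the
exponent there only through a diagonal ending at `(a, b)`. As the neighbours of a local minimum have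
equal heights, that term is zero before and after the move. -/
theorem exponent_eq_of_agreeOff {n i j : ℤ} {H X Y H' X' Y' : ℤ → ℤ → ℤ} {a b : ℤ}
    (hm : IsLocalMin H a b) (hag : AgreeOff a b H X Y H' X' Y') {c d : ℤ}
    (h0 : ¬ (c = a ∧ d = b)) (hE : ¬ (c = a + 1 ∧ d = b)) (hW : ¬ (c = a - 1 ∧ d = b))
    (hN : ¬ (c = a ∧ d = b + 1)) (hS : ¬ (c = a ∧ d = b - 1)) :
    exponent n i j H' X' Y' c d = exponent n i j H X Y c d := by
  obtain ⟨m1, m2, m3, m4⟩ := hm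
  unfold exponent
  rw [hag.height (c + 1) d (by omega), hag.height (c - 1) d (by omega),
    hag.height c (d + 1) (by omega), hag.height c (d - 1) (by omega),
    hag.horizontal c d (by omega), hag.horizontal (c - 1) d (by omega),
    hag.vertical c d (by omega), hag.vertical c (d - 1) (by omega)]
  have key : ∀ x y, ¬ (x = a ∧ y = b) → ¬ (x = a - 1 ∧ y = b) → ¬ (x = a ∧ y = b - 1) →
      ¬ (x = a - 1 ∧ y = b - 1) → squareTotal X' Y' x y = squareTotal X Y x y := by
    intro x y _ _ _ _
    unfold squareTotal
    rw [hag.horizontal x y (by omega), hag.horizontal x (y + 1) (by omega),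
      hag.vertical x y (by omega), hag.vertical (x + 1) y (by omega)]
  congr 1
  · congr 1
    · congr 1
      · congr 1
        split_ifs with hh
        · rfl
        · rw [key]
          all_goals (try omega)
          rintro ⟨rfl, rfl⟩
          simp only [sub_add_cancel] at *
          omega
      · split_ifs with hh
        · rfl
        · rw [key]
          all_goals (try omega)
          rintro ⟨hx, rfl⟩
          obtain rfl : c = a + 1 := by omega
          simp only [sub_add_cancel, add_sub_cancel_right] at *
          omega
    · split_ifs with hh
      · rfl
      · rw [key]
        all_goals (try omega)
        rintro ⟨hx, hy⟩
        obtain rfl : c = a + 1 := by omega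
        obtain rfl : d = b + 1 := by omega
        simp only [add_sub_cancel_right] at *
        omega
  · split_ifs with hh
    · rfl
    · rw [key]
      all_goals (try omega)
      rintro ⟨rfl, hy⟩
      obtain rfl : d = b + 1 := by omega
      simp only [sub_add_cancel, add_sub_cancel_right] at *
      omega

/-- The four lattice edges at `(a, b)` in `(X', Y')` are complementary to those in `(X, Y)`: in each
square, exactly one of the four edges at `(a, b)` is matched by one of the two configurations. -/
structure Complementary (X Y X' Y' : ℤ → ℤ → ℤ) (a b : ℤ) : Prop where
  ne : X' a b + Y' a b = 1 - (X a b + Y a b)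
  nw : X' (a - 1) b + Y' a b = 1 - (X (a - 1) b + Y a b)
  sw : X' (a - 1) b + Y' a (b - 1) = 1 - (X (a - 1) b + Y a (b - 1))
  se : X' a b + Y' a (b - 1) = 1 - (X a b + Y a (b - 1))

/-- The indicators of the four lattice edges at `(a, b)` are `0` or `1`. -/
structure StarBits (X Y : ℤ → ℤ → ℤ) (a b : ℤ) : Prop where
  e : X a b = 0 ∨ X a b = 1
  w : X (a - 1) b = 0 ∨ X (a - 1) b = 1
  n : Y a b = 0 ∨ Y a b = 1
  s : Y a (b - 1) = 0 ∨ Y a (b - 1) = 1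

theorem StarBits.nonneg {X Y : ℤ → ℤ → ℤ} {a b : ℤ} (h : StarBits X Y a b) :
    0 ≤ X a b ∧ 0 ≤ X (a - 1) b ∧ 0 ≤ Y a b ∧ 0 ≤ Y a (b - 1) := by
  obtain ⟨h1, h2, h3, h4⟩ := h
  refine ⟨?_, ?_, ?_, ?_⟩ <;> omega

theorem squareMatched_of_flat {hsw hse hne hnw s e t w : ℤ} (h1 : hsw = hne) (h2 : hse = hnw) :
    SquareMatched hsw hse hne hnw s e t w ↔ s + e + t + w = 1 :=
  ⟨fun h => h.1 h1 h2, fun h => ⟨fun _ _ => h, fun h' => absurd h1 h', fun h' => absurd h2 h'⟩⟩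

theorem squareMatched_of_ne_left {hsw hse hne hnw s e t w : ℤ} (h1 : hsw ≠ hne) (h2 : hse = hnw) :
    SquareMatched hsw hse hne hnw s e t w ↔ s + w = t + e ∧ s + w ≤ 1 :=
  ⟨fun h => h.2.1 h1, fun h => ⟨fun h' => absurd h' h1, fun _ => h, fun h' => absurd h2 h'⟩⟩

theorem squareMatched_of_ne_right {hsw hse hne hnw s e t w : ℤ} (h1 : hsw = hne) (h2 : hse ≠ hnw) :
    SquareMatched hsw hse hne hnw s e t w ↔ s + e = t + w ∧ s + e ≤ 1 :=
  ⟨fun h => h.2.2 h2, fun h => ⟨fun _ h' => absurd h' h2, fun h' => absurd h1 h', fun _ => h⟩⟩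

/-- Raising the point turns each flat square at it into a split one and conversely. With the two far
edges of the square kept, the condition `s + e + t + w = 1` becomes an equality between near and far
edges, and the complementary near edges satisfy one exactly when the old edges satisfy the other. -/
theorem starMatched_iff {H X Y H' X' Y' : ℤ → ℤ → ℤ} {a b : ℤ}
    (hm : IsLocalMin H a b) (hc : CornerHeights H a b) (hag : AgreeOff a b H X Y H' X' Y')
    (hr : H' a b = H a b + 2) (hco : Complementary X Y X' Y' a b)
    (hb : StarBits X Y a b) (hb' : StarBits X' Y' a b) :
    StarMatched H X Y a b ↔ StarMatched H' X' Y' a b := by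
  obtain ⟨m1, m2, m3, m4⟩ := hm
  obtain ⟨k1, k2, k3, k4⟩ := hco
  obtain ⟨b1, b2, b3, b4⟩ := hb.nonneg
  obtain ⟨c1, c2, c3, c4⟩ := hb'.nonneg
  have hE := hag.height (a + 1) b (by omega)
  have hW := hag.height (a - 1) b (by omega)
  have hN := hag.height a (b + 1) (by omega)
  have hS := hag.height a (b - 1) (by omega)
  have ne : SquareMatched (H a b) (H (a + 1) b) (H (a + 1) (b + 1)) (H a (b + 1))
        (X a b) (Y (a + 1) b) (X a (b + 1)) (Y a b) ↔
      SquareMatched (H' a b) (H' (a + 1) b) (H' (a + 1) (b + 1)) (H' a (b + 1))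
        (X' a b) (Y' (a + 1) b) (X' a (b + 1)) (Y' a b) := by
    rw [hE, hN, hr, hag.height (a + 1) (b + 1) (by omega), hag.horizontal a (b + 1) (by omega),
      hag.vertical (a + 1) b (by omega)]
    rcases hc.ne with h | h
    · rw [squareMatched_of_flat (by omega) (by omega),
        squareMatched_of_ne_left (by omega) (by omega)]
      omega
    · rw [squareMatched_of_ne_left (by omega) (by omega),
        squareMatched_of_flat (by omega) (by omega)]
      omega
  have nw : SquareMatched (H (a - 1) b) (H a b) (H a (b + 1)) (H (a - 1) (b + 1))
        (X (a - 1) b) (Y a b) (X (a - 1) (b + 1)) (Y (a - 1) b) ↔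
      SquareMatched (H' (a - 1) b) (H' a b) (H' a (b + 1)) (H' (a - 1) (b + 1))
        (X' (a - 1) b) (Y' a b) (X' (a - 1) (b + 1)) (Y' (a - 1) b) := by
    rw [hW, hN, hr, hag.height (a - 1) (b + 1) (by omega),
      hag.horizontal (a - 1) (b + 1) (by omega), hag.vertical (a - 1) b (by omega)]
    rcases hc.nw with h | h
    · rw [squareMatched_of_flat (by omega) (by omega),
        squareMatched_of_ne_right (by omega) (by omega)]
      omega
    · rw [squareMatched_of_ne_right (by omega) (by omega),
        squareMatched_of_flat (by omega) (by omega)]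
      omega
  have sw : SquareMatched (H (a - 1) (b - 1)) (H a (b - 1)) (H a b) (H (a - 1) b)
        (X (a - 1) (b - 1)) (Y a (b - 1)) (X (a - 1) b) (Y (a - 1) (b - 1)) ↔
      SquareMatched (H' (a - 1) (b - 1)) (H' a (b - 1)) (H' a b) (H' (a - 1) b)
        (X' (a - 1) (b - 1)) (Y' a (b - 1)) (X' (a - 1) b) (Y' (a - 1) (b - 1)) := by
    rw [hW, hS, hr, hag.height (a - 1) (b - 1) (by omega),
      hag.horizontal (a - 1) (b - 1) (by omega), hag.vertical (a - 1) (b - 1) (by omega)]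
    rcases hc.sw with h | h
    · rw [squareMatched_of_flat (by omega) (by omega),
        squareMatched_of_ne_left (by omega) (by omega)]
      omega
    · rw [squareMatched_of_ne_left (by omega) (by omega),
        squareMatched_of_flat (by omega) (by omega)]
      omega
  have se : SquareMatched (H a (b - 1)) (H (a + 1) (b - 1)) (H (a + 1) b) (H a b)
        (X a (b - 1)) (Y (a + 1) (b - 1)) (X a b) (Y a (b - 1)) ↔
      SquareMatched (H' a (b - 1)) (H' (a + 1) (b - 1)) (H' (a + 1) b) (H' a b)
        (X' a (b - 1)) (Y' (a + 1) (b - 1)) (X' a b) (Y' a (b - 1)) := by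
    rw [hE, hS, hr, hag.height (a + 1) (b - 1) (by omega), hag.horizontal a (b - 1) (by omega),
      hag.vertical (a + 1) (b - 1) (by omega)]
    rcases hc.se with h | h
    · rw [squareMatched_of_flat (by omega) (by omega),
        squareMatched_of_ne_right (by omega) (by omega)]
      omega
    · rw [squareMatched_of_ne_right (by omega) (by omega),
        squareMatched_of_flat (by omega) (by omega)]
      omega
  constructor
  · rintro ⟨h1, h2, h3, h4⟩
    exact ⟨ne.1 h1, nw.1 h2, sw.1 h3, se.1 h4⟩
  · rintro ⟨h1, h2, h3, h4⟩
    exact ⟨ne.2 h1, nw.2 h2, sw.2 h3, se.2 h4⟩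

/-- When the neighbours have equal heights, the two edges at `(a, b)` in a common square end at the
same dual vertex, so at most one of them is matched. -/
theorem StarMatched.sum_le {H X Y : ℤ → ℤ → ℤ} {a b : ℤ} (h : StarMatched H X Y a b)
    (bitX : ∀ a b, X a b = 0 ∨ X a b = 1) (bitY : ∀ a b, Y a b = 0 ∨ Y a b = 1)
    (hE : H (a + 1) b = H a (b + 1)) (hW : H (a - 1) b = H a (b + 1))
    (hS : H a (b - 1) = H a (b + 1)) :
    X a b + Y a b ≤ 1 ∧ X (a - 1) b + Y a b ≤ 1 ∧ X (a - 1) b + Y a (b - 1) ≤ 1 ∧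
      X a b + Y a (b - 1) ≤ 1 := by
  have nonneg : ∀ {x : ℤ}, x = 0 ∨ x = 1 → 0 ≤ x := by intro x hx; omega
  have x1 := nonneg (bitX a (b + 1))
  have x2 := nonneg (bitX (a - 1) (b + 1))
  have x3 := nonneg (bitX a (b - 1))
  have x4 := nonneg (bitX (a - 1) (b - 1))
  have y1 := nonneg (bitY (a + 1) b)
  have y2 := nonneg (bitY (a - 1) b)
  have y3 := nonneg (bitY (a + 1) (b - 1))
  have y4 := nonneg (bitY (a - 1) (b - 1))
  refine ⟨?_, ?_, ?_, ?_⟩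
  · by_cases hd : H a b = H (a + 1) (b + 1)
    · have := (squareMatched_of_flat hd hE).1 h.ne; omega
    · have := (squareMatched_of_ne_left hd hE).1 h.ne; omega
  · by_cases hd : H a b = H (a - 1) (b + 1)
    · have := (squareMatched_of_flat hW hd).1 h.nw; omega
    · have := (squareMatched_of_ne_right hW hd).1 h.nw; omega
  · by_cases hd : H (a - 1) (b - 1) = H a b
    · have := (squareMatched_of_flat hd (hS.trans hW.symm)).1 h.sw; omega
    · have := (squareMatched_of_ne_left hd (hS.trans hW.symm)).1 h.sw; omega
  · by_cases hd : H (a + 1) (b - 1) = H a b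
    · have := (squareMatched_of_flat (hS.trans hE.symm) hd).1 h.se; omega
    · have := (squareMatched_of_ne_right (hS.trans hE.symm) hd).1 h.se; omega

/-- No level diagonal ends at a point whose four neighbours have equal heights, so only the four
lattice edges count. -/
theorem exponent_center {n i j : ℤ} {H X Y : ℤ → ℤ → ℤ} {a b : ℤ} (hab : InHexInterior n i j a b)
    (hE : H (a + 1) b = H a (b + 1)) (hW : H (a - 1) b = H a (b + 1))
    (hS : H a (b - 1) = H a (b + 1)) :
    exponent n i j H X Y a b =
      2 * (1 - (X a b + X (a - 1) b + Y a b + Y a (b - 1))) := by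
  unfold exponent cornerTerm
  unfold InHexInterior at hab
  rw [if_neg (by omega), if_neg (by omega), if_pos hE, if_pos hW, if_pos (hW.trans hS.symm),
    if_pos (hE.trans hS.symm)]
  ring

/-- The change of the exponents at the four neighbours of the raised point. -/
structure NeighbourChange (n i j a b : ℤ) (H X Y H' X' Y' : ℤ → ℤ → ℤ) : Prop where
  east : exponent n i j H' X' Y' (a + 1) b - exponent n i j H X Y (a + 1) b =
    2 * (1 - X' a b - X a b - Y a b - Y a (b - 1))
  west : exponent n i j H' X' Y' (a - 1) b - exponent n i j H X Y (a - 1) b =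
    2 * (1 - X' (a - 1) b - X (a - 1) b - Y a b - Y a (b - 1))
  north : exponent n i j H' X' Y' a (b + 1) - exponent n i j H X Y a (b + 1) =
    2 * (1 - Y' a b - Y a b - X a b - X (a - 1) b)
  south : exponent n i j H' X' Y' a (b - 1) - exponent n i j H X Y a (b - 1) =
    2 * (1 - Y' a (b - 1) - Y a (b - 1) - X a b - X (a - 1) b)

/-- The diagonal joining two neighbours of `(a, b)` appears or disappears with the raise. In either
case its term changes by `1 - 2 * (sum of the two near edges)`; each neighbour collects two such
changes and that of its edge to `(a, b)`. -/
theorem neighbourChange {n i j : ℤ} {H X Y H' X' Y' : ℤ → ℤ → ℤ} {a b : ℤ}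
    (hm : IsLocalMin H a b) (hc : CornerHeights H a b) (hag : AgreeOff a b H X Y H' X' Y')
    (hr : H' a b = H a b + 2) (hco : Complementary X Y X' Y' a b)
    (hst : StarMatched H X Y a b) : NeighbourChange n i j a b H X Y H' X' Y' := by
  obtain ⟨m1, m2, m3, m4⟩ := hm
  obtain ⟨k1, k2, k3, k4⟩ := hco
  obtain ⟨s1, s2, s3, s4⟩ := hst
  have ne : (if H' a b = H' (a + 1) (b + 1) then 0 else squareTotal X' Y' a b - 1) =
      (if H a b = H (a + 1) (b + 1) then 0 else squareTotal X Y a b - 1) +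
        1 - 2 * (X a b + Y a b) := by
    unfold squareTotal
    rw [hr, hag.height (a + 1) (b + 1) (by omega), hag.horizontal a (b + 1) (by omega),
      hag.vertical (a + 1) b (by omega)]
    rcases hc.ne with h | h
    · rw [squareMatched_of_flat (by omega) (by omega)] at s1
      rw [if_neg (by omega), if_pos h.symm]
      omega
    · rw [squareMatched_of_ne_left (by omega) (by omega)] at s1
      rw [if_pos h.symm, if_neg (by omega)]
      omega
  have nw : (if H' a b = H' (a - 1) (b + 1) then 0 else squareTotal X' Y' (a - 1) b - 1) =
      (if H a b = H (a - 1) (b + 1) then 0 else squareTotal X Y (a - 1) b - 1) +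
        1 - 2 * (X (a - 1) b + Y a b) := by
    unfold squareTotal
    simp only [sub_add_cancel]
    rw [hr, hag.height (a - 1) (b + 1) (by omega), hag.horizontal (a - 1) (b + 1) (by omega),
      hag.vertical (a - 1) b (by omega)]
    rcases hc.nw with h | h
    · rw [squareMatched_of_flat (by omega) (by omega)] at s2
      rw [if_neg (by omega), if_pos h.symm]
      omega
    · rw [squareMatched_of_ne_right (by omega) (by omega)] at s2
      rw [if_pos h.symm, if_neg (by omega)]
      omega
  have sw : (if H' a b = H' (a - 1) (b - 1) then 0 else squareTotal X' Y' (a - 1) (b - 1) - 1) =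
      (if H a b = H (a - 1) (b - 1) then 0 else squareTotal X Y (a - 1) (b - 1) - 1) +
        1 - 2 * (X (a - 1) b + Y a (b - 1)) := by
    unfold squareTotal
    simp only [sub_add_cancel]
    rw [hr, hag.height (a - 1) (b - 1) (by omega), hag.horizontal (a - 1) (b - 1) (by omega),
      hag.vertical (a - 1) (b - 1) (by omega)]
    rcases hc.sw with h | h
    · rw [squareMatched_of_flat (by omega) (by omega)] at s3
      rw [if_neg (by omega), if_pos h.symm]
      omega
    · rw [squareMatched_of_ne_left (by omega) (by omega)] at s3
      rw [if_pos h.symm, if_neg (by omega)]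
      omega
  have se : (if H' a b = H' (a + 1) (b - 1) then 0 else squareTotal X' Y' a (b - 1) - 1) =
      (if H a b = H (a + 1) (b - 1) then 0 else squareTotal X Y a (b - 1) - 1) +
        1 - 2 * (X a b + Y a (b - 1)) := by
    unfold squareTotal
    simp only [sub_add_cancel]
    rw [hr, hag.height (a + 1) (b - 1) (by omega), hag.horizontal a (b - 1) (by omega),
      hag.vertical (a + 1) (b - 1) (by omega)]
    rcases hc.se with h | h
    · rw [squareMatched_of_flat (by omega) (by omega)] at s4
      rw [if_neg (by omega), if_pos h.symm]
      omega
    · rw [squareMatched_of_ne_right (by omega) (by omega)] at s4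
      rw [if_pos h.symm, if_neg (by omega)]
      omega
  have tot : ∀ x y, ¬ (x = a ∧ y = b) → ¬ (x = a - 1 ∧ y = b) → ¬ (x = a ∧ y = b - 1) →
      ¬ (x = a - 1 ∧ y = b - 1) → squareTotal X' Y' x y = squareTotal X Y x y := by
    intro x y _ _ _ _
    unfold squareTotal
    rw [hag.horizontal x y (by omega), hag.horizontal x (y + 1) (by omega),
      hag.vertical x y (by omega), hag.vertical (x + 1) y (by omega)]
  constructor
  · unfold exponent
    simp only [add_sub_cancel_right]
    rw [ne, se, hag.height (a + 1 + 1) b (by omega), hag.height (a + 1) (b + 1) (by omega),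
      hag.height (a + 1) (b - 1) (by omega), hag.horizontal (a + 1) b (by omega),
      hag.vertical (a + 1) b (by omega), hag.vertical (a + 1) (b - 1) (by omega),
      tot (a + 1) b (by omega) (by omega) (by omega) (by omega),
      tot (a + 1) (b - 1) (by omega) (by omega) (by omega) (by omega)]
    ring
  · unfold exponent
    simp only [sub_add_cancel]
    rw [nw, sw, hag.height (a - 1 - 1) b (by omega), hag.height (a - 1) (b + 1) (by omega),
      hag.height (a - 1) (b - 1) (by omega), hag.horizontal (a - 1 - 1) b (by omega),
      hag.vertical (a - 1) b (by omega), hag.vertical (a - 1) (b - 1) (by omega),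
      tot (a - 1 - 1) b (by omega) (by omega) (by omega) (by omega),
      tot (a - 1 - 1) (b - 1) (by omega) (by omega) (by omega) (by omega)]
    ring
  · unfold exponent
    simp only [add_sub_cancel_right]
    simp only [eq_comm (a := H' (a + 1) (b + 1)) (b := H' a b),
      eq_comm (a := H' (a - 1) (b + 1)) (b := H' a b),
      eq_comm (a := H (a + 1) (b + 1)) (b := H a b),
      eq_comm (a := H (a - 1) (b + 1)) (b := H a b)]
    rw [ne, nw, hag.height a (b + 1 + 1) (by omega), hag.height (a + 1) (b + 1) (by omega),
      hag.height (a - 1) (b + 1) (by omega), hag.vertical a (b + 1) (by omega),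
      hag.horizontal a (b + 1) (by omega), hag.horizontal (a - 1) (b + 1) (by omega),
      tot a (b + 1) (by omega) (by omega) (by omega) (by omega),
      tot (a - 1) (b + 1) (by omega) (by omega) (by omega) (by omega)]
    ring
  · unfold exponent
    simp only [sub_add_cancel]
    simp only [eq_comm (a := H' (a + 1) (b - 1)) (b := H' a b),
      eq_comm (a := H' (a - 1) (b - 1)) (b := H' a b),
      eq_comm (a := H (a + 1) (b - 1)) (b := H a b),
      eq_comm (a := H (a - 1) (b - 1)) (b := H a b)]
    rw [se, sw, hag.height a (b - 1 - 1) (by omega), hag.height (a + 1) (b - 1) (by omega),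
      hag.height (a - 1) (b - 1) (by omega), hag.vertical a (b - 1 - 1) (by omega),
      hag.horizontal a (b - 1) (by omega), hag.horizontal (a - 1) (b - 1) (by omega),
      tot a (b - 1 - 1) (by omega) (by omega) (by omega) (by omega),
      tot (a - 1) (b - 1 - 1) (by omega) (by omega) (by omega) (by omega)]
    ring

/-- Half of the change of the weight of a matching when the surface is raised at a point, in terms
of the values of the function at this point and its neighbours and of the edges at this point. -/
def raiseChange (f f' fe fw fn fs : ℝ) (e w n s e' w' n' s' : ℤ) : ℝ :=
  f' * ((1 - (e' + w' + n' + s') : ℤ) : ℝ) - f * ((1 - (e + w + n + s) : ℤ) : ℝ)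
  + fe * ((1 - e' - e - n - s : ℤ) : ℝ) + fw * ((1 - w' - w - n - s : ℤ) : ℝ)
  + fn * ((1 - n' - n - e - w : ℤ) : ℝ) + fs * ((1 - s' - s - e - w : ℤ) : ℝ)

theorem matchingWeight_sub {n i j : ℤ} (hij : i ≤ j)
    {F F' : ℤ → ℤ → ℝ} {H X Y H' X' Y' : ℤ → ℤ → ℤ} {a b : ℤ} (hab : InHexInterior n i j a b)
    (hF : ∀ c d, ¬ (c = a ∧ d = b) → F' c d = F c d)
    (hm : IsLocalMin H a b) (hc : CornerHeights H a b) (hag : AgreeOff a b H X Y H' X' Y')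
    (hr : H' a b = H a b + 2) (hco : Complementary X Y X' Y' a b)
    (hst : StarMatched H X Y a b) :
    matchingWeight n i j F' H' X' Y' - matchingWeight n i j F H X Y =
      2 * raiseChange (F a b) (F' a b) (F (a + 1) b) (F (a - 1) b) (F a (b + 1)) (F a (b - 1))
        (X a b) (X (a - 1) b) (Y a b) (Y a (b - 1))
        (X' a b) (X' (a - 1) b) (Y' a b) (Y' a (b - 1)) := by
  obtain ⟨cE, cW, cN, cS⟩ := neighbourChange (n := n) (i := i) (j := j) hm hc hag hr hco hst
  have c0 := exponent_center (X := X) (Y := Y) hab (hm.east.trans hm.north.symm)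
    (hm.west.trans hm.north.symm) (hm.south.trans hm.north.symm)
  have c0' := exponent_center (H := H') (X := X') (Y := Y') hab
    (by rw [hag.height _ _ (by omega), hag.height _ _ (by omega), hm.east, hm.north])
    (by rw [hag.height _ _ (by omega), hag.height _ _ (by omega), hm.west, hm.north])
    (by rw [hag.height _ _ (by omega), hag.height _ _ (by omega), hm.south, hm.north])
  let S : Finset (ℤ × ℤ) := {(a, b), (a + 1, b), (a - 1, b), (a, b + 1), (a, b - 1)}
  have hS : S ⊆ hexFinset n i j := by
    intro p hp
    simp only [S, Finset.mem_insert, Finset.mem_singleton] at hp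
    unfold InHexInterior at hab
    rcases hp with rfl | rfl | rfl | rfl | rfl <;> rw [mem_hexFinset hij] <;> unfold InHex <;> omega
  unfold matchingWeight
  rw [← Finset.sum_sub_distrib, ← Finset.sum_subset hS]
  · rw [Finset.sum_insert, Finset.sum_insert, Finset.sum_insert, Finset.sum_insert,
      Finset.sum_singleton]
    · simp only
      rw [hF (a + 1) b (by omega), hF (a - 1) b (by omega), hF a (b + 1) (by omega),
        hF a (b - 1) (by omega), c0, c0', ← mul_sub, ← mul_sub, ← mul_sub, ← mul_sub,
        ← Int.cast_sub, ← Int.cast_sub, ← Int.cast_sub, ← Int.cast_sub, cE, cW, cN, cS]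
      unfold raiseChange
      push_cast
      ring
    all_goals simp only [Finset.mem_insert, Finset.mem_singleton, Prod.mk.injEq]; omega
  · rintro ⟨c, d⟩ - hp
    simp only [S, Finset.mem_insert, Finset.mem_singleton, Prod.mk.injEq, not_or] at hp
    obtain ⟨h0, h1, h2, h3, h4⟩ := hp
    simp only
    rw [hF c d h0, exponent_eq_of_agreeOff hm hag h0 h1 h2 h3 h4, sub_self]

/-! ### The tropical spider move -/

/-- The bounds leave seven local configurations: no edge, one edge, or two opposite edges. Fixing
the far edges prescribes the complement in each corner, and this determines the new edges except
when there were none. -/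
theorem exists_raise {f f' fe fw fn fs : ℝ} (hf : f' = max (fn + fs) (fe + fw) - f)
    {e w n s : ℤ} (he : e = 0 ∨ e = 1) (hw : w = 0 ∨ w = 1) (hn : n = 0 ∨ n = 1)
    (hs : s = 0 ∨ s = 1) (h : e + n ≤ 1 ∧ w + n ≤ 1 ∧ w + s ≤ 1 ∧ e + s ≤ 1) :
    ∃ e' w' n' s' : ℤ, (e' = 0 ∨ e' = 1) ∧ (w' = 0 ∨ w' = 1) ∧ (n' = 0 ∨ n' = 1) ∧
      (s' = 0 ∨ s' = 1) ∧ e' + n' = 1 - (e + n) ∧ w' + n' = 1 - (w + n) ∧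
      w' + s' = 1 - (w + s) ∧ e' + s' = 1 - (e + s) ∧
      0 ≤ raiseChange f f' fe fw fn fs e w n s e' w' n' s' := by
  have l1 := le_max_left (fn + fs) (fe + fw)
  have l2 := le_max_right (fn + fs) (fe + fw)
  unfold raiseChange
  rcases he with rfl | rfl <;> rcases hw with rfl | rfl <;> rcases hn with rfl | rfl <;>
    rcases hs with rfl | rfl <;> try omega
  -- No old edge: every corner needs one new edge, so an opposite pair is added. Taking north and
  -- south changes the weight by `fe + fw - f - f'`, taking east and west by `fn + fs - f - f'`; the
  -- pair is chosen to make this zero.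
  · rcases le_total (fn + fs) (fe + fw) with hm | hm
    · rw [max_eq_right hm] at hf
      refine ⟨0, 0, 1, 1, by norm_num, by norm_num, by norm_num, by norm_num, by norm_num,
        by norm_num, by norm_num, by norm_num, ?_⟩
      rw [hf]; push_cast; linarith
    · rw [max_eq_left hm] at hf
      refine ⟨1, 1, 0, 0, by norm_num, by norm_num, by norm_num, by norm_num, by norm_num,
        by norm_num, by norm_num, by norm_num, ?_⟩
      rw [hf]; push_cast; linarith
  -- A single edge is replaced by the opposite one, with no change of weight.
  · refine ⟨0, 0, 1, 0, by norm_num, by norm_num, by norm_num, by norm_num, by norm_num,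
        by norm_num, by norm_num, by norm_num, ?_⟩
    push_cast; linarith
  · refine ⟨0, 0, 0, 1, by norm_num, by norm_num, by norm_num, by norm_num, by norm_num,
        by norm_num, by norm_num, by norm_num, ?_⟩
    push_cast; linarith
  -- A pair of opposite edges is removed; the gain is `f + f'` minus the sum over the other pair,
  -- nonnegative by the recurrence.
  · refine ⟨0, 0, 0, 0, by norm_num, by norm_num, by norm_num, by norm_num, by norm_num,
        by norm_num, by norm_num, by norm_num, ?_⟩
    push_cast; linarith
  · refine ⟨1, 0, 0, 0, by norm_num, by norm_num, by norm_num, by norm_num, by norm_num,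
        by norm_num, by norm_num, by norm_num, ?_⟩
    push_cast; linarith
  · refine ⟨0, 1, 0, 0, by norm_num, by norm_num, by norm_num, by norm_num, by norm_num,
        by norm_num, by norm_num, by norm_num, ?_⟩
    push_cast; linarith
  · refine ⟨0, 0, 0, 0, by norm_num, by norm_num, by norm_num, by norm_num, by norm_num,
        by norm_num, by norm_num, by norm_num, ?_⟩
    push_cast; linarith

/-- The recurrence `f + f' = max …` is symmetric in `f` and `f'`, so lowering is raising with the
two values exchanged. -/
theorem exists_lower {f f' fe fw fn fs : ℝ} (hf : f' = max (fn + fs) (fe + fw) - f)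
    {e w n s : ℤ} (he : e = 0 ∨ e = 1) (hw : w = 0 ∨ w = 1) (hn : n = 0 ∨ n = 1)
    (hs : s = 0 ∨ s = 1) (h : e + n ≤ 1 ∧ w + n ≤ 1 ∧ w + s ≤ 1 ∧ e + s ≤ 1) :
    ∃ e' w' n' s' : ℤ, (e' = 0 ∨ e' = 1) ∧ (w' = 0 ∨ w' = 1) ∧ (n' = 0 ∨ n' = 1) ∧
      (s' = 0 ∨ s' = 1) ∧ e' + n' = 1 - (e + n) ∧ w' + n' = 1 - (w + n) ∧
      w' + s' = 1 - (w + s) ∧ e' + s' = 1 - (e + s) ∧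
      raiseChange f f' fe fw fn fs e' w' n' s' e w n s ≤ 0 := by
  obtain ⟨e', w', n', s', h1, h2, h3, h4, h5, h6, h7, h8, h9⟩ :=
    exists_raise (f := f') (f' := f) (by rw [hf]; ring) he hw hn hs h
  refine ⟨e', w', n', s', h1, h2, h3, h4, h5, h6, h7, h8, ?_⟩
  -- `raiseChange` is antisymmetric under exchanging old and new only modulo the four complement
  -- relations; these products supply the difference.
  have key : ∀ g : ℝ, g * ((e' + n' - (1 - (e + n)) : ℤ) : ℝ) = 0 ∧
      g * ((w' + n' - (1 - (w + n)) : ℤ) : ℝ) = 0 ∧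
      g * ((w' + s' - (1 - (w + s)) : ℤ) : ℝ) = 0 ∧
      g * ((e' + s' - (1 - (e + s)) : ℤ) : ℝ) = 0 := by
    intro g
    rw [h5, h6, h7, h8]
    simp
  have ke := key fe
  have kw := key fw
  have kn := key fn
  have ks := key fs
  unfold raiseChange at *
  push_cast at *
  linarith

/-- The height function of a surface raised at `(a, b)`. -/
def raiseHeight (H : ℤ → ℤ → ℤ) (a b : ℤ) : ℤ → ℤ → ℤ :=
  fun c d => if c = a ∧ d = b then H c d + 2 else H c d

/-- Replacement of the horizontal edges at `(a, b)`. -/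
def replaceHorizontal (X : ℤ → ℤ → ℤ) (a b e w : ℤ) : ℤ → ℤ → ℤ :=
  fun c d => if d = b ∧ c = a then e else if d = b ∧ c = a - 1 then w else X c d

/-- Replacement of the vertical edges at `(a, b)`. -/
def replaceVertical (Y : ℤ → ℤ → ℤ) (a b n s : ℤ) : ℤ → ℤ → ℤ :=
  fun c d => if c = a ∧ d = b then n else if c = a ∧ d = b - 1 then s else Y c d

theorem raiseHeight_self (H : ℤ → ℤ → ℤ) (a b : ℤ) : raiseHeight H a b a b = H a b + 2 := by
  simp [raiseHeight]

theorem replace_star (X Y : ℤ → ℤ → ℤ) (a b e w n s : ℤ) :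
    replaceHorizontal X a b e w a b = e ∧ replaceHorizontal X a b e w (a - 1) b = w ∧
      replaceVertical Y a b n s a b = n ∧ replaceVertical Y a b n s a (b - 1) = s := by
  simp [replaceHorizontal, replaceVertical]

theorem agreeOff_raise (H X Y : ℤ → ℤ → ℤ) (a b e w n s : ℤ) :
    AgreeOff a b H X Y (raiseHeight H a b) (replaceHorizontal X a b e w)
      (replaceVertical Y a b n s) := by
  constructor <;> intro c d h
  · simp only [raiseHeight, if_neg h]
  · simp only [replaceHorizontal]
    rw [if_neg (by omega), if_neg (by omega)]
  · simp only [replaceVertical]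
    rw [if_neg (by omega), if_neg (by omega)]

theorem agreeOff_lower (H X Y : ℤ → ℤ → ℤ) (a b e w n s : ℤ) :
    AgreeOff a b H (replaceHorizontal X a b e w) (replaceVertical Y a b n s)
      (raiseHeight H a b) X Y := by
  obtain ⟨h1, h2, h3⟩ := agreeOff_raise H X Y a b e w n s
  exact ⟨h1, fun c d h => (h2 c d h).symm, fun c d h => (h3 c d h).symm⟩

theorem AgreeOff.symm {a b : ℤ} {H X Y H' X' Y' : ℤ → ℤ → ℤ} (h : AgreeOff a b H X Y H' X' Y') :
    AgreeOff a b H' X' Y' H X Y :=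
  ⟨fun c d k => (h.height c d k).symm, fun c d k => (h.horizontal c d k).symm,
    fun c d k => (h.vertical c d k).symm⟩

/-! ### Invariance of the maximal weight -/

/-- A real function `O a b t` satisfies the octahedron rule in the tetrahedron between the initial
surface and the light cone of the point above `(i, j)`. -/
def OctahedronRule (n i j : ℤ) (O : ℤ → ℤ → ℤ → ℝ) : Prop :=
  ∀ a b t, startHeight n a b ≤ t → t + 2 ≤ coneHeight n i j a b → 2 ∣ t - (a + b - n) →
    O a b (t + 2) = max (O a (b + 1) (t + 1) + O a (b - 1) (t + 1))
      (O (a + 1) b (t + 1) + O (a - 1) b (t + 1)) - O a b t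

/-- Twice the real number `x` is the maximal weight of the matchings of the surface `H`. -/
def IsMaxWeight (n i j : ℤ) (O : ℤ → ℤ → ℤ → ℝ) (H : ℤ → ℤ → ℤ) (x : ℝ) : Prop :=
  (∀ X Y, IsMatched n i j H X Y → matchingWeight n i j (fun a b => O a b (H a b)) H X Y ≤ 2 * x) ∧
  ∃ X Y, IsMatched n i j H X Y ∧ matchingWeight n i j (fun a b => O a b (H a b)) H X Y = 2 * x

theorem IsMaxWeight.of_raise {n i j : ℤ} (hi : 0 < i) (hij : i ≤ j) (hj : j < n)
    {O : ℤ → ℤ → ℤ → ℝ} (hO : OctahedronRule n i j O) {H : ℤ → ℤ → ℤ} (hH : IsSurface n i j H)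
    {a b : ℤ} (hm : IsLocalMin H a b)
    (hab : H a b + 2 ≤ max (startHeight n a b) (coneHeight n i j a b)) {x : ℝ}
    (h : IsMaxWeight n i j O (raiseHeight H a b) x) : IsMaxWeight n i j O H x := by
  have hint := hH.interior hi hj hab
  have hc := hH.cornerHeights hm
  have hr := raiseHeight_self H a b
  have hf : O a b (raiseHeight H a b a b) =
      max (O a (b + 1) (H a (b + 1)) + O a (b - 1) (H a (b - 1)))
        (O (a + 1) b (H (a + 1) b) + O (a - 1) b (H (a - 1) b)) - O a b (H a b) := by
    rw [hr, hm.east, hm.west, hm.north, hm.south]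
    refine hO a b (H a b) (hH.lower a b) ?_ (hH.parity a b)
    have := hH.lower a b
    omega
  have hF : ∀ c d, ¬ (c = a ∧ d = b) → O c d (raiseHeight H a b c d) = O c d (H c d) := by
    intro c d hcd
    simp only [raiseHeight, if_neg hcd]
  have hval : ∀ c d, ¬ (c = a ∧ d = b) → raiseHeight H a b c d = H c d := by
    intro c d hcd
    simp only [raiseHeight, if_neg hcd]
  have upper : ∀ X Y, IsMatched n i j H X Y →
      matchingWeight n i j (fun a b => O a b (H a b)) H X Y ≤ 2 * x := by
    intro X Y hXY
    have hst := hXY.star hint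
    obtain ⟨e, w, k, s, he, hw, hk, hs, h1, h2, h3, h4, h5⟩ :=
      exists_raise hf (hXY.bitX a b) (hXY.bitX (a - 1) b) (hXY.bitY a b) (hXY.bitY a (b - 1))
        (hst.sum_le hXY.bitX hXY.bitY (hm.east.trans hm.north.symm) (hm.west.trans hm.north.symm)
          (hm.south.trans hm.north.symm))
    obtain ⟨r1, r2, r3, r4⟩ := replace_star X Y a b e w k s
    have hag := agreeOff_raise H X Y a b e w k s
    set X' := replaceHorizontal X a b e w
    set Y' := replaceVertical Y a b k s
    have hco : Complementary X Y X' Y' a b := by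
      constructor <;> simp only [r1, r2, r3, r4] <;> assumption
    have hb : StarBits X Y a b :=
      ⟨hXY.bitX a b, hXY.bitX (a - 1) b, hXY.bitY a b, hXY.bitY a (b - 1)⟩
    have hb' : StarBits X' Y' a b := by
      constructor <;> simp only [r1, r2, r3, r4] <;> assumption
    have hst' := (starMatched_iff hm hc hag hr hco hb hb').1 hst
    have hM := hXY.transfer hint hag hst' hb'.e hb'.w hb'.n hb'.s
    have hle := h.1 X' Y' hM
    have hsub := matchingWeight_sub (F := fun a b => O a b (H a b))
      (F' := fun c d => O c d (raiseHeight H a b c d)) hij hint hF hm hc hag hr hco hst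
    rw [r1, r2, r3, r4] at hsub
    linarith
  refine ⟨upper, ?_⟩
  obtain ⟨X', Y', hM, hx⟩ := h.2
  have hst' := hM.star hint
  obtain ⟨e, w, k, s, he, hw, hk, hs, h1, h2, h3, h4, h5⟩ :=
    exists_lower hf (hM.bitX a b) (hM.bitX (a - 1) b) (hM.bitY a b) (hM.bitY a (b - 1))
      (hst'.sum_le hM.bitX hM.bitY
        (by rw [hval _ _ (by omega), hval _ _ (by omega), hm.east, hm.north])
        (by rw [hval _ _ (by omega), hval _ _ (by omega), hm.west, hm.north])
        (by rw [hval _ _ (by omega), hval _ _ (by omega), hm.south, hm.north]))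
  obtain ⟨r1, r2, r3, r4⟩ := replace_star X' Y' a b e w k s
  have hag := agreeOff_lower H X' Y' a b e w k s
  set X := replaceHorizontal X' a b e w
  set Y := replaceVertical Y' a b k s
  have hco : Complementary X Y X' Y' a b := by
    constructor <;> simp only [r1, r2, r3, r4] <;> omega
  have hb' : StarBits X' Y' a b :=
    ⟨hM.bitX a b, hM.bitX (a - 1) b, hM.bitY a b, hM.bitY a (b - 1)⟩
  have hb : StarBits X Y a b := by
    constructor <;> simp only [r1, r2, r3, r4] <;> assumption
  have hst := (starMatched_iff hm hc hag hr hco hb hb').2 hst'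
  have hXY := hM.transfer hint hag.symm hst hb.e hb.w hb.n hb.s
  have hsub := matchingWeight_sub (F := fun a b => O a b (H a b))
    (F' := fun c d => O c d (raiseHeight H a b c d)) hij hint hF hm hc hag hr hco hst
  rw [r1, r2, r3, r4] at hsub
  -- The lowered matching has weight at least `2 * x`; the bound `upper` turns this into equality.
  exact ⟨X, Y, hXY, le_antisymm (upper X Y hXY) (by linarith)⟩

/-! ### Raising a surface up to the envelope -/

/-- The upper envelope of the initial surface and the light cone of the point above `(i, j)`. -/
noncomputable def topHeight (n i j a b : ℤ) : ℤ := max (startHeight n a b) (coneHeight n i j a b)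

theorem isSurface_startHeight (n i j : ℤ) : IsSurface n i j (startHeight n) := by
  constructor <;> intro a b <;> unfold startHeight <;> omega

theorem IsSurface.raise {n i j : ℤ} {H : ℤ → ℤ → ℤ} (hH : IsSurface n i j H)
    {a b : ℤ} (hm : IsLocalMin H a b)
    (hab : H a b + 2 ≤ max (startHeight n a b) (coneHeight n i j a b)) :
    IsSurface n i j (raiseHeight H a b) := by
  obtain ⟨m1, m2, m3, m4⟩ := hm
  constructor <;> intro c d
  · have := hH.lower c d
    unfold raiseHeight; split_ifs <;> omega
  · have := hH.upper c d
    unfold raiseHeight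
    split_ifs with h
    · obtain ⟨rfl, rfl⟩ := h; exact hab
    · exact this
  · have := hH.parity c d
    unfold raiseHeight; split_ifs <;> omega
  · have := hH.stepX c d
    unfold raiseHeight
    by_cases h1 : c = a ∧ d = b
    · obtain ⟨rfl, rfl⟩ := h1
      rw [if_neg (by omega), if_pos (by omega)]; omega
    by_cases h2 : c + 1 = a ∧ d = b
    · obtain ⟨rfl, rfl⟩ := h2
      simp only [add_sub_cancel_right] at m2
      rw [if_pos (by omega), if_neg (by omega)]; omega
    rw [if_neg h1, if_neg h2]; exact this
  · have := hH.stepY c d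
    unfold raiseHeight
    by_cases h1 : c = a ∧ d = b
    · obtain ⟨rfl, rfl⟩ := h1
      rw [if_neg (by omega), if_pos (by omega)]; omega
    by_cases h2 : c = a ∧ d + 1 = b
    · obtain ⟨rfl, rfl⟩ := h2
      simp only [add_sub_cancel_right] at m4
      rw [if_pos (by omega), if_neg (by omega)]; omega
    rw [if_neg h1, if_neg h2]; exact this

/-- A surface below the upper envelope has a local minimum at which it can be raised. -/
theorem IsSurface.exists_localMin {n i j : ℤ} (hi : 0 < i) (hij : i ≤ j) (hj : j < n)
    {H : ℤ → ℤ → ℤ} (hH : IsSurface n i j H)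
    (hne : ∃ p ∈ hexFinset n i j, H p.1 p.2 ≠ topHeight n i j p.1 p.2) :
    ∃ a b, IsLocalMin H a b ∧ H a b + 2 ≤ max (startHeight n a b) (coneHeight n i j a b) := by
  have hlt : ∀ a b, H a b ≠ topHeight n i j a b → H a b + 2 ≤ topHeight n i j a b := by
    intro a b h
    have h1 := hH.upper a b
    have h2 := hH.parity a b
    unfold topHeight startHeight coneHeight at *
    omega
  -- A lowest point among those below the envelope is a local minimum: a neighbour is either no
  -- lower by minimality, or lies on the envelope, whose height drops by at most one per step.
  obtain ⟨p, hp, hmin⟩ := Finset.exists_min_image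
    ((hexFinset n i j).filter fun p => H p.1 p.2 ≠ topHeight n i j p.1 p.2) (fun p => H p.1 p.2)
    (by obtain ⟨p, hp, h⟩ := hne; exact ⟨p, Finset.mem_filter.2 ⟨hp, h⟩⟩)
  obtain ⟨a, b⟩ := p
  have hab := hlt a b (Finset.mem_filter.1 hp).2
  have hint := hH.interior hi hj hab
  have nb : ∀ c d, InHex n i j c d → topHeight n i j a b ≤ topHeight n i j c d + 1 →
      H a b ≤ H c d := by
    intro c d hcd hs
    by_cases h : H c d = topHeight n i j c d
    · omega
    · exact hmin (c, d) (Finset.mem_filter.2 ⟨(mem_hexFinset hij).2 hcd, h⟩)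
  have e1 := hH.stepX a b
  have e2 := hH.stepX (a - 1) b
  have e3 := hH.stepY a b
  have e4 := hH.stepY a (b - 1)
  simp only [sub_add_cancel] at e2 e4
  have n1 := nb (a + 1) b (by unfold InHex; unfold InHexInterior at hint; omega)
    (by unfold topHeight startHeight coneHeight; omega)
  have n2 := nb (a - 1) b (by unfold InHex; unfold InHexInterior at hint; omega)
    (by unfold topHeight startHeight coneHeight; omega)
  have n3 := nb a (b + 1) (by unfold InHex; unfold InHexInterior at hint; omega)
    (by unfold topHeight startHeight coneHeight; omega)
  have n4 := nb a (b - 1) (by unfold InHex; unfold InHexInterior at hint; omega)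
    (by unfold topHeight startHeight coneHeight; omega)
  exact ⟨a, b, ⟨by omega, by omega, by omega, by omega⟩, hab⟩

/-- Induction on the volume between the surface and the envelope, which each raise decreases. -/
theorem isMaxWeight_of_surface {n i j : ℤ} (hi : 0 < i) (hij : i ≤ j) (hj : j < n)
    {O : ℤ → ℤ → ℤ → ℝ} (hO : OctahedronRule n i j O) {x : ℝ}
    (htop : ∀ H, IsSurface n i j H → (∀ a b, H a b = topHeight n i j a b) →
      IsMaxWeight n i j O H x) {H : ℤ → ℤ → ℤ}
    (hH : IsSurface n i j H) : IsMaxWeight n i j O H x := by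
  induction hN : ∑ p ∈ hexFinset n i j, (topHeight n i j p.1 p.2 - H p.1 p.2).toNat
    using Nat.strong_induction_on generalizing H with
  | _ N ih =>
    by_cases hne : ∃ p ∈ hexFinset n i j, H p.1 p.2 ≠ topHeight n i j p.1 p.2
    · obtain ⟨a, b, hm, hab⟩ := hH.exists_localMin hi hij hj hne
      refine IsMaxWeight.of_raise hi hij hj hO hH hm hab (ih _ ?_ (hH.raise hm hab) rfl)
      rw [← hN]
      have hint := hH.interior hi hj hab
      refine Finset.sum_lt_sum (fun p _ => ?_) ⟨(a, b), (mem_hexFinset hij).2 ?_, ?_⟩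
      · unfold raiseHeight; split_ifs <;> omega
      · unfold InHexInterior at hint; unfold InHex; omega
      · simp only [raiseHeight_self]; unfold topHeight; omega
    · push Not at hne
      refine htop H hH fun a b => ?_
      by_cases hp : InHex n i j a b
      · exact hne (a, b) ((mem_hexFinset hij).2 hp)
      -- Off the hexagon the cone is below the initial surface, so both bounds on `H` coincide.
      · have h1 := hH.lower a b
        have h2 := hH.upper a b
        unfold InHex at hp
        unfold topHeight startHeight coneHeight at *
        omega

/-! ### The matching of the upper envelope -/

section Values

variable {n i j a b : ℤ}

theorem startHeight_of_le (h : n ≤ a + b) : startHeight n a b = a + b - n :=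
  max_eq_left (by omega)

theorem startHeight_of_ge (h : a + b ≤ n) : startHeight n a b = n - a - b :=
  max_eq_right (by omega)

theorem topHeight_eq_of_le {x : ℤ} (hx : coneHeight n i j a b = x) (h1 : a + b - n ≤ x)
    (h2 : n - a - b ≤ x) : topHeight n i j a b = x := by
  unfold topHeight startHeight
  rw [hx]
  exact max_eq_right (max_le h1 h2)

theorem coneHeight_northEast (ha : i ≤ a) (hb : j ≤ b) :
    coneHeight n i j a b = n + 2 * i - a - b := by
  unfold coneHeight
  rw [max_eq_left (by omega), max_eq_left (by omega)]
  ring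

theorem coneHeight_northWest (ha : a ≤ i) (hb : j ≤ b) : coneHeight n i j a b = n + a - b := by
  unfold coneHeight
  rw [max_eq_right (by omega), max_eq_left (by omega)]
  ring

theorem coneHeight_southWest (ha : a ≤ i) (hb : b ≤ j) :
    coneHeight n i j a b = n - 2 * j + a + b := by
  unfold coneHeight
  rw [max_eq_right (by omega), max_eq_right (by omega)]
  ring

theorem coneHeight_southEast (ha : i ≤ a) (hb : b ≤ j) :
    coneHeight n i j a b = n + 2 * i - 2 * j - a + b := by
  unfold coneHeight
  rw [max_eq_left (by omega), max_eq_right (by omega)]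
  ring

theorem topHeight_northEast (hi : 0 < i) (ha : i ≤ a) (hb : j ≤ b) (h : a + b ≤ n + i) :
    topHeight n i j a b = n + 2 * i - a - b :=
  topHeight_eq_of_le (coneHeight_northEast ha hb) (by omega) (by omega)

theorem topHeight_northWest (ha : a ≤ i) (hb : j ≤ b) (h0 : 0 ≤ a) (h : b ≤ n) :
    topHeight n i j a b = n + a - b :=
  topHeight_eq_of_le (coneHeight_northWest ha hb) (by omega) (by omega)

theorem topHeight_southWest (hj : j < n) (ha : a ≤ i) (hb : b ≤ j) (h : j ≤ a + b) :
    topHeight n i j a b = n - 2 * j + a + b :=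
  topHeight_eq_of_le (coneHeight_southWest ha hb) (by omega) (by omega)

theorem topHeight_southEast (ha : i ≤ a) (hb : b ≤ j) (h1 : a ≤ n + i - j) (h2 : j - i ≤ b) :
    topHeight n i j a b = n + 2 * i - 2 * j - a + b :=
  topHeight_eq_of_le (coneHeight_southEast ha hb) (by omega) (by omega)

theorem coneHeight_le_abs (n i j a b : ℤ) :
    coneHeight n i j a b ≤ n + 2 * i - a - b ∧ coneHeight n i j a b ≤ n + a - b ∧
    coneHeight n i j a b ≤ n - 2 * j + a + b ∧
    coneHeight n i j a b ≤ n + 2 * i - 2 * j - a + b := by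
  have h1 := le_max_left (a - i) (i - a)
  have h2 := le_max_right (a - i) (i - a)
  have h3 := le_max_left (b - j) (j - b)
  have h4 := le_max_right (b - j) (j - b)
  unfold coneHeight
  refine ⟨?_, ?_, ?_, ?_⟩ <;> linarith

/-- Above the initial surface `a + b - n`, the envelope is the initial surface. -/
theorem topHeight_upper (h0 : n ≤ a + b) (h : n + i ≤ a + b ∨ n ≤ b ∨ n + i - j ≤ a) :
    topHeight n i j a b = a + b - n := by
  have := coneHeight_le_abs n i j a b
  unfold topHeight
  rw [startHeight_of_le h0]
  exact max_eq_left (by omega)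

theorem topHeight_lower (h0 : a + b ≤ n) (h : a + b ≤ j ∨ a ≤ 0 ∨ b ≤ j - i) :
    topHeight n i j a b = n - a - b := by
  have := coneHeight_le_abs n i j a b
  unfold topHeight
  rw [startHeight_of_ge h0]
  exact max_eq_left (by omega)

end Values

/-! ### The frozen matching -/

theorem frozenVertical_bit (n i j a b : ℤ) :
    frozenVertical n i j a b = 0 ∨ frozenVertical n i j a b = 1 := by
  unfold frozenVertical; split_ifs <;> simp

/-- In each quadrant around `(i, j)` the envelope inside the hexagon is a plane, so its squares are
split and are satisfied by their diagonal alone. The squares cut by the sides `BC` and `EF` are flat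
and use their frozen edge. -/
theorem isMatched_frozen {n i j : ℤ} (hi : 0 < i) (hj : j < n) :
    IsMatched n i j (topHeight n i j) (fun _ _ => 0) (frozenVertical n i j) := by
  refine ⟨fun _ _ => Or.inl rfl, frozenVertical_bit n i j, fun _ _ _ => rfl, fun _ _ _ => rfl,
    fun a b hab => ?_⟩
  have hdiag : ∀ {c d : ℤ}, c + d ≠ j - 1 → c + d ≠ n + i → frozenVertical n i j c d = 0 := by
    intro c d h1 h2
    unfold frozenVertical
    rw [if_neg (by omega)]
  unfold MeetsHex InHex at hab
  rcases lt_or_ge a i with ha | ha <;> rcases lt_or_ge b j with hb | hb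
  · rw [topHeight_southWest hj (a := a + 1) (b := b) (by omega) (by omega) (by omega),
      topHeight_southWest hj (a := a + 1) (b := b + 1) (by omega) (by omega) (by omega),
      topHeight_southWest hj (a := a) (b := b + 1) (by omega) (by omega) (by omega),
      hdiag (c := a + 1) (d := b) (by omega) (by omega)]
    by_cases h1 : a + b = j - 1
    · rw [topHeight_lower (by omega) (by omega), squareMatched_of_flat (by omega) (by omega)]
      unfold frozenVertical
      rw [if_pos (by omega)]
      omega
    · rw [topHeight_southWest hj (by omega) (by omega) (by omega),
        squareMatched_of_ne_left (by omega) (by omega), hdiag (by omega) (by omega)]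
      omega
  · rw [topHeight_northWest (a := a) (b := b) (by omega) (by omega) (by omega) (by omega),
      topHeight_northWest (a := a + 1) (b := b) (by omega) (by omega) (by omega) (by omega),
      topHeight_northWest (a := a) (b := b + 1) (by omega) (by omega) (by omega) (by omega),
      topHeight_northWest (a := a + 1) (b := b + 1) (by omega) (by omega) (by omega) (by omega),
      hdiag (c := a + 1) (d := b) (by omega) (by omega),
      hdiag (c := a) (d := b) (by omega) (by omega),
      squareMatched_of_ne_right (by omega) (by omega)]
    omega
  · rw [topHeight_southEast (a := a) (b := b) (by omega) (by omega) (by omega) (by omega),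
      topHeight_southEast (a := a + 1) (b := b) (by omega) (by omega) (by omega) (by omega),
      topHeight_southEast (a := a) (b := b + 1) (by omega) (by omega) (by omega) (by omega),
      topHeight_southEast (a := a + 1) (b := b + 1) (by omega) (by omega) (by omega) (by omega),
      hdiag (c := a + 1) (d := b) (by omega) (by omega),
      hdiag (c := a) (d := b) (by omega) (by omega),
      squareMatched_of_ne_right (by omega) (by omega)]
    omega
  · rw [topHeight_northEast hi (a := a) (b := b) (by omega) (by omega) (by omega),
      topHeight_northEast hi (a := a + 1) (b := b) (by omega) (by omega) (by omega),
      topHeight_northEast hi (a := a) (b := b + 1) (by omega) (by omega) (by omega),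
      hdiag (c := a) (d := b) (by omega) (by omega)]
    by_cases h1 : a + 1 + b = n + i
    · rw [topHeight_upper (by omega) (by omega), squareMatched_of_flat (by omega) (by omega)]
      unfold frozenVertical
      rw [if_pos (by omega)]
      omega
    · rw [topHeight_northEast hi (by omega) (by omega) (by omega),
        squareMatched_of_ne_left (by omega) (by omega), hdiag (by omega) (by omega)]
      omega

/-! ### Uniqueness of the matching on the envelope -/

section Uniqueness

variable {n i j : ℤ} {X Y : ℤ → ℤ → ℤ}

theorem IsMatched.nonneg {H : ℤ → ℤ → ℤ} (h : IsMatched n i j H X Y) (a b : ℤ) :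
    0 ≤ X a b ∧ 0 ≤ Y a b := by
  have h1 := h.bitX a b
  have h2 := h.bitY a b
  omega

/-- Zeros spread inwards from the side `EF`: once the top and right edges of a split square vanish,
so do the bottom and left ones. The number `k` bounds the distance to `EF`. -/
theorem IsMatched.northEast (h : IsMatched n i j (topHeight n i j) X Y) (hi : 0 < i) (k : ℕ) :
    ∀ a b, MeetsHex n i j a b → i ≤ a → j ≤ b → n + i - 1 - a - b ≤ k → X a b + Y a b = 0 := by
  induction k with
  | zero =>
    intro a b hab ha hb hk
    have hs := h.square a b hab
    unfold MeetsHex InHex at hab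
    -- In a square cut by `EF` the frozen right edge is already the only matched edge allowed.
    rw [squareMatched_of_flat (by rw [topHeight_northEast hi (by omega) (by omega) (by omega),
        topHeight_upper (by omega) (by omega)]; omega)
      (by rw [topHeight_northEast hi (by omega) (by omega) (by omega), topHeight_northEast hi
          (by omega) (by omega) (by omega)]; omega),
      h.outerY (a + 1) b (by unfold VerticalInner; omega)] at hs
    have := h.nonneg a b
    have := h.nonneg a (b + 1)
    unfold frozenVertical at hs
    rw [if_pos (by omega)] at hs
    omega
  | succ k ih =>
    intro a b hab ha hb hk
    by_cases h0 : n + i - 1 - a - b ≤ k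
    · exact ih a b hab ha hb h0
    have hs := h.square a b hab
    have h1 : X a (b + 1) = 0 := by
      by_cases hb' : b + 1 < n
      · have := ih a (b + 1) (by unfold MeetsHex InHex at *; omega) ha (by omega) (by omega)
        have := h.nonneg a (b + 1)
        omega
      · exact h.outerX _ _ (by unfold HorizontalInner; omega)
    have h2 : Y (a + 1) b = 0 := by
      by_cases ha' : a + 1 < n + i - j
      · have := ih (a + 1) b (by unfold MeetsHex InHex at *; omega) (by omega) hb (by omega)
        have := h.nonneg (a + 1) b
        omega
      · rw [h.outerY _ _ (by unfold VerticalInner; omega)]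
        unfold frozenVertical
        unfold MeetsHex InHex at hab
        rw [if_neg (by omega)]
    unfold MeetsHex InHex at hab
    rw [squareMatched_of_ne_left (by rw [topHeight_northEast hi (by omega) (by omega) (by omega),
        topHeight_northEast hi (by omega) (by omega) (by omega)]; omega)
      (by rw [topHeight_northEast hi (by omega) (by omega) (by omega), topHeight_northEast hi
          (by omega) (by omega) (by omega)]; omega)] at hs
    omega

/-- As in `IsMatched.northEast`, now from the side `BC`, whose frozen edges are on the left of their
squares. -/
theorem IsMatched.southWest (h : IsMatched n i j (topHeight n i j) X Y) (hj : j < n) (k : ℕ) :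
    ∀ a b, MeetsHex n i j a b → a < i → b < j → a + b - (j - 1) ≤ k →
      X a (b + 1) + Y (a + 1) b = 0 := by
  induction k with
  | zero =>
    intro a b hab ha hb hk
    have hs := h.square a b hab
    unfold MeetsHex InHex at hab
    rw [squareMatched_of_flat (by rw [topHeight_lower (by omega) (by omega),
        topHeight_southWest hj (by omega) (by omega) (by omega)]; omega)
      (by rw [topHeight_southWest hj (by omega) (by omega) (by omega), topHeight_southWest hj
          (by omega) (by omega) (by omega)]; omega),
      h.outerY a b (by unfold VerticalInner; omega)] at hs
    have := h.nonneg a b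
    have := h.nonneg (a + 1) b
    have := h.nonneg a (b + 1)
    unfold frozenVertical at hs
    rw [if_pos (by omega)] at hs
    omega
  | succ k ih =>
    intro a b hab ha hb hk
    by_cases h0 : a + b - (j - 1) ≤ k
    · exact ih a b hab ha hb h0
    have hs := h.square a b hab
    have h1 : X a b = 0 := by
      by_cases hb' : j - i < b
      · have := ih a (b - 1) (by unfold MeetsHex InHex at *; omega) ha (by omega) (by omega)
        simp only [sub_add_cancel] at this
        have := h.nonneg a b
        have := h.nonneg (a + 1) (b - 1)
        omega
      · exact h.outerX _ _ (by unfold HorizontalInner; omega)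
    have h2 : Y a b = 0 := by
      by_cases ha' : 0 < a
      · have := ih (a - 1) b (by unfold MeetsHex InHex at *; omega) (by omega) hb (by omega)
        simp only [sub_add_cancel] at this
        have := h.nonneg a b
        have := h.nonneg (a - 1) (b + 1)
        omega
      · rw [h.outerY _ _ (by unfold VerticalInner; omega)]
        unfold frozenVertical
        unfold MeetsHex InHex at hab
        rw [if_neg (by omega)]
    unfold MeetsHex InHex at hab
    rw [squareMatched_of_ne_left (by rw [topHeight_southWest hj (by omega) (by omega) (by omega),
        topHeight_southWest hj (by omega) (by omega) (by omega)]; omega)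
      (by rw [topHeight_southWest hj (by omega) (by omega) (by omega), topHeight_southWest hj
          (by omega) (by omega) (by omega)]; omega)] at hs
    omega

/-- In this quadrant the level diagonals have the other direction. Zeros spread from the corner `D`,
where the bottom and right edges lie on the sides `CD` and `DE` and hence vanish. -/
theorem IsMatched.southEast (h : IsMatched n i j (topHeight n i j) X Y)
    (k : ℕ) :
    ∀ a b, MeetsHex n i j a b → i ≤ a → b < j → (n + i - j - a) + (b - (j - i)) ≤ k →
      X a (b + 1) + Y a b = 0 := by
  induction k with
  -- The measure is at least 1 on every square, because `a + 1 ≤ n + i - j`.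
  | zero =>
    intro a b hab ha hb hk
    unfold MeetsHex InHex at hab
    omega
  | succ k ih =>
    intro a b hab ha hb hk
    have hs := h.square a b hab
    have h1 : X a b = 0 := by
      by_cases hb' : j - i < b
      · have := ih a (b - 1) (by unfold MeetsHex InHex at *; omega) ha (by omega) (by omega)
        simp only [sub_add_cancel] at this
        have := h.nonneg a b
        have := h.nonneg a (b - 1)
        omega
      · exact h.outerX _ _ (by unfold HorizontalInner; omega)
    have h2 : Y (a + 1) b = 0 := by
      by_cases ha' : a + 1 < n + i - j
      · have := ih (a + 1) b (by unfold MeetsHex InHex at *; omega) (by omega) hb (by omega)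
        have := h.nonneg (a + 1) b
        have := h.nonneg (a + 1) (b + 1)
        omega
      · rw [h.outerY _ _ (by unfold VerticalInner; omega)]
        unfold frozenVertical
        unfold MeetsHex InHex at hab
        rw [if_neg (by omega)]
    unfold MeetsHex InHex at hab
    rw [squareMatched_of_ne_right (by rw [topHeight_southEast (by omega) (by omega) (by omega)
        (by omega), topHeight_southEast (by omega) (by omega) (by omega) (by omega)]; omega)
      (by rw [topHeight_southEast (by omega) (by omega) (by omega) (by omega),
          topHeight_southEast (by omega) (by omega) (by omega) (by omega)]; omega)] at hs
    omega

/-- The mirror image of `IsMatched.southEast`, starting from the corner `A` with the sides `AB` and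
`AF`. -/
theorem IsMatched.northWest (h : IsMatched n i j (topHeight n i j) X Y)
    (k : ℕ) :
    ∀ a b, MeetsHex n i j a b → a < i → j ≤ b → a + (n - b) ≤ k →
      X a b + Y (a + 1) b = 0 := by
  induction k with
  | zero =>
    intro a b hab ha hb hk
    unfold MeetsHex InHex at hab
    omega
  | succ k ih =>
    intro a b hab ha hb hk
    have hs := h.square a b hab
    have h1 : X a (b + 1) = 0 := by
      by_cases hb' : b + 1 < n
      · have := ih a (b + 1) (by unfold MeetsHex InHex at *; omega) ha (by omega) (by omega)
        have := h.nonneg a (b + 1)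
        have := h.nonneg (a + 1) (b + 1)
        omega
      · exact h.outerX _ _ (by unfold HorizontalInner; omega)
    have h2 : Y a b = 0 := by
      by_cases ha' : 0 < a
      · have := ih (a - 1) b (by unfold MeetsHex InHex at *; omega) (by omega) hb (by omega)
        simp only [sub_add_cancel] at this
        have := h.nonneg a b
        have := h.nonneg (a - 1) b
        omega
      · rw [h.outerY _ _ (by unfold VerticalInner; omega)]
        unfold frozenVertical
        unfold MeetsHex InHex at hab
        rw [if_neg (by omega)]
    unfold MeetsHex InHex at hab
    rw [squareMatched_of_ne_right (by rw [topHeight_northWest (by omega) (by omega) (by omega)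
        (by omega), topHeight_northWest (by omega) (by omega) (by omega) (by omega)]; omega)
      (by rw [topHeight_northWest (by omega) (by omega) (by omega) (by omega),
          topHeight_northWest (by omega) (by omega) (by omega) (by omega)]; omega)] at hs
    omega

theorem IsMatched.eq_frozen (h : IsMatched n i j (topHeight n i j) X Y) (hi : 0 < i)
    (hj : j < n) : X = (fun _ _ => 0) ∧ Y = frozenVertical n i j := by
  constructor <;> funext a b
  · by_cases hab : HorizontalInner n i j a b
    swap
    · exact h.outerX a b hab
    have hp := h.nonneg a b
    unfold HorizontalInner at hab
    rcases lt_or_ge a i with ha | ha <;> rcases lt_or_ge b j with hb | hb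
    · have := h.southWest hj (a + (b - 1) - (j - 1)).toNat a (b - 1)
        (by unfold MeetsHex InHex; omega) ha (by omega) (by omega)
      have := h.nonneg (a + 1) (b - 1)
      simp only [sub_add_cancel] at *
      omega
    · have := h.northWest (a + (n - b)).toNat a b
        (by unfold MeetsHex InHex; omega) ha (by omega) (by omega)
      have := h.nonneg (a + 1) b
      omega
    · have := h.southEast ((n + i - j - a) + (b - 1 - (j - i))).toNat a (b - 1)
        (by unfold MeetsHex InHex; omega) ha (by omega) (by omega)
      have := h.nonneg a (b - 1)
      simp only [sub_add_cancel] at *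
      omega
    · have := h.northEast hi (n + i - 1 - a - b).toNat a b
        (by unfold MeetsHex InHex; omega) ha (by omega) (by omega)
      omega
  · by_cases hab : VerticalInner n i j a b
    swap
    · exact h.outerY a b hab
    have hp := h.nonneg a b
    have hf : frozenVertical n i j a b = 0 := by
      unfold frozenVertical; unfold VerticalInner at hab; rw [if_neg (by omega)]
    rw [hf]
    unfold VerticalInner at hab
    rcases le_or_gt a i with ha | ha <;> rcases lt_or_ge b j with hb | hb
    · have := h.southWest hj (a - 1 + b - (j - 1)).toNat (a - 1) b
        (by unfold MeetsHex InHex; omega) (by omega) (by omega) (by omega)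
      have := h.nonneg (a - 1) (b + 1)
      simp only [sub_add_cancel] at *
      omega
    · have := h.northWest (a - 1 + (n - b)).toNat (a - 1) b
        (by unfold MeetsHex InHex; omega) (by omega) (by omega) (by omega)
      have := h.nonneg (a - 1) b
      simp only [sub_add_cancel] at *
      omega
    · have := h.southEast ((n + i - j - a) + (b - (j - i))).toNat a b
        (by unfold MeetsHex InHex; omega) (by omega) (by omega) (by omega)
      have := h.nonneg a (b + 1)
      omega
    · have := h.northEast hi (n + i - 1 - a - b).toNat a b
        (by unfold MeetsHex InHex; omega) (by omega) (by omega) (by omega)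
      omega

end Uniqueness

/-! ### Exponents on the envelope -/

theorem topHeight_cases {n i j : ℤ} (hi : 0 < i) (hj : j < n) (c d : ℤ) :
    (i ≤ c ∧ j ≤ d ∧ c + d ≤ n + i ∧ topHeight n i j c d = n + 2 * i - c - d) ∨
    (c ≤ i ∧ j ≤ d ∧ 0 ≤ c ∧ d ≤ n ∧ topHeight n i j c d = n + c - d) ∨
    (c ≤ i ∧ d ≤ j ∧ j ≤ c + d ∧ topHeight n i j c d = n - 2 * j + c + d) ∨
    (i ≤ c ∧ d ≤ j ∧ c ≤ n + i - j ∧ j - i ≤ d ∧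
      topHeight n i j c d = n + 2 * i - 2 * j - c + d) ∨
    (n ≤ c + d ∧ (n + i ≤ c + d ∨ n ≤ d ∨ n + i - j ≤ c) ∧ topHeight n i j c d = c + d - n) ∨
    (c + d ≤ n ∧ (c + d ≤ j ∨ c ≤ 0 ∨ d ≤ j - i) ∧ topHeight n i j c d = n - c - d) := by
  by_cases h1 : i ≤ c ∧ j ≤ d ∧ c + d ≤ n + i
  · exact Or.inl ⟨h1.1, h1.2.1, h1.2.2, topHeight_northEast hi h1.1 h1.2.1 h1.2.2⟩
  by_cases h2 : c ≤ i ∧ j ≤ d ∧ 0 ≤ c ∧ d ≤ n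
  · obtain ⟨k1, k2, k3, k4⟩ := h2
    exact Or.inr <| Or.inl ⟨k1, k2, k3, k4, topHeight_northWest k1 k2 k3 k4⟩
  by_cases h3 : c ≤ i ∧ d ≤ j ∧ j ≤ c + d
  · obtain ⟨k1, k2, k3⟩ := h3
    exact Or.inr <| Or.inr <| Or.inl ⟨k1, k2, k3, topHeight_southWest hj k1 k2 k3⟩
  by_cases h4 : i ≤ c ∧ d ≤ j ∧ c ≤ n + i - j ∧ j - i ≤ d
  · obtain ⟨k1, k2, k3, k4⟩ := h4
    exact Or.inr <| Or.inr <| Or.inr <| Or.inl ⟨k1, k2, k3, k4, topHeight_southEast k1 k2 k3 k4⟩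
  by_cases h5 : n ≤ c + d ∧ (n + i ≤ c + d ∨ n ≤ d ∨ n + i - j ≤ c)
  · exact Or.inr <| Or.inr <| Or.inr <| Or.inr <| Or.inl ⟨h5.1, h5.2, topHeight_upper h5.1 h5.2⟩
  · have h6 : c + d ≤ n ∧ (c + d ≤ j ∨ c ≤ 0 ∨ d ≤ j - i) := by omega
    exact Or.inr <| Or.inr <| Or.inr <| Or.inr <| Or.inr ⟨h6.1, h6.2, topHeight_lower h6.1 h6.2⟩

/-- This and the next three equivalences settle the case distinctions in `exponent`: in each of the
four squares at a point they decide whether a level diagonal of the envelope ends at that point. -/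
theorem level_northEast {n i j : ℤ} (hi : 0 < i) (hj : j < n) {a b : ℤ}
    (hab : InHex n i j a b) :
    topHeight n i j (a + 1) b = topHeight n i j a (b + 1) ↔
    (i ≤ a ∧ j ≤ b) ∨ (a < i ∧ b < j) ∨ b = n ∨ a = n + i - j := by
  unfold InHex at hab
  rcases topHeight_cases hi hj (a + 1) b with h | h | h | h | h | h <;>
    rcases topHeight_cases hi hj a (b + 1) with k | k | k | k | k | k <;> omega

theorem level_southWest {n i j : ℤ} (hi : 0 < i) (hj : j < n) {a b : ℤ}
    (hab : InHex n i j a b) :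
    topHeight n i j (a - 1) b = topHeight n i j a (b - 1) ↔
    (a ≤ i ∧ b ≤ j) ∨ (i < a ∧ j < b) ∨ a = 0 ∨ b = j - i := by
  unfold InHex at hab
  rcases topHeight_cases hi hj (a - 1) b with h | h | h | h | h | h <;>
    rcases topHeight_cases hi hj a (b - 1) with k | k | k | k | k | k <;> omega

theorem level_northWest {n i j : ℤ} (hi : 0 < i) (hj : j < n) {a b : ℤ}
    (hab : InHex n i j a b) :
    topHeight n i j (a - 1) b = topHeight n i j a (b + 1) ↔
    (i < a ∧ b < j) ∨ (a ≤ i ∧ j ≤ b ∧ 0 < a ∧ b < n) ∨ (a = 0 ∧ b = n) ∨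
      (a + b = n + i ∧ i < a) ∨ (a + b = j ∧ b < j) := by
  unfold InHex at hab
  rcases topHeight_cases hi hj (a - 1) b with h | h | h | h | h | h <;>
    rcases topHeight_cases hi hj a (b + 1) with k | k | k | k | k | k <;> omega

theorem level_southEast {n i j : ℤ} (hi : 0 < i) (hj : j < n) {a b : ℤ}
    (hab : InHex n i j a b) :
    topHeight n i j (a + 1) b = topHeight n i j a (b - 1) ↔
    (a < i ∧ j < b) ∨ (i ≤ a ∧ b ≤ j ∧ a < n + i - j ∧ j - i < b) ∨
      (a = n + i - j ∧ b = j - i) ∨ (a + b = j ∧ a < i) ∨ (a + b = n + i ∧ j < b) := by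
  unfold InHex at hab
  rcases topHeight_cases hi hj (a + 1) b with h | h | h | h | h | h <;>
    rcases topHeight_cases hi hj a (b - 1) with k | k | k | k | k | k <;> omega

theorem exponent_topHeight_of_interior {n i j : ℤ} (hi : 0 < i) (hj : j < n) {a b : ℤ}
    (h : InHexInterior n i j a b) :
    exponent n i j (topHeight n i j) (fun _ _ => 0) (frozenVertical n i j) a b =
      if a = i ∧ b = j then 2 else 0 := by
  have hab : InHex n i j a b := by unfold InHexInterior at h; unfold InHex; omega
  unfold exponent
  simp only [level_northEast hi hj hab, level_northWest hi hj hab,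
    level_southWest hi hj hab, level_southEast hi hj hab]
  unfold InHex at hab
  unfold cornerTerm squareTotal frozenVertical
  beta_reduce
  unfold InHexInterior at h
  clear hab
  rcases lt_trichotomy a i with ha | ha | ha <;> rcases lt_trichotomy b j with hb | hb | hb <;>
    grind

theorem exponent_topHeight_of_slanted_side {n i j : ℤ} (hi : 0 < i) (hj : j < n)
    {a b : ℤ} (hab : InHex n i j a b) (h : a + b = j ∨ a + b = n + i) :
    exponent n i j (topHeight n i j) (fun _ _ => 0) (frozenVertical n i j) a b = 0 := by
  unfold exponent
  simp only [level_northEast hi hj hab, level_northWest hi hj hab,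
    level_southWest hi hj hab, level_southEast hi hj hab]
  unfold InHex at hab
  unfold cornerTerm squareTotal frozenVertical
  beta_reduce
  rcases h with h | h
  · obtain rfl : b = j - a := by omega
    rcases eq_or_ne a 0 with h1 | h1 <;> rcases eq_or_ne a i with h2 | h2 <;>
      grind
  · obtain rfl : b = n + i - a := by omega
    rcases eq_or_ne a i with h1 | h1 <;> rcases eq_or_ne a (n + i - j) with h2 | h2 <;>
      grind

theorem exponent_topHeight_of_lattice_side {n i j : ℤ} (hi : 0 < i) (hj : j < n)
    {a b : ℤ} (hab : InHex n i j a b) (h1 : j < a + b) (h2 : a + b < n + i)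
    (h : a = 0 ∨ a = n + i - j ∨ b = n ∨ b = j - i) :
    exponent n i j (topHeight n i j) (fun _ _ => 0) (frozenVertical n i j) a b = 0 := by
  unfold exponent
  simp only [level_northEast hi hj hab, level_northWest hi hj hab,
    level_southWest hi hj hab, level_southEast hi hj hab]
  unfold InHex at hab
  unfold cornerTerm squareTotal frozenVertical
  beta_reduce
  rcases h with rfl | rfl | rfl | rfl
  · rcases eq_or_ne b n with h3 | h3 <;>
      grind
  · rcases eq_or_ne b (j - i) with h3 | h3 <;>
      grind
  · rcases eq_or_ne a 0 with h3 | h3 <;>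
      grind
  · rcases eq_or_ne a (n + i - j) with h3 | h3 <;>
      grind

/-- An interior point other than `(i, j)` is the end of exactly two level diagonals, both matched,
which cancel the constant 2; at `(i, j)` there are none. On the sides the frozen edges and
`cornerTerm` produce zero. -/
theorem exponent_topHeight {n i j : ℤ} (hi : 0 < i) (hij : i ≤ j) (hj : j < n) {a b : ℤ}
    (hab : InHex n i j a b) :
    exponent n i j (topHeight n i j) (fun _ _ => 0) (frozenVertical n i j) a b =
      if a = i ∧ b = j then 2 else 0 := by
  by_cases h : InHexInterior n i j a b
  · exact exponent_topHeight_of_interior hi hj h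
  rw [if_neg (by rintro ⟨rfl, rfl⟩; apply h; unfold InHexInterior; omega)]
  by_cases h1 : a + b = j ∨ a + b = n + i
  · exact exponent_topHeight_of_slanted_side hi hj hab h1
  · refine exponent_topHeight_of_lattice_side hi hj hab ?_ ?_ ?_ <;>
      unfold InHex at hab <;> unfold InHexInterior at h <;> omega

theorem isMaxWeight_topHeight {n i j : ℤ} (hi : 0 < i) (hij : i ≤ j) (hj : j < n)
    (O : ℤ → ℤ → ℤ → ℝ) : IsMaxWeight n i j O (topHeight n i j) (O i j (n + i - j)) := by
  have hv : topHeight n i j i j = n + i - j := by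
    rw [topHeight_northEast hi le_rfl le_rfl (by omega)]; ring
  have hw : matchingWeight n i j (fun a b => O a b (topHeight n i j a b)) (topHeight n i j)
      (fun _ _ => 0) (frozenVertical n i j) = 2 * O i j (n + i - j) := by
    unfold matchingWeight
    rw [Finset.sum_eq_single (i, j)]
    · rw [exponent_topHeight hi hij hj (by unfold InHex; omega), if_pos ⟨rfl, rfl⟩]
      simp only [hv]
      push_cast
      ring
    · rintro ⟨a, b⟩ hp hne
      rw [exponent_topHeight hi hij hj ((mem_hexFinset hij).1 hp), if_neg (by simpa using hne)]
      simp
    · intro h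
      exact absurd ((mem_hexFinset hij).2 (by unfold InHex; omega)) h
  refine ⟨fun X Y h => ?_, _, _, isMatched_frozen hi hj, hw⟩
  obtain ⟨rfl, rfl⟩ := h.eq_frozen hi hj
  exact hw.le

/-- The octahedron recurrence computes the maximal weight of the matchings of any surface below the
light cone. -/
theorem isMaxWeight {n i j : ℤ} (hi : 0 < i) (hij : i ≤ j) (hj : j < n)
    {O : ℤ → ℤ → ℤ → ℝ} (hO : OctahedronRule n i j O) {H : ℤ → ℤ → ℤ}
    (hH : IsSurface n i j H) : IsMaxWeight n i j O H (O i j (n + i - j)) := by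
  refine isMaxWeight_of_surface hi hij hj hO (fun H' _ h => ?_) hH
  obtain rfl : H' = topHeight n i j := by funext a b; exact h a b
  exact isMaxWeight_topHeight hi hij hj O

/-! ### Tilings in integer coordinates -/

/-- The functions `L₁`, `L₂`, `L₃`, `U`, `D` are the indicators of the lozenges of the three types
and of the upward and downward border triangles in a lozenge tiling of the hexagon. -/
structure IsTilingIndicator (n i j : ℤ) (L₁ L₂ L₃ U D : ℤ → ℤ → ℤ) : Prop where
  bit₁ : ∀ a b, L₁ a b = 0 ∨ L₁ a b = 1
  bit₂ : ∀ a b, L₂ a b = 0 ∨ L₂ a b = 1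
  bit₃ : ∀ a b, L₃ a b = 0 ∨ L₃ a b = 1
  supp₁ : ∀ a b, L₁ a b ≠ 0 → InHex n i j a (b + 1) ∧ InHex n i j (a + 1) b ∧
    InHex n i j (a + 2) b ∧ InHex n i j (a + 1) (b + 1)
  supp₂ : ∀ a b, L₂ a b ≠ 0 → InHex n i j (a + 1) b ∧ InHex n i j (a + 1) (b + 1) ∧
    InHex n i j a (b + 2) ∧ InHex n i j a (b + 1)
  supp₃ : ∀ a b, L₃ a b ≠ 0 → InHex n i j a b ∧ InHex n i j (a + 1) b ∧
    InHex n i j (a + 1) (b + 1) ∧ InHex n i j a (b + 1)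
  suppU : ∀ a b, U a b ≠ 0 → InHex n i j a (b + 1) ∧ InHex n i j (a + 1) (b + 1) ∧
    InHex n i j (a + 1) b
  suppD : ∀ a b, D a b ≠ 0 → InHex n i j a (b + 1) ∧ InHex n i j a b ∧ InHex n i j (a + 1) b
  level₃ : ∀ a b, L₃ a b ≠ 0 → a + b + 1 ≠ n
  levelU : ∀ a b, U a b ≠ 0 → a + b + 1 = n
  levelD : ∀ a b, D a b ≠ 0 → a + b + 1 = n
  up : ∀ a b, InHex n i j a (b + 1) → InHex n i j (a + 1) (b + 1) → InHex n i j (a + 1) b →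
    L₁ a b + L₂ a b + L₃ a b + U a b = 1
  down : ∀ a b, InHex n i j a (b + 1) → InHex n i j a b → InHex n i j (a + 1) b →
    L₁ (a - 1) b + L₂ a (b - 1) + L₃ a b + D a b = 1
  border : ∀ a b, a + b + 1 = n → InHex n i j a (b + 1) → InHex n i j (a + 1) b →
    U a b + D a b = 1

/-- The horizontal edges of the matching of a tiling. -/
def tilingHorizontal (L₂ : ℤ → ℤ → ℤ) (a b : ℤ) : ℤ := L₂ a (b - 1)

/-- The vertical edges of the matching of a tiling. -/
def tilingVertical (n i j : ℤ) (L₁ : ℤ → ℤ → ℤ) (a b : ℤ) : ℤ :=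
  L₁ (a - 1) b + frozenVertical n i j a b

theorem startHeight_cases (n a b : ℤ) :
    (n ≤ a + b ∧ startHeight n a b = a + b - n) ∨ (a + b ≤ n ∧ startHeight n a b = n - a - b) := by
  rcases le_total n (a + b) with h | h
  · exact Or.inl ⟨h, startHeight_of_le h⟩
  · exact Or.inr ⟨h, startHeight_of_ge h⟩

theorem frozenVertical_of_ne {n i j a b : ℤ} (h1 : a + b ≠ j - 1) (h2 : a + b ≠ n + i) :
    frozenVertical n i j a b = 0 := by
  unfold frozenVertical
  rw [if_neg (by omega)]

section

variable {n i j : ℤ} {L₁ L₂ L₃ U D : ℤ → ℤ → ℤ}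

/-- The support conditions extend the covering relation to all positions, with value 0 off the
hexagon, so it can be used uniformly at boundary points. -/
theorem IsTilingIndicator.up_eq (h : IsTilingIndicator n i j L₁ L₂ L₃ U D) (a b : ℤ) :
    L₁ a b + L₂ a b + L₃ a b + U a b =
      if InHex n i j a (b + 1) ∧ InHex n i j (a + 1) (b + 1) ∧ InHex n i j (a + 1) b
        then 1 else 0 := by
  split_ifs with k
  · exact h.up a b k.1 k.2.1 k.2.2
  · have h1 : L₁ a b = 0 := by
      by_contra h0; exact k ⟨(h.supp₁ a b h0).1, (h.supp₁ a b h0).2.2.2, (h.supp₁ a b h0).2.1⟩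
    have h2 : L₂ a b = 0 := by
      by_contra h0; exact k ⟨(h.supp₂ a b h0).2.2.2, (h.supp₂ a b h0).2.1, (h.supp₂ a b h0).1⟩
    have h3 : L₃ a b = 0 := by
      by_contra h0; exact k ⟨(h.supp₃ a b h0).2.2.2, (h.supp₃ a b h0).2.2.1, (h.supp₃ a b h0).2.1⟩
    have h4 : U a b = 0 := by
      by_contra h0; exact k (h.suppU a b h0)
    omega

theorem IsTilingIndicator.down_eq (h : IsTilingIndicator n i j L₁ L₂ L₃ U D) (a b : ℤ) :
    L₁ (a - 1) b + L₂ a (b - 1) + L₃ a b + D a b =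
      if InHex n i j a (b + 1) ∧ InHex n i j a b ∧ InHex n i j (a + 1) b then 1 else 0 := by
  split_ifs with k
  · exact h.down a b k.1 k.2.1 k.2.2
  · have h1 : L₁ (a - 1) b = 0 := by
      by_contra h0
      have := h.supp₁ _ _ h0
      rw [show a - 1 + 2 = a + 1 by ring, sub_add_cancel] at this
      exact k ⟨this.2.2.2, this.2.1, this.2.2.1⟩
    have h2 : L₂ a (b - 1) = 0 := by
      by_contra h0
      have := h.supp₂ _ _ h0
      rw [show b - 1 + 2 = b + 1 by ring, sub_add_cancel] at this
      exact k ⟨this.2.2.1, this.2.2.2, this.2.1⟩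
    have h3 : L₃ a b = 0 := by
      by_contra h0; exact k ⟨(h.supp₃ a b h0).2.2.2, (h.supp₃ a b h0).1, (h.supp₃ a b h0).2.1⟩
    have h4 : D a b = 0 := by
      by_contra h0; exact k (h.suppD a b h0)
    omega

theorem IsTilingIndicator.border_eq (h : IsTilingIndicator n i j L₁ L₂ L₃ U D) (a b : ℤ) :
    U a b + D a b =
      if a + b + 1 = n ∧ InHex n i j a (b + 1) ∧ InHex n i j (a + 1) b then 1 else 0 := by
  split_ifs with k
  · exact h.border a b k.1 k.2.1 k.2.2
  · have h1 : U a b = 0 := by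
      by_contra h0; exact k ⟨h.levelU a b h0, (h.suppU a b h0).1, (h.suppU a b h0).2.2⟩
    have h2 : D a b = 0 := by
      by_contra h0; exact k ⟨h.levelD a b h0, (h.suppD a b h0).1, (h.suppD a b h0).2.2⟩
    omega

/-- Lozenges of the first two types are the dual edges crossing their vertical or horizontal short
diagonal; the covering relations of the two triangles of a square become its matching condition. -/
theorem IsTilingIndicator.isMatched (h : IsTilingIndicator n i j L₁ L₂ L₃ U D) (hi : 0 < i)
    (hj : j < n) : IsMatched n i j (startHeight n) (tilingHorizontal L₂)
      (tilingVertical n i j L₁) := by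
  have outer₁ : ∀ a b, ¬ VerticalInner n i j a b → L₁ (a - 1) b = 0 := by
    intro a b hab
    by_contra h0
    have := h.supp₁ _ _ h0
    rw [show a - 1 + 2 = a + 1 by ring, sub_add_cancel] at this
    unfold InHex at this
    unfold VerticalInner at hab
    omega
  refine ⟨fun a b => h.bit₂ _ _, fun a b => ?_, fun a b hab => ?_, fun a b hab => ?_,
    fun a b hab => ?_⟩
  · unfold tilingVertical
    by_cases hab : VerticalInner n i j a b
    · rw [frozenVertical_of_ne (by unfold VerticalInner at hab; omega)
        (by unfold VerticalInner at hab; omega), add_zero]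
      exact h.bit₁ _ _
    · rw [outer₁ a b hab, zero_add]
      exact frozenVertical_bit n i j a b
  · unfold tilingHorizontal
    by_contra h0
    have := h.supp₂ _ _ h0
    rw [show b - 1 + 2 = b + 1 by ring, sub_add_cancel] at this
    unfold InHex at this
    unfold HorizontalInner at hab
    omega
  · unfold tilingVertical
    rw [outer₁ a b hab, zero_add]
  · have hu := h.up_eq a b
    have hd := h.down_eq a b
    have hb := h.border_eq a b
    have h3 := h.bit₃ a b
    have hl := h.level₃ a b
    have hs := h.supp₃ a b
    unfold tilingHorizontal tilingVertical
    simp only [add_sub_cancel_right]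
    unfold MeetsHex at hab
    by_cases hn : a + b + 1 = n
    -- On the equator the two covering relations add up to 2. One unit is the border triangle and a
    -- lozenge of the third type is excluded, so exactly one of the four lattice edges is matched.
    · rw [squareMatched_of_flat
        (by rw [startHeight_of_ge (by omega), startHeight_of_le (by omega)]; omega)
        (by rw [startHeight_of_ge (by omega), startHeight_of_ge (by omega)]; omega)]
      rw [frozenVertical_of_ne (by unfold InHex at hab; omega) (by omega),
        frozenVertical_of_ne (by unfold InHex at hab; omega) (by omega)]
      rw [if_pos (by unfold InHex at *; omega)] at hu hd hb
      omega
    · have c1 := startHeight_cases n a b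
      have c2 := startHeight_cases n (a + 1) b
      have c3 := startHeight_cases n a (b + 1)
      have c4 := startHeight_cases n (a + 1) (b + 1)
      have hU : U a b = 0 := by by_contra h0; exact hn (h.levelU a b h0)
      have hD : D a b = 0 := by by_contra h0; exact hn (h.levelD a b h0)
      have n1 : 0 ≤ L₁ a b := by have := h.bit₁ a b; omega
      have n2 : 0 ≤ L₂ a b := by have := h.bit₂ a b; omega
      rw [squareMatched_of_ne_left (by omega) (by omega)]
      clear c1 c2 c3 c4 hb
      -- A square cut by `BC` or `EF` has only one triangle in the hexagon; its frozen left or right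
      -- edge, respectively, stands for the cover of the missing one.
      by_cases hBC : a + b = j - 1
      · rw [frozenVertical_of_ne (a := a + 1) (by omega) (by omega)]
        unfold frozenVertical
        rw [if_pos (by unfold InHex at hab; omega)]
        rw [if_pos (by unfold InHex at *; omega)] at hu
        rw [if_neg (by unfold InHex; omega)] at hd
        have : L₃ a b = 0 := by by_contra h0; have := hs h0; unfold InHex at this; omega
        omega
      · rw [frozenVertical_of_ne (a := a) (by omega) (by unfold InHex at hab; omega)]
        rw [if_pos (by unfold InHex at *; omega)] at hd
        by_cases hEF : a + 1 + b = n + i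
        · unfold frozenVertical
          rw [if_pos (by unfold InHex at hab; omega)]
          rw [if_neg (by unfold InHex; omega)] at hu
          have : L₃ a b = 0 := by by_contra h0; have := hs h0; unfold InHex at this; omega
          omega
        · rw [frozenVertical_of_ne (by unfold InHex at hab; omega) hEF]
          rw [if_pos (by unfold InHex at *; omega)] at hu
          omega

/-! ### Tile coefficients and exponents -/

/-- Three times the coefficient with which the tiles of a tiling contribute to the point
`(a, b)`. -/
def tileCoefficient (L₁ L₂ L₃ U D : ℤ → ℤ → ℤ) (a b : ℤ) : ℤ :=
  (L₁ a (b - 1) + L₁ (a - 2) b - L₁ (a - 1) b - L₁ (a - 1) (b - 1)) +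
  (L₂ (a - 1) b + L₂ a (b - 2) - L₂ (a - 1) (b - 1) - L₂ a (b - 1)) +
  (L₃ a b + L₃ (a - 1) (b - 1) - L₃ (a - 1) b - L₃ a (b - 1)) +
  (U (a - 1) (b - 1) - U a (b - 1)) + (D a b - D a (b - 1))

/-- Three times the coefficient of the weight of the hexagon at the point `(a, b)`. -/
def hexagonCoefficient (n i j a b : ℤ) : ℤ :=
  (if a = 0 ∧ b = j then 1 else 0) + (if a = i ∧ b = j - i then 1 else 0) -
  (if a = n + i - j ∧ b = j - i then 1 else 0) + (if a = n + i - j ∧ b = j then 1 else 0) +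
  (if a = i ∧ b = n then 1 else 0)

/-- The relation between the numbers of triangles of the hexagon at a point and of frozen edges. -/
theorem triangle_count (hi : 0 < i) (hj : j < n) {a b : ℤ} (hab : InHex n i j a b) :
    2 * ((if InHex n i j a b ∧ InHex n i j (a + 1) b ∧ InHex n i j (a + 1) (b - 1) then 1 else 0) +
      (if InHex n i j (a - 1) b ∧ InHex n i j a b ∧ InHex n i j a (b - 1) then 1 else 0) +
      (if InHex n i j (a - 1) (b + 1) ∧ InHex n i j a (b + 1) ∧ InHex n i j a b then 1 else 0) +
      (if InHex n i j a b ∧ InHex n i j a (b - 1) ∧ InHex n i j (a + 1) (b - 1) then 1 else 0) +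
      (if InHex n i j a (b + 1) ∧ InHex n i j a b ∧ InHex n i j (a + 1) b then 1 else 0) +
      (if InHex n i j (a - 1) (b + 1) ∧ InHex n i j (a - 1) b ∧ InHex n i j a b then 1 else 0)) -
      4 * (if a + b = n ∧ InHex n i j a b ∧ InHex n i j (a + 1) (b - 1) then 1 else 0) -
      2 * (if a + b = n ∧ InHex n i j (a - 1) (b + 1) ∧ InHex n i j a b then 1 else 0) +
      2 * hexagonCoefficient n i j a b =
    3 * (cornerTerm n i j a b + 2 - 2 * frozenVertical n i j a b -
      2 * frozenVertical n i j a (b - 1) + if a + b = n then 0 else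
      (if InHex n i j a b ∧ InHex n i j (a + 1) b ∧ InHex n i j (a + 1) (b - 1) then 1 else 0) +
      (if InHex n i j (a - 1) (b + 1) ∧ InHex n i j a (b + 1) ∧ InHex n i j a b then 1 else 0) +
      (if InHex n i j a b ∧ InHex n i j a (b - 1) ∧ InHex n i j (a + 1) (b - 1) then 1 else 0) +
      (if InHex n i j (a - 1) (b + 1) ∧ InHex n i j (a - 1) b ∧ InHex n i j a b then 1 else 0) +
      frozenVertical n i j (a - 1) b + frozenVertical n i j a b + frozenVertical n i j a (b - 1) +
      frozenVertical n i j (a + 1) (b - 1) - 2) := by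
  have u1 : InHex n i j a b ∧ InHex n i j (a + 1) b ∧ InHex n i j (a + 1) (b - 1) ↔
      a < n + i - j ∧ j - i < b ∧ a + b < n + i := by unfold InHex at *; omega
  have u2 : InHex n i j (a - 1) b ∧ InHex n i j a b ∧ InHex n i j a (b - 1) ↔
      0 < a ∧ j - i < b ∧ j < a + b := by unfold InHex at *; omega
  have u3 : InHex n i j (a - 1) (b + 1) ∧ InHex n i j a (b + 1) ∧ InHex n i j a b ↔
      0 < a ∧ b < n ∧ a + b < n + i := by unfold InHex at *; omega
  have d1 : InHex n i j a b ∧ InHex n i j a (b - 1) ∧ InHex n i j (a + 1) (b - 1) ↔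
      a < n + i - j ∧ j - i < b ∧ j < a + b := by unfold InHex at *; omega
  have d2 : InHex n i j a (b + 1) ∧ InHex n i j a b ∧ InHex n i j (a + 1) b ↔
      a < n + i - j ∧ b < n ∧ a + b < n + i := by unfold InHex at *; omega
  have d3 : InHex n i j (a - 1) (b + 1) ∧ InHex n i j (a - 1) b ∧ InHex n i j a b ↔
      0 < a ∧ b < n ∧ j < a + b := by unfold InHex at *; omega
  have b1 : InHex n i j a b ∧ InHex n i j (a + 1) (b - 1) ↔ a < n + i - j ∧ j - i < b := by
    unfold InHex at *; omega
  have b2 : InHex n i j (a - 1) (b + 1) ∧ InHex n i j a b ↔ 0 < a ∧ b < n := by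
    unfold InHex at *; omega
  have f0 : frozenVertical n i j a b = if a + b = n + i ∧ i < a then 1 else 0 :=
    if_congr (by unfold InHex at hab; omega) rfl rfl
  have f1 : frozenVertical n i j a (b - 1) = if a + b = j ∧ a < i then 1 else 0 :=
    if_congr (by unfold InHex at hab; omega) rfl rfl
  have f2 : frozenVertical n i j (a - 1) b = if a + b = j ∧ 0 < a then 1 else 0 :=
    if_congr (by unfold InHex at hab; omega) rfl rfl
  have f3 : frozenVertical n i j (a + 1) (b - 1) =
      if a + b = n + i ∧ a < n + i - j then 1 else 0 :=
    if_congr (by unfold InHex at hab; omega) rfl rfl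
  simp only [u1, u2, u3, d1, d2, d3, b1, b2, f0, f1, f2, f3]
  clear u1 u2 u3 d1 d2 d3 b1 b2 f0 f1 f2 f3
  unfold hexagonCoefficient cornerTerm
  unfold InHex at hab
  by_cases h1 : a + b = j
  · obtain rfl : b = j - a := by omega
    rcases eq_or_ne a 0 with h1 | h1 <;> rcases eq_or_ne a i with h2 | h2 <;> grind (splits := 20)
  by_cases h2 : a + b = n + i
  · obtain rfl : b = n + i - a := by omega
    rcases eq_or_ne a i with h1 | h1 <;> rcases eq_or_ne a (n + i - j) with h2 | h2 <;> grind
        (splits := 20)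
  by_cases h3 : a = 0
  · rcases eq_or_ne b n with h3 | h3 <;> grind (splits := 20)
  by_cases h4 : a = n + i - j
  · rcases eq_or_ne b (j - i) with h3 | h3 <;> grind (splits := 20)
  by_cases h5 : b = n
  · grind (splits := 20)
  by_cases h6 : b = j - i
  · grind (splits := 20)
  by_cases h7 : a + b = n <;> grind (splits := 20)

/-- The two sides differ by a combination of the covering relations of the six triangles at the
point and the relations of its two border edges. What remains is an identity of constants,
`triangle_count`; the factor 3 is the denominator in the tile weights. -/
theorem IsTilingIndicator.exponent_eq (h : IsTilingIndicator n i j L₁ L₂ L₃ U D) (hi : 0 < i)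
    (hj : j < n) {a b : ℤ} (hab : InHex n i j a b) :
    2 * (tileCoefficient L₁ L₂ L₃ U D a b + hexagonCoefficient n i j a b) =
      3 * exponent n i j (startHeight n) (tilingHorizontal L₂) (tilingVertical n i j L₁) a b := by
  have key := triangle_count hi hj hab
  have u1 := h.up_eq a (b - 1)
  have u2 := h.up_eq (a - 1) (b - 1)
  have u3 := h.up_eq (a - 1) b
  have d1 := h.down_eq a (b - 1)
  have d2 := h.down_eq a b
  have d3 := h.down_eq (a - 1) b
  have b1 := h.border_eq a (b - 1)
  have b2 := h.border_eq (a - 1) b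
  simp only [sub_add_cancel] at u1 u2 u3 d1 d2 d3 b1 b2
  rw [show a - 1 - 1 = a - 2 by ring] at d3
  rw [show b - 1 - 1 = b - 2 by ring] at d1
  rw [show a + (b - 1) + 1 = a + b by ring] at b1
  rw [show a - 1 + b + 1 = a + b by ring] at b2
  -- Trades each indicator of a triangle or border edge in `triangle_count` for the tiles that cover
  -- it.
  rw [← u1, ← u2, ← u3, ← d1, ← d2, ← d3, ← b1, ← b2] at key
  unfold exponent squareTotal tilingHorizontal tilingVertical
  simp only [sub_add_cancel, add_sub_cancel_right]
  rw [show a - 1 - 1 = a - 2 by ring, show b - 1 - 1 = b - 2 by ring]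
  have c1 := startHeight_cases n (a + 1) b
  have c2 := startHeight_cases n (a - 1) b
  have c3 := startHeight_cases n a (b + 1)
  have c4 := startHeight_cases n a (b - 1)
  have e1 : startHeight n (a + 1) b = startHeight n a (b + 1) := by clear key; omega
  have e2 : startHeight n (a - 1) b = startHeight n a (b - 1) := by clear key; omega
  have e3 : startHeight n (a - 1) b = startHeight n a (b + 1) ↔ a + b = n := by clear key; omega
  have e4 : startHeight n (a + 1) b = startHeight n a (b - 1) ↔ a + b = n := by clear key; omega
  rw [if_pos e1, if_pos e2]
  unfold tileCoefficient
  by_cases hn : a + b = n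
  · rw [if_pos (e3.2 hn), if_pos (e4.2 hn)]
    rw [if_pos hn] at key
    have l1 : L₃ (a - 1) b = 0 := by
      by_contra h0; exact h.level₃ _ _ h0 (by omega)
    have l2 : L₃ a (b - 1) = 0 := by
      by_contra h0; exact h.level₃ _ _ h0 (by omega)
    linarith
  · rw [if_neg (mt e3.1 hn), if_neg (mt e4.1 hn)]
    rw [if_neg hn] at key
    have l1 : U (a - 1) b = 0 := by
      by_contra h0; exact hn (by have := h.levelU _ _ h0; omega)
    have l2 : U a (b - 1) = 0 := by
      by_contra h0; exact hn (by have := h.levelU _ _ h0; omega)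
    have l3 : D (a - 1) b = 0 := by
      by_contra h0; exact hn (by have := h.levelD _ _ h0; omega)
    have l4 : D a (b - 1) = 0 := by
      by_contra h0; exact hn (by have := h.levelD _ _ h0; omega)
    linarith

end

/-! ### Lozenge tilings and matchings of the initial surface -/

theorem mem_hexagon_iff {n i j : ℕ} (hij : i ≤ j) (hj : j < n) (p q : ℕ) :
    (p, q) ∈ hexagon n (i, j) ↔ InHex n i j p q := by
  simp only [hexagon, Set.mem_ofPred_eq]
  unfold InHex
  omega

theorem up_subset_iff (p q : ℕ) (t : Tile) : (UnitTriangle.up p q).verts ⊆ t.verts ↔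
    t = .loz₁ p q ∨ t = .loz₂ p q ∨ t = .loz₃ p q ∨ t = .tri (.up p q) := by
  rcases t with ⟨a, b⟩ | ⟨a, b⟩ | ⟨a, b⟩ | ⟨⟨a, b⟩ | ⟨a, b⟩⟩ <;>
    simp only [UnitTriangle.verts, Tile.verts, Finset.insert_subset_iff,
      Finset.singleton_subset_iff, Finset.mem_insert, Finset.mem_singleton, Prod.mk.injEq,
      Tile.loz₁.injEq, Tile.loz₂.injEq, Tile.loz₃.injEq, Tile.tri.injEq, UnitTriangle.up.injEq,
      reduceCtorEq, false_or, or_false, iff_false] <;> omega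

/-- The guards matter because of truncated subtraction: for `p = 0` the tile `.loz₁ (p - 1) q` would
be one that does not contain the triangle, and similarly for `q = 0`. -/
theorem down_subset_iff (p q : ℕ) (t : Tile) : (UnitTriangle.down p q).verts ⊆ t.verts ↔
    (0 < p ∧ t = .loz₁ (p - 1) q) ∨ (0 < q ∧ t = .loz₂ p (q - 1)) ∨ t = .loz₃ p q ∨
      t = .tri (.down p q) := by
  rcases t with ⟨a, b⟩ | ⟨a, b⟩ | ⟨a, b⟩ | ⟨⟨a, b⟩ | ⟨a, b⟩⟩ <;>
    simp only [UnitTriangle.verts, Tile.verts, Finset.insert_subset_iff,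
      Finset.singleton_subset_iff, Finset.mem_insert, Finset.mem_singleton, Prod.mk.injEq,
      Tile.loz₁.injEq, Tile.loz₂.injEq, Tile.loz₃.injEq, Tile.tri.injEq, UnitTriangle.down.injEq,
      reduceCtorEq, false_or, or_false, and_false, iff_false] <;> omega

/-- The indicator of the tiles `k p q` in `Ξ`, as a function on all of `ℤ × ℤ`. -/
def tileIndicator (Ξ : Finset Tile) (k : ℕ → ℕ → Tile) (a b : ℤ) : ℤ :=
  if 0 ≤ a ∧ 0 ≤ b ∧ k a.toNat b.toNat ∈ Ξ then 1 else 0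

theorem tileIndicator_bit (Ξ : Finset Tile) (k : ℕ → ℕ → Tile) (a b : ℤ) :
    tileIndicator Ξ k a b = 0 ∨ tileIndicator Ξ k a b = 1 := by
  unfold tileIndicator; split_ifs <;> simp

theorem tileIndicator_natCast (Ξ : Finset Tile) (k : ℕ → ℕ → Tile) (p q : ℕ) :
    tileIndicator Ξ k p q = if k p q ∈ Ξ then 1 else 0 := by
  unfold tileIndicator
  simp

theorem tileIndicator_pred_left (Ξ : Finset Tile) (k : ℕ → ℕ → Tile) (p q : ℕ) :
    tileIndicator Ξ k (p - 1) q = if 0 < p ∧ k (p - 1) q ∈ Ξ then 1 else 0 := by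
  rcases p with _ | p
  · simp [tileIndicator]
  · rw [Nat.cast_succ, add_sub_cancel_right, tileIndicator_natCast]
    simp

theorem tileIndicator_pred_right (Ξ : Finset Tile) (k : ℕ → ℕ → Tile) (p q : ℕ) :
    tileIndicator Ξ k p (q - 1) = if 0 < q ∧ k p (q - 1) ∈ Ξ then 1 else 0 := by
  rcases q with _ | q
  · simp [tileIndicator]
  · rw [Nat.cast_succ, add_sub_cancel_right, tileIndicator_natCast]
    simp

theorem exists_of_tileIndicator_ne_zero {Ξ : Finset Tile} {k : ℕ → ℕ → Tile} {a b : ℤ}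
    (h : tileIndicator Ξ k a b ≠ 0) : ∃ p q : ℕ, a = p ∧ b = q ∧ k p q ∈ Ξ := by
  unfold tileIndicator at h
  split_ifs at h with h'
  · exact ⟨a.toNat, b.toNat, by omega, by omega, h'.2.2⟩
  · exact absurd rfl h

section

variable {n i j : ℕ} {Ξ : Finset Tile}

theorem IsLozengeTiling.inHex (h : IsLozengeTiling n (i, j) Ξ) (hij : i ≤ j) (hj : j < n)
    {t : Tile} (ht : t ∈ Ξ) {p q : ℕ} (hp : (p, q) ∈ t.verts) : InHex n i j p q :=
  (mem_hexagon_iff hij hj p q).1 (h.subset t ht _ hp)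

theorem IsLozengeTiling.isTilingIndicator (h : IsLozengeTiling n (i, j) Ξ) (hij : i ≤ j)
    (hj : j < n) : IsTilingIndicator n i j (tileIndicator Ξ .loz₁) (tileIndicator Ξ .loz₂)
      (tileIndicator Ξ .loz₃) (tileIndicator Ξ fun p q => .tri (.up p q))
      (tileIndicator Ξ fun p q => .tri (.down p q)) := by
  have inH := fun {t : Tile} (ht : t ∈ Ξ) {p q : ℕ} => h.inHex hij hj (p := p) (q := q) ht
  refine ⟨tileIndicator_bit _ _, tileIndicator_bit _ _, tileIndicator_bit _ _, ?_, ?_, ?_, ?_, ?_,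
    ?_, ?_, ?_, ?_, ?_, ?_⟩
  · intro a b h0
    obtain ⟨p, q, rfl, rfl, ht⟩ := exists_of_tileIndicator_ne_zero h0
    exact_mod_cast And.intro (inH ht (by simp [Tile.verts])) (And.intro
      (inH ht (by simp [Tile.verts])) (And.intro (inH ht (by simp [Tile.verts]))
      (inH ht (by simp [Tile.verts]))))
  · intro a b h0
    obtain ⟨p, q, rfl, rfl, ht⟩ := exists_of_tileIndicator_ne_zero h0
    exact_mod_cast And.intro (inH ht (by simp [Tile.verts])) (And.intro
      (inH ht (by simp [Tile.verts])) (And.intro (inH ht (by simp [Tile.verts]))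
      (inH ht (by simp [Tile.verts]))))
  · intro a b h0
    obtain ⟨p, q, rfl, rfl, ht⟩ := exists_of_tileIndicator_ne_zero h0
    exact_mod_cast And.intro (inH ht (by simp [Tile.verts])) (And.intro
      (inH ht (by simp [Tile.verts])) (And.intro (inH ht (by simp [Tile.verts]))
      (inH ht (by simp [Tile.verts]))))
  · intro a b h0
    obtain ⟨p, q, rfl, rfl, ht⟩ := exists_of_tileIndicator_ne_zero h0
    exact_mod_cast And.intro (inH ht (by simp [Tile.verts, UnitTriangle.verts])) (And.intro
      (inH ht (by simp [Tile.verts, UnitTriangle.verts]))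
      (inH ht (by simp [Tile.verts, UnitTriangle.verts])))
  · intro a b h0
    obtain ⟨p, q, rfl, rfl, ht⟩ := exists_of_tileIndicator_ne_zero h0
    exact_mod_cast And.intro (inH ht (by simp [Tile.verts, UnitTriangle.verts])) (And.intro
      (inH ht (by simp [Tile.verts, UnitTriangle.verts]))
      (inH ht (by simp [Tile.verts, UnitTriangle.verts])))
  · intro a b h0
    obtain ⟨p, q, rfl, rfl, ht⟩ := exists_of_tileIndicator_ne_zero h0
    have := h.allowed _ ht
    simp [Tile.Allowed, InHalf, Tile.verts] at this
    omega
  · intro a b h0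
    obtain ⟨p, q, rfl, rfl, ht⟩ := exists_of_tileIndicator_ne_zero h0
    have := h.allowed _ ht
    simp only [Tile.Allowed] at this
    omega
  · intro a b h0
    obtain ⟨p, q, rfl, rfl, ht⟩ := exists_of_tileIndicator_ne_zero h0
    have := h.allowed _ ht
    simp only [Tile.Allowed] at this
    omega
  · intro a b h1 h2 h3
    lift a to ℕ using h1.1
    lift b to ℕ using (by unfold InHex at h3; omega)
    obtain ⟨t, ⟨ht, hs⟩, huniq⟩ := h.cover (.up a b) (by
      simp only [UnitTriangle.verts, Finset.mem_insert, Finset.mem_singleton]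
      rintro p (rfl | rfl | rfl) <;> rw [mem_hexagon_iff hij hj] <;> assumption_mod_cast)
    have hu : ∀ t', t' ∈ Ξ → (t' = .loz₁ a b ∨ t' = .loz₂ a b ∨ t' = .loz₃ a b ∨
        t' = .tri (.up a b)) → t' = t :=
      fun t' ht' hs' => huniq t' ⟨ht', (up_subset_iff a b t').2 hs'⟩
    have u1 : Tile.loz₁ a b ∈ Ξ → Tile.loz₁ a b = t := fun h' => hu _ h' (Or.inl rfl)
    have u2 : Tile.loz₂ a b ∈ Ξ → Tile.loz₂ a b = t := fun h' => hu _ h' (Or.inr (Or.inl rfl))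
    have u3 : Tile.loz₃ a b ∈ Ξ → Tile.loz₃ a b = t :=
      fun h' => hu _ h' (Or.inr (Or.inr (Or.inl rfl)))
    have u4 : Tile.tri (.up a b) ∈ Ξ → Tile.tri (.up a b) = t :=
      fun h' => hu _ h' (Or.inr (Or.inr (Or.inr rfl)))
    simp only [tileIndicator_natCast]
    rcases (up_subset_iff a b t).1 hs with rfl | rfl | rfl | rfl
    · rw [if_pos ht, if_neg (fun h => nomatch u2 h), if_neg (fun h => nomatch u3 h),
        if_neg (fun h => nomatch u4 h)]
      rfl
    · rw [if_neg (fun h => nomatch u1 h), if_pos ht, if_neg (fun h => nomatch u3 h),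
        if_neg (fun h => nomatch u4 h)]
      rfl
    · rw [if_neg (fun h => nomatch u1 h), if_neg (fun h => nomatch u2 h), if_pos ht,
        if_neg (fun h => nomatch u4 h)]
      rfl
    · rw [if_neg (fun h => nomatch u1 h), if_neg (fun h => nomatch u2 h),
        if_neg (fun h => nomatch u3 h), if_pos ht]
      rfl
  · intro a b h1 h2 h3
    lift a to ℕ using h1.1
    lift b to ℕ using (by unfold InHex at h3; omega)
    obtain ⟨t, ⟨ht, hs⟩, huniq⟩ := h.cover (.down a b) (by
      simp only [UnitTriangle.verts, Finset.mem_insert, Finset.mem_singleton]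
      rintro p (rfl | rfl | rfl) <;> rw [mem_hexagon_iff hij hj] <;> assumption_mod_cast)
    have hu : ∀ t', t' ∈ Ξ → ((0 < a ∧ t' = .loz₁ (a - 1) b) ∨ (0 < b ∧ t' = .loz₂ a (b - 1)) ∨
        t' = .loz₃ a b ∨ t' = .tri (.down a b)) → t' = t :=
      fun t' ht' hs' => huniq t' ⟨ht', (down_subset_iff a b t').2 hs'⟩
    have u1 : 0 < a ∧ Tile.loz₁ (a - 1) b ∈ Ξ → Tile.loz₁ (a - 1) b = t :=
      fun h' => hu _ h'.2 (Or.inl ⟨h'.1, rfl⟩)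
    have u2 : 0 < b ∧ Tile.loz₂ a (b - 1) ∈ Ξ → Tile.loz₂ a (b - 1) = t :=
      fun h' => hu _ h'.2 (Or.inr (Or.inl ⟨h'.1, rfl⟩))
    have u3 : Tile.loz₃ a b ∈ Ξ → Tile.loz₃ a b = t :=
      fun h' => hu _ h' (Or.inr (Or.inr (Or.inl rfl)))
    have u4 : Tile.tri (.down a b) ∈ Ξ → Tile.tri (.down a b) = t :=
      fun h' => hu _ h' (Or.inr (Or.inr (Or.inr rfl)))
    rw [tileIndicator_pred_left, tileIndicator_pred_right]
    simp only [tileIndicator_natCast]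
    rcases (down_subset_iff a b t).1 hs with ⟨h0, rfl⟩ | ⟨h0, rfl⟩ | rfl | rfl
    · rw [if_pos ⟨h0, ht⟩, if_neg (fun h => nomatch u2 h), if_neg (fun h => nomatch u3 h),
        if_neg (fun h => nomatch u4 h)]
      rfl
    · rw [if_neg (fun h => nomatch u1 h), if_pos ⟨h0, ht⟩, if_neg (fun h => nomatch u3 h),
        if_neg (fun h => nomatch u4 h)]
      rfl
    · rw [if_neg (fun h => nomatch u1 h), if_neg (fun h => nomatch u2 h), if_pos ht,
        if_neg (fun h => nomatch u4 h)]
      rfl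
    · rw [if_neg (fun h => nomatch u1 h), if_neg (fun h => nomatch u2 h),
        if_neg (fun h => nomatch u3 h), if_pos ht]
      rfl
  · intro a b hn h1 h2
    lift a to ℕ using h1.1
    lift b to ℕ using (by unfold InHex at h2; omega)
    have hx := h.border a b (by exact_mod_cast hn)
      ((mem_hexagon_iff hij hj _ _).2 (by exact_mod_cast h1))
      ((mem_hexagon_iff hij hj _ _).2 (by exact_mod_cast h2))
    simp only [tileIndicator_natCast]
    rcases hx with ⟨h1, h2⟩ | ⟨h1, h2⟩ <;> simp [h1, h2]

end

/-! ### The weight of a tiling as a sum over lattice points -/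

/-- The position of a tile. -/
def Tile.position : Tile → ℕ × ℕ
  | .loz₁ p q => (p, q)
  | .loz₂ p q => (p, q)
  | .loz₃ p q => (p, q)
  | .tri (.up p q) => (p, q)
  | .tri (.down p q) => (p, q)

/-- The sum of the values of `g` at the tiles `k p q` in `Ξ`. -/
noncomputable def kindSum (n : ℕ) (Ξ : Finset Tile) (k : ℕ → ℕ → Tile) (g : ℕ → ℕ → ℝ) : ℝ :=
  ∑ x ∈ Finset.range (n + 1) ×ˢ Finset.range (n + 1), if k x.1 x.2 ∈ Ξ then g x.1 x.2 else 0

theorem sum_tiles {n : ℕ} {Ξ : Finset Tile} (h : ∀ t ∈ Ξ, t.position.1 ≤ n ∧ t.position.2 ≤ n)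
    (g : Tile → ℝ) : ∑ t ∈ Ξ, g t =
      kindSum n Ξ .loz₁ (fun p q => g (.loz₁ p q)) + kindSum n Ξ .loz₂ (fun p q => g (.loz₂ p q)) +
      kindSum n Ξ .loz₃ (fun p q => g (.loz₃ p q)) +
      kindSum n Ξ (fun p q => .tri (.up p q)) (fun p q => g (.tri (.up p q))) +
      kindSum n Ξ (fun p q => .tri (.down p q)) (fun p q => g (.tri (.down p q))) := by
  unfold kindSum
  rw [← Finset.sum_add_distrib, ← Finset.sum_add_distrib, ← Finset.sum_add_distrib,
    ← Finset.sum_add_distrib, ← Finset.sum_fiberwise_of_maps_to (g := Tile.position)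
      (t := Finset.range (n + 1) ×ˢ Finset.range (n + 1))]
  · refine Finset.sum_congr rfl ?_
    rintro ⟨p, q⟩ -
    have hfil : Ξ.filter (fun t => t.position = (p, q)) =
        ({.loz₁ p q, .loz₂ p q, .loz₃ p q, .tri (.up p q), .tri (.down p q)} :
          Finset Tile).filter (· ∈ Ξ) := by
      ext t
      rw [Finset.mem_filter, Finset.mem_filter, and_comm]
      refine and_congr_left fun _ => ?_
      rcases t with ⟨a, b⟩ | ⟨a, b⟩ | ⟨a, b⟩ | ⟨⟨a, b⟩ | ⟨a, b⟩⟩ <;> simp [Tile.position]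
    rw [hfil, Finset.sum_filter, Finset.sum_insert (by simp), Finset.sum_insert (by simp),
      Finset.sum_insert (by simp), Finset.sum_insert (by simp), Finset.sum_singleton]
    ring
  · intro t ht
    have := h t ht
    simp only [Finset.mem_product, Finset.mem_range]
    omega

/-- Reindexing by the vertex at offset `(d₁, d₂)` turns one term of the tile weights into a sum over
lattice points of the hexagon. -/
theorem kindSum_shift {n i j : ℕ} (hij : i ≤ j) {Ξ : Finset Tile}
    {k : ℕ → ℕ → Tile} (F : ℤ → ℤ → ℝ) (d₁ d₂ : ℕ)
    (h : ∀ p q, k p q ∈ Ξ → (p ≤ n ∧ q ≤ n) ∧ InHex n i j ((p : ℤ) + d₁) ((q : ℤ) + d₂)) :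
    kindSum n Ξ k (fun p q => F ((p : ℤ) + d₁) ((q : ℤ) + d₂)) =
      ∑ y ∈ hexFinset n i j, F y.1 y.2 * tileIndicator Ξ k (y.1 - d₁) (y.2 - d₂) := by
  unfold kindSum
  rw [← Finset.sum_filter]
  refine Finset.sum_of_injOn (fun x => ((x.1 : ℤ) + d₁, (x.2 : ℤ) + d₂)) ?_ ?_ ?_ ?_
  · rintro ⟨a, b⟩ - ⟨c, d⟩ - hxy
    simp only [Prod.mk.injEq, add_left_inj, Nat.cast_inj] at hxy ⊢
    exact hxy
  · rintro ⟨a, b⟩ hx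
    simp only [Finset.coe_filter, Finset.mem_product, Finset.mem_range, Set.mem_ofPred_eq] at hx
    exact (mem_hexFinset (by exact_mod_cast hij)).2 (h a b hx.2).2
  · rintro ⟨a, b⟩ - hx
    refine mul_eq_zero_of_right _ ?_
    by_contra h0
    obtain ⟨p, q, hp, hq, ht⟩ := exists_of_tileIndicator_ne_zero (by exact_mod_cast h0)
    refine hx ⟨(p, q), ?_, ?_⟩
    · have := (h p q ht).1
      simp only [Finset.coe_filter, Finset.mem_product, Finset.mem_range, Set.mem_ofPred_eq]
      exact ⟨⟨by omega, by omega⟩, ht⟩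
    · simp only [Prod.mk.injEq] at hp hq ⊢
      omega
  · rintro ⟨a, b⟩ hx
    simp only [Finset.mem_filter] at hx
    simp only [add_sub_cancel_right]
    rw [tileIndicator_natCast, if_pos hx.2]
    simp

theorem kindSum_lozenge (n : ℕ) (Ξ : Finset Tile) (k : ℕ → ℕ → Tile) (A B C D : ℕ → ℕ → ℝ) :
    kindSum n Ξ k (fun p q => (1 / 3 : ℝ) • (A p q + B p q - C p q - D p q)) =
      1 / 3 * (kindSum n Ξ k A + kindSum n Ξ k B - kindSum n Ξ k C - kindSum n Ξ k D) := by
  unfold kindSum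
  rw [← Finset.sum_add_distrib, ← Finset.sum_sub_distrib, ← Finset.sum_sub_distrib,
    Finset.mul_sum]
  refine Finset.sum_congr rfl fun x _ => ?_
  split_ifs <;> simp

theorem kindSum_triangle (n : ℕ) (Ξ : Finset Tile) (k : ℕ → ℕ → Tile) (A B : ℕ → ℕ → ℝ) :
    kindSum n Ξ k (fun p q => (1 / 3 : ℝ) • (A p q - B p q)) =
      1 / 3 * (kindSum n Ξ k A - kindSum n Ξ k B) := by
  unfold kindSum
  rw [← Finset.sum_sub_distrib, Finset.mul_sum]
  refine Finset.sum_congr rfl fun x _ => ?_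
  split_ifs <;> simp

theorem sum_hexFinset_single {n i j : ℤ} (hij : i ≤ j) (F : ℤ → ℤ → ℝ) {a b : ℤ}
    (hab : InHex n i j a b) :
    ∑ y ∈ hexFinset n i j, F y.1 y.2 * ((if y.1 = a ∧ y.2 = b then 1 else 0 : ℤ) : ℝ) = F a b := by
  rw [Finset.sum_eq_single (a, b)]
  · simp
  · rintro ⟨c, d⟩ - hne
    rw [if_neg (by simpa using hne)]
    simp
  · intro hn
    exact absurd ((mem_hexFinset hij).2 hab) hn

section

variable {n i j : ℕ} {Ξ : Finset Tile}

theorem IsLozengeTiling.position_le (h : IsLozengeTiling n (i, j) Ξ) (hij : i ≤ j) (hj : j < n)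
    {t : Tile} (ht : t ∈ Ξ) : t.position.1 ≤ n ∧ t.position.2 ≤ n := by
  have inH := fun {p q : ℕ} => h.inHex hij hj (p := p) (q := q) ht
  rcases t with ⟨a, b⟩ | ⟨a, b⟩ | ⟨a, b⟩ | ⟨⟨a, b⟩ | ⟨a, b⟩⟩
  · have h1 := inH (p := a + 1) (q := b) (by simp [Tile.verts])
    unfold InHex at h1
    simp only [Tile.position]
    omega
  · have h1 := inH (p := a + 1) (q := b) (by simp [Tile.verts])
    unfold InHex at h1
    simp only [Tile.position]
    omega
  · have h1 := inH (p := a + 1) (q := b) (by simp [Tile.verts])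
    unfold InHex at h1
    simp only [Tile.position]
    omega
  · have h1 := inH (p := a + 1) (q := b) (by simp [Tile.verts, UnitTriangle.verts])
    unfold InHex at h1
    simp only [Tile.position]
    omega
  · have h1 := inH (p := a + 1) (q := b) (by simp [Tile.verts, UnitTriangle.verts])
    unfold InHex at h1
    simp only [Tile.position]
    omega

theorem IsLozengeTiling.kindSum_eq (h : IsLozengeTiling n (i, j) Ξ) (hij : i ≤ j) (hj : j < n)
    (f : ℕ × ℕ → ℝ) (k : ℕ → ℕ → Tile) (d₁ d₂ : ℕ)
    (hk : ∀ p q, (k p q).position = (p, q) ∧ (p + d₁, q + d₂) ∈ (k p q).verts) :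
    kindSum n Ξ k (fun p q => f (p + d₁, q + d₂)) = ∑ y ∈ hexFinset n i j,
      f (y.1.toNat, y.2.toNat) * tileIndicator Ξ k (y.1 - d₁) (y.2 - d₂) := by
  rw [← kindSum_shift hij (fun a b => f (a.toNat, b.toNat)) d₁ d₂]
  · congr 1
  · intro p q ht
    have h1 := h.position_le hij hj ht
    rw [(hk p q).1] at h1
    exact ⟨h1, by exact_mod_cast h.inHex hij hj ht (hk p q).2⟩

theorem IsLozengeTiling.two_mul_tilingWeight (h : IsLozengeTiling n (i, j) Ξ) (hi : 0 < i)
    (hij : i ≤ j) (hj : j < n) (f : ℕ × ℕ → ℝ) :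
    2 * tilingWeight n (i, j) Ξ f = matchingWeight n i j (fun a b => f (a.toNat, b.toNat))
      (startHeight n) (tilingHorizontal (tileIndicator Ξ .loz₂))
      (tilingVertical n i j (tileIndicator Ξ .loz₁)) := by
  have hI := h.isTilingIndicator hij hj
  have hexp : 3 * matchingWeight n i j (fun a b => f (a.toNat, b.toNat))
      (startHeight n) (tilingHorizontal (tileIndicator Ξ .loz₂))
      (tilingVertical n i j (tileIndicator Ξ .loz₁)) =
      2 * ∑ y ∈ hexFinset n i j, f (y.1.toNat, y.2.toNat) *
        ((tileCoefficient (tileIndicator Ξ .loz₁) (tileIndicator Ξ .loz₂)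
          (tileIndicator Ξ .loz₃) (tileIndicator Ξ fun p q => .tri (.up p q))
          (tileIndicator Ξ fun p q => .tri (.down p q)) y.1 y.2 +
          hexagonCoefficient n i j y.1 y.2 : ℤ) : ℝ) := by
    unfold matchingWeight
    rw [Finset.mul_sum, Finset.mul_sum]
    refine Finset.sum_congr rfl ?_
    rintro ⟨a, b⟩ hy
    have := hI.exponent_eq (by exact_mod_cast hi) (by exact_mod_cast hj)
      ((mem_hexFinset (by exact_mod_cast hij)).1 hy)
    have : (2 : ℝ) * ((tileCoefficient (tileIndicator Ξ .loz₁) (tileIndicator Ξ .loz₂)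
          (tileIndicator Ξ .loz₃) (tileIndicator Ξ fun p q => .tri (.up p q))
          (tileIndicator Ξ fun p q => .tri (.down p q)) a b +
          hexagonCoefficient n i j a b : ℤ) : ℝ) =
        3 * (exponent n i j (startHeight n) (tilingHorizontal (tileIndicator Ξ .loz₂))
      (tilingVertical n i j (tileIndicator Ξ .loz₁)) a b : ℤ) := by exact_mod_cast this
    linear_combination (-f (a.toNat, b.toNat)) * this
  have hij' : (i : ℤ) ≤ j := by exact_mod_cast hij
  have h1 := sum_hexFinset_single (n := n) hij' (fun a b => f (a.toNat, b.toNat))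
    (a := 0) (b := j) (by unfold InHex; omega)
  have h2 := sum_hexFinset_single (n := n) hij' (fun a b => f (a.toNat, b.toNat))
    (a := i) (b := j - i) (by unfold InHex; omega)
  have h3 := sum_hexFinset_single (n := n) hij' (fun a b => f (a.toNat, b.toNat))
    (a := n + i - j) (b := j - i) (by unfold InHex; omega)
  have h4 := sum_hexFinset_single (n := n) hij' (fun a b => f (a.toNat, b.toNat))
    (a := n + i - j) (b := j) (by unfold InHex; omega)
  have h5 := sum_hexFinset_single (n := n) hij' (fun a b => f (a.toNat, b.toNat))
    (a := i) (b := n) (by unfold InHex; omega)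
  have e1 : ((j : ℤ) - i).toNat = j - i := by omega
  have e2 : ((n : ℤ) + i - j).toNat = n + i - j := by omega
  simp only [e1, e2, Int.toNat_natCast, Int.toNat_zero] at h1 h2 h3 h4 h5
  -- One identity for each vertex that occurs in the weights of the five kinds of tiles.
  have s1 := h.kindSum_eq hij hj f .loz₁ 0 1 fun p q => ⟨rfl, by simp [Tile.verts]⟩
  have s2 := h.kindSum_eq hij hj f .loz₁ 2 0 fun p q => ⟨rfl, by simp [Tile.verts]⟩
  have s3 := h.kindSum_eq hij hj f .loz₁ 1 0 fun p q => ⟨rfl, by simp [Tile.verts]⟩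
  have s4 := h.kindSum_eq hij hj f .loz₁ 1 1 fun p q => ⟨rfl, by simp [Tile.verts]⟩
  have s5 := h.kindSum_eq hij hj f .loz₂ 1 0 fun p q => ⟨rfl, by simp [Tile.verts]⟩
  have s6 := h.kindSum_eq hij hj f .loz₂ 0 2 fun p q => ⟨rfl, by simp [Tile.verts]⟩
  have s7 := h.kindSum_eq hij hj f .loz₂ 1 1 fun p q => ⟨rfl, by simp [Tile.verts]⟩
  have s8 := h.kindSum_eq hij hj f .loz₂ 0 1 fun p q => ⟨rfl, by simp [Tile.verts]⟩
  have s9 := h.kindSum_eq hij hj f .loz₃ 0 0 fun p q => ⟨rfl, by simp [Tile.verts]⟩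
  have s10 := h.kindSum_eq hij hj f .loz₃ 1 1 fun p q => ⟨rfl, by simp [Tile.verts]⟩
  have s11 := h.kindSum_eq hij hj f .loz₃ 1 0 fun p q => ⟨rfl, by simp [Tile.verts]⟩
  have s12 := h.kindSum_eq hij hj f .loz₃ 0 1 fun p q => ⟨rfl, by simp [Tile.verts]⟩
  have s13 := h.kindSum_eq hij hj f (fun p q => .tri (.up p q)) 1 1 fun p q => ⟨rfl,
      by simp [Tile.verts, UnitTriangle.verts]⟩
  have s14 := h.kindSum_eq hij hj f (fun p q => .tri (.up p q)) 0 1 fun p q => ⟨rfl,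
      by simp [Tile.verts, UnitTriangle.verts]⟩
  have s15 := h.kindSum_eq hij hj f (fun p q => .tri (.down p q)) 0 0 fun p q => ⟨rfl,
      by simp [Tile.verts, UnitTriangle.verts]⟩
  have s16 := h.kindSum_eq hij hj f (fun p q => .tri (.down p q)) 0 1 fun p q => ⟨rfl,
      by simp [Tile.verts, UnitTriangle.verts]⟩
  unfold tilingWeight hexagonWeight
  rw [sum_tiles (fun t ht => h.position_le hij hj ht)]
  simp only [Tile.weight, kindSum_lozenge, kindSum_triangle]
  simp only [add_zero] at s1 s2 s3 s4 s5 s6 s7 s8 s9 s10 s11 s12 s13 s14 s15 s16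
  rw [s1, s2, s3, s4, s5, s6, s7, s8, s9, s10, s11, s12, s13, s14, s15, s16, ← h1, ← h2, ← h3,
      ← h4, ← h5]
  -- Clearing the factor `1 / 3` makes the pointwise coefficient identity applicable.
  rw [← mul_right_inj' (three_ne_zero' ℝ), hexp]
  unfold tileCoefficient hexagonCoefficient
  push_cast
  simp only [mul_add, mul_sub, Finset.sum_add_distrib, Finset.sum_sub_distrib, sub_zero,
    smul_eq_mul]
  ring

end

/-! ### The tiling of a matching -/

theorem finite_setOf_tile (A B : ℕ) :
    {t : Tile | ∀ p ∈ t.verts, p.1 ≤ A ∧ p.2 ≤ B}.Finite := by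
  let S : Set (ℕ × ℕ) := Set.Iic A ×ˢ Set.Iic B
  have hS : S.Finite := (Set.finite_Iic A).prod (Set.finite_Iic B)
  refine (((((hS.image fun x => Tile.loz₁ x.1 x.2).union
      (hS.image fun x => Tile.loz₂ x.1 x.2)).union
    (hS.image fun x => Tile.loz₃ x.1 x.2)).union (hS.image fun x => Tile.tri (.up x.1 x.2))).union
    (hS.image fun x => Tile.tri (.down x.1 x.2))).subset ?_
  intro t ht
  rcases t with ⟨a, b⟩ | ⟨a, b⟩ | ⟨a, b⟩ | ⟨⟨a, b⟩ | ⟨a, b⟩⟩ <;>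
    simp only [Set.mem_ofPred_eq, Tile.verts, UnitTriangle.verts, Finset.mem_insert,
      Finset.mem_singleton, forall_eq_or_imp, forall_eq] at ht <;>
    simp [S] <;> omega

theorem finite_setOf_isLozengeTiling (n : ℕ) (v : ℕ × ℕ) :
    {Ξ : Finset Tile | IsLozengeTiling n v Ξ}.Finite := by
  refine ((finite_setOf_tile (n + v.1) n).toFinset.powerset.finite_toSet).subset fun Ξ hΞ => ?_
  rw [Finset.mem_coe, Finset.mem_powerset]
  intro t ht
  rw [Set.Finite.mem_toFinset]
  intro p hp
  have h := hΞ.subset t ht p hp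
  exact ⟨h.1.trans (Nat.sub_le _ _), h.2.2.1⟩

/-- The tiles of the tiling of a matching. -/
def IsMatchingTile (n i j : ℤ) (X Y : ℤ → ℤ → ℤ) : Tile → Prop
  | .loz₁ p q => VerticalInner n i j (p + 1) q ∧ Y (p + 1) q = 1
  | .loz₂ p q => HorizontalInner n i j p (q + 1) ∧ X p (q + 1) = 1
  | .loz₃ p q => (InHex n i j p q ∧ InHex n i j (p + 1) q ∧ InHex n i j p (q + 1) ∧
      InHex n i j (p + 1) (q + 1)) ∧ (p : ℤ) + q + 1 ≠ n ∧ X p q + Y p q = 0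
  | .tri (.up p q) => ((p : ℤ) + q + 1 = n ∧ InHex n i j (p + 1) q ∧ InHex n i j p (q + 1)) ∧
      X p (q + 1) + Y (p + 1) q = 0
  | .tri (.down p q) => ((p : ℤ) + q + 1 = n ∧ InHex n i j (p + 1) q ∧ InHex n i j p (q + 1)) ∧
      X p q + Y p q = 0

/-- The clauses `VerticalInner` and `HorizontalInner` keep the frozen edges from producing lozenges
that stick out of the hexagon. -/
theorem IsMatchingTile.inHex {n i j : ℤ} (hi : 0 < i) (hj : j < n) {X Y : ℤ → ℤ → ℤ} {t : Tile}
    (h : IsMatchingTile n i j X Y t) {p : ℕ × ℕ} (hp : p ∈ t.verts) :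
    InHex n i j p.1 p.2 := by
  rcases t with ⟨a, b⟩ | ⟨a, b⟩ | ⟨a, b⟩ | ⟨⟨a, b⟩ | ⟨a, b⟩⟩ <;>
    have h := h.1 <;>
    simp only [Tile.verts, UnitTriangle.verts, Finset.mem_insert, Finset.mem_singleton] at hp <;>
    simp only [VerticalInner, HorizontalInner, InHex] at h <;> unfold InHex
  · rcases hp with rfl | rfl | rfl | rfl <;> push_cast <;> omega
  · rcases hp with rfl | rfl | rfl | rfl <;> push_cast <;> omega
  · rcases hp with rfl | rfl | rfl | rfl <;> push_cast <;> omega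
  · rcases hp with rfl | rfl | rfl <;> push_cast <;> omega
  · rcases hp with rfl | rfl | rfl <;> push_cast <;> omega

theorem IsMatched.square_flat {n i j : ℤ} {X Y : ℤ → ℤ → ℤ}
    (h : IsMatched n i j (startHeight n) X Y) {a b : ℤ} (hab : MeetsHex n i j a b)
    (hn : a + b + 1 = n) : X a b + Y (a + 1) b + X a (b + 1) + Y a b = 1 :=
  (squareMatched_of_flat
    (by rw [startHeight_of_ge (by omega), startHeight_of_le (by omega)]; omega)
    (by rw [startHeight_of_ge (by omega), startHeight_of_ge (by omega)]; omega)).1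
    (h.square a b hab)

theorem IsMatched.square_slanted {n i j : ℤ} {X Y : ℤ → ℤ → ℤ}
    (h : IsMatched n i j (startHeight n) X Y) {a b : ℤ} (hab : MeetsHex n i j a b)
    (hn : a + b + 1 ≠ n) : X a b + Y a b = X a (b + 1) + Y (a + 1) b ∧ X a b + Y a b ≤ 1 := by
  have c1 := startHeight_cases n a b
  have c2 := startHeight_cases n (a + 1) b
  have c3 := startHeight_cases n a (b + 1)
  have c4 := startHeight_cases n (a + 1) (b + 1)
  exact (squareMatched_of_ne_left (by omega) (by omega)).1 (h.square a b hab)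

section

variable {n i j : ℕ} {X Y : ℤ → ℤ → ℤ}

theorem IsMatched.vertical_eq_zero (h : IsMatched n i j (startHeight n) X Y) {a b : ℤ}
    (h0 : ¬ VerticalInner n i j a b) (h1 : a + b ≠ j - 1) (h2 : a + b ≠ n + i) : Y a b = 0 := by
  rw [h.outerY a b h0, frozenVertical_of_ne h1 h2]

/-- The unique tile over a triangle is read off from the matched edge of its dual vertex: vertical,
horizontal or diagonal. On the equator a triangle with neither of its lattice edges matched is a
border triangle. -/
theorem IsMatched.existsUnique_up (h : IsMatched n i j (startHeight n) X Y) {p q : ℕ}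
    (h1 : InHex n i j p (q + 1)) (h2 : InHex n i j (p + 1) (q + 1)) (h3 : InHex n i j (p + 1) q) :
    ∃! t : Tile, IsMatchingTile n i j X Y t ∧ (UnitTriangle.up p q).verts ⊆ t.verts := by
  have hm : MeetsHex n i j p q := ⟨h3, h1, Or.inr h2⟩
  have hx := h.bitX p (q + 1)
  have hy := h.bitY (p + 1) q
  have m1 : Y (p + 1) q = 1 → VerticalInner n i j (p + 1) q := by
    intro hy1
    by_contra h0
    have := h.vertical_eq_zero h0 (by unfold InHex at *; omega) (by unfold InHex at *; omega)
    omega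
  have m2 : X p (q + 1) = 1 → HorizontalInner n i j p (q + 1) := by
    intro hx1
    by_contra h0
    have := h.outerX _ _ h0
    omega
  have n1 := h.nonneg p q
  have key : ∀ t, IsMatchingTile n i j X Y t →
      (∀ t', IsMatchingTile n i j X Y t' → (t' = .loz₁ p q ∨ t' = .loz₂ p q ∨ t' = .loz₃ p q ∨
        t' = .tri (.up p q)) → t' = t) →
      (t = .loz₁ p q ∨ t = .loz₂ p q ∨ t = .loz₃ p q ∨ t = .tri (.up p q)) →
      ∃! t : Tile, IsMatchingTile n i j X Y t ∧ (UnitTriangle.up p q).verts ⊆ t.verts :=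
    fun t ht hu hs => ⟨t, ⟨ht, (up_subset_iff p q t).2 hs⟩,
      fun t' ht' => hu t' ht'.1 ((up_subset_iff p q t').1 ht'.2)⟩
  have sq : ((p : ℤ) + q + 1 = n → X p q + Y (p + 1) q + X p (q + 1) + Y p q = 1) ∧
      ((p : ℤ) + q + 1 ≠ n → X p q + Y p q = X p (q + 1) + Y (p + 1) q ∧ X p q + Y p q ≤ 1) :=
    ⟨h.square_flat hm, h.square_slanted hm⟩
  by_cases e1 : Y (p + 1) q = 1
  · refine key (.loz₁ p q) ⟨m1 e1, e1⟩ ?_ (Or.inl rfl)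
    rintro t' ht' (rfl | rfl | rfl | rfl)
    · rfl
    all_goals
      unfold IsMatchingTile at ht'
      omega
  by_cases e2 : X p (q + 1) = 1
  · refine key (.loz₂ p q) ⟨m2 e2, e2⟩ ?_ (Or.inr (Or.inl rfl))
    rintro t' ht' (rfl | rfl | rfl | rfl)
    · exact absurd ht'.2 e1
    · rfl
    all_goals
      unfold IsMatchingTile at ht'
      omega
  by_cases hn : (p : ℤ) + q + 1 = n
  · refine key (.tri (.up p q)) ⟨⟨hn, h3, h1⟩, by omega⟩ ?_ (Or.inr (Or.inr (Or.inr rfl)))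
    rintro t' ht' (rfl | rfl | rfl | rfl)
    · exact absurd ht'.2 e1
    · exact absurd ht'.2 e2
    · exact absurd hn ht'.2.1
    · rfl
  -- Otherwise the square is cut by `BC`, and its frozen left edge forces the top or the right edge
  -- to be matched.
  · have h0 : InHex n i j p q := by
      by_contra h0
      have hY := h.outerY p q (by unfold InHex at h0 h1 h2 h3; unfold VerticalInner; omega)
      unfold frozenVertical at hY
      rw [if_pos (by unfold InHex at h0 h1 h2 h3; omega)] at hY
      have := sq.2 hn
      omega
    refine key (.loz₃ p q) ⟨⟨h0, h3, h1, h2⟩, hn, by have := sq.2 hn; omega⟩ ?_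
      (Or.inr (Or.inr (Or.inl rfl)))
    rintro t' ht' (rfl | rfl | rfl | rfl)
    · exact absurd ht'.2 e1
    · exact absurd ht'.2 e2
    · rfl
    · exact absurd ht'.1.1 hn

theorem IsMatched.existsUnique_down (h : IsMatched n i j (startHeight n) X Y) (hij : i ≤ j)
    {p q : ℕ}
    (h1 : InHex n i j p (q + 1)) (h2 : InHex n i j p q) (h3 : InHex n i j (p + 1) q) :
    ∃! t : Tile, IsMatchingTile n i j X Y t ∧ (UnitTriangle.down p q).verts ⊆ t.verts := by
  have hm : MeetsHex n i j p q := ⟨h3, h1, Or.inl h2⟩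
  have hx := h.bitX p q
  have hy := h.bitY p q
  have m1 : Y p q = 1 → VerticalInner n i j p q := by
    intro hy1
    by_contra h0
    have := h.vertical_eq_zero h0 (by unfold InHex at *; omega) (by unfold InHex at *; omega)
    omega
  have m2 : X p q = 1 → HorizontalInner n i j p q := by
    intro hx1
    by_contra h0
    have := h.outerX _ _ h0
    omega
  have n1 := h.nonneg p (q + 1)
  have n2 := h.nonneg (p + 1) q
  have c1 : 0 < p → ((p - 1 : ℕ) : ℤ) + 1 = p := by omega
  have c2 : 0 < q → ((q - 1 : ℕ) : ℤ) + 1 = q := by omega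
  have t1 : ∀ h0 : 0 < p, (IsMatchingTile n i j X Y (.loz₁ (p - 1) q) ↔
      VerticalInner n i j p q ∧ Y p q = 1) := by
    intro h0
    simp only [IsMatchingTile]
    rw [c1 h0]
  have t2 : ∀ h0 : 0 < q, (IsMatchingTile n i j X Y (.loz₂ p (q - 1)) ↔
      HorizontalInner n i j p q ∧ X p q = 1) := by
    intro h0
    simp only [IsMatchingTile]
    rw [c2 h0]
  have key : ∀ t, IsMatchingTile n i j X Y t →
      (∀ t', IsMatchingTile n i j X Y t' → ((0 < p ∧ t' = .loz₁ (p - 1) q) ∨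
        (0 < q ∧ t' = .loz₂ p (q - 1)) ∨ t' = .loz₃ p q ∨ t' = .tri (.down p q)) → t' = t) →
      ((0 < p ∧ t = .loz₁ (p - 1) q) ∨ (0 < q ∧ t = .loz₂ p (q - 1)) ∨ t = .loz₃ p q ∨
        t = .tri (.down p q)) →
      ∃! t : Tile, IsMatchingTile n i j X Y t ∧ (UnitTriangle.down p q).verts ⊆ t.verts :=
    fun t ht hu hs => ⟨t, ⟨ht, (down_subset_iff p q t).2 hs⟩,
      fun t' ht' => hu t' ht'.1 ((down_subset_iff p q t').1 ht'.2)⟩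
  have sq : ((p : ℤ) + q + 1 = n → X p q + Y (p + 1) q + X p (q + 1) + Y p q = 1) ∧
      ((p : ℤ) + q + 1 ≠ n → X p q + Y p q = X p (q + 1) + Y (p + 1) q ∧ X p q + Y p q ≤ 1) :=
    ⟨h.square_flat hm, h.square_slanted hm⟩
  by_cases e1 : Y p q = 1
  · have hv := m1 e1
    have h0 : 0 < p := by unfold VerticalInner at hv; omega
    refine key (.loz₁ (p - 1) q) ((t1 h0).2 ⟨hv, e1⟩) ?_ (Or.inl ⟨h0, rfl⟩)
    rintro t' ht' (⟨_, rfl⟩ | ⟨h4, rfl⟩ | rfl | rfl)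
    · rfl
    · have := ((t2 h4).1 ht').2
      omega
    all_goals
      unfold IsMatchingTile at ht'
      omega
  by_cases e2 : X p q = 1
  · have hv := m2 e2
    have h0 : 0 < q := by unfold HorizontalInner at hv; unfold InHex at h2; omega
    refine key (.loz₂ p (q - 1)) ((t2 h0).2 ⟨hv, e2⟩) ?_ (Or.inr (Or.inl ⟨h0, rfl⟩))
    rintro t' ht' (⟨h4, rfl⟩ | ⟨_, rfl⟩ | rfl | rfl)
    · exact absurd ((t1 h4).1 ht').2 e1
    · rfl
    all_goals
      unfold IsMatchingTile at ht'
      omega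
  by_cases hn : (p : ℤ) + q + 1 = n
  · refine key (.tri (.down p q)) ⟨⟨hn, h3, h1⟩, by omega⟩ ?_ (Or.inr (Or.inr (Or.inr rfl)))
    rintro t' ht' (⟨h4, rfl⟩ | ⟨h4, rfl⟩ | rfl | rfl)
    · exact absurd ((t1 h4).1 ht').2 e1
    · exact absurd ((t2 h4).1 ht').2 e2
    · exact absurd hn ht'.2.1
    · rfl
  -- Otherwise the square is cut by `EF`, and its frozen right edge forces the bottom or the left
  -- edge to be matched.
  · have h0 : InHex n i j (p + 1) (q + 1) := by
      by_contra h0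
      have hY := h.outerY (p + 1) q
        (by unfold InHex at h0 h1 h2 h3; unfold VerticalInner; omega)
      unfold frozenVertical at hY
      rw [if_pos (by unfold InHex at h0 h1 h2 h3; omega)] at hY
      have := sq.2 hn
      omega
    refine key (.loz₃ p q) ⟨⟨h2, h3, h1, h0⟩, hn, by omega⟩ ?_
      (Or.inr (Or.inr (Or.inl rfl)))
    rintro t' ht' (⟨h4, rfl⟩ | ⟨h4, rfl⟩ | rfl | rfl)
    · exact absurd ((t1 h4).1 ht').2 e1
    · exact absurd ((t2 h4).1 ht').2 e2
    · rfl
    · exact absurd ht'.1.1 hn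

/-- Recovering `X` and `Y` exactly, and not only some tiling, is what lets an optimal matching be
replaced by a tiling of the same weight. -/
theorem IsMatched.exists_tiling (h : IsMatched n i j (startHeight n) X Y) (hi : 0 < i)
    (hij : i ≤ j) (hj : j < n) : ∃ Ξ : Finset Tile, IsLozengeTiling n (i, j) Ξ ∧
      tilingHorizontal (tileIndicator Ξ .loz₂) = X ∧
      tilingVertical n i j (tileIndicator Ξ .loz₁) = Y := by
  have hi' : (0 : ℤ) < i := by exact_mod_cast hi
  have hj' : (j : ℤ) < n := by exact_mod_cast hj
  have hfin : {t : Tile | IsMatchingTile n i j X Y t}.Finite := by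
    refine (finite_setOf_tile n n).subset fun t ht p hp => ?_
    have := IsMatchingTile.inHex hi' hj' ht hp
    unfold InHex at this
    omega
  have hmem : ∀ t, t ∈ hfin.toFinset ↔ IsMatchingTile n i j X Y t := by simp
  refine ⟨hfin.toFinset, ⟨?_, ?_, ?_, ?_⟩, ?_, ?_⟩
  · intro t ht
    rw [hmem] at ht
    rcases t with ⟨a, b⟩ | ⟨a, b⟩ | ⟨a, b⟩ | ⟨⟨a, b⟩ | ⟨a, b⟩⟩
    · simp only [Tile.Allowed, InHalf, Tile.verts, Finset.mem_insert, Finset.mem_singleton,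
        forall_eq_or_imp, forall_eq]
      omega
    · simp only [Tile.Allowed, InHalf, Tile.verts, Finset.mem_insert, Finset.mem_singleton,
        forall_eq_or_imp, forall_eq]
      omega
    · have := ht.2.1
      simp only [Tile.Allowed, InHalf, Tile.verts, Finset.mem_insert, Finset.mem_singleton,
        forall_eq_or_imp, forall_eq]
      omega
    · have := ht.1.1
      simp only [Tile.Allowed]
      omega
    · have := ht.1.1
      simp only [Tile.Allowed]
      omega
  · intro t ht p hp
    rw [hmem] at ht
    exact (mem_hexagon_iff hij hj p.1 p.2).2 (IsMatchingTile.inHex hi' hj' ht hp)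
  · rintro (⟨p, q⟩ | ⟨p, q⟩) hs <;>
      simp only [UnitTriangle.verts, Finset.mem_insert, Finset.mem_singleton, forall_eq_or_imp,
        forall_eq, mem_hexagon_iff hij hj] at hs <;>
      push_cast at hs <;> simp only [hmem]
    · exact h.existsUnique_up hs.1 hs.2.1 hs.2.2
    · exact h.existsUnique_down hij hs.1 hs.2.1 hs.2.2
  · intro p q hn h1 h2
    rw [mem_hexagon_iff hij hj] at h1 h2
    push_cast at h1 h2
    have hn' : (p : ℤ) + q + 1 = n := by exact_mod_cast hn
    have hsq := h.square_flat (a := p) (b := q)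
      ⟨h2, h1, Or.inl (by unfold InHex at *; omega)⟩ hn'
    have n1 := h.nonneg p q
    have n2 := h.nonneg (p + 1) q
    have n3 := h.nonneg p (q + 1)
    have hu : IsMatchingTile n i j X Y (.tri (.up p q)) ↔ X p (q + 1) + Y (p + 1) q = 0 :=
      ⟨fun h' => h'.2, fun h' => ⟨⟨hn', h2, h1⟩, h'⟩⟩
    have hd : IsMatchingTile n i j X Y (.tri (.down p q)) ↔ X p q + Y p q = 0 :=
      ⟨fun h' => h'.2, fun h' => ⟨⟨hn', h2, h1⟩, h'⟩⟩
    rw [hmem, hmem, hu, hd]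
    unfold Xor
    omega
  · funext a b
    unfold tilingHorizontal
    by_cases hab : HorizontalInner n i j a b
    · have ha : 0 ≤ a := hab.1
      have hb : 1 ≤ b := by unfold HorizontalInner at hab; omega
      obtain ⟨p, rfl⟩ := Int.eq_ofNat_of_zero_le ha
      obtain ⟨q, hq⟩ := Int.eq_ofNat_of_zero_le (show 0 ≤ b - 1 by omega)
      obtain rfl : b = q + 1 := by omega
      rw [add_sub_cancel_right, tileIndicator_natCast]
      have := h.bitX p (q + 1)
      by_cases hx : X p (q + 1) = 1
      · rw [if_pos ((hmem (.loz₂ p q)).2 ⟨hab, hx⟩), hx]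
      · rw [if_neg (fun h' => hx ((hmem (.loz₂ p q)).1 h').2)]
        omega
    · rw [h.outerX a b hab]
      by_contra h0
      obtain ⟨p, q, rfl, hq, ht⟩ := exists_of_tileIndicator_ne_zero h0
      obtain rfl : b = q + 1 := by omega
      exact hab ((hmem _).1 ht).1
  · funext a b
    unfold tilingVertical
    by_cases hab : VerticalInner n i j a b
    · have ha : 0 < a := hab.1
      have hb : 0 ≤ b := by unfold VerticalInner at hab; omega
      obtain ⟨q, rfl⟩ := Int.eq_ofNat_of_zero_le hb
      obtain ⟨p, hp⟩ := Int.eq_ofNat_of_zero_le (show 0 ≤ a - 1 by omega)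
      obtain rfl : a = p + 1 := by omega
      rw [add_sub_cancel_right, tileIndicator_natCast, frozenVertical_of_ne
        (by unfold VerticalInner at hab; omega) (by unfold VerticalInner at hab; omega), add_zero]
      have := h.bitY (p + 1) q
      by_cases hx : Y (p + 1) q = 1
      · rw [if_pos ((hmem (.loz₁ p q)).2 ⟨hab, hx⟩), hx]
      · rw [if_neg (fun h' => hx ((hmem (.loz₁ p q)).1 h').2)]
        omega
    · rw [h.outerY a b hab]
      simp only [add_eq_right]
      by_contra h0
      obtain ⟨p, q, hp, rfl, ht⟩ := exists_of_tileIndicator_ne_zero h0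
      obtain rfl : a = p + 1 := by omega
      exact hab ((hmem _).1 ht).1

end

/-! ### The octahedron extension as a function of height -/

/-- The value of the octahedron extension at the point of height `z + w = t` above
`(x + w, y + w) = (a, b)`. -/
noncomputable def octahedronValue (f : ℕ × ℕ → ℝ) (n a b t : ℤ) : ℝ :=
  octahedronExtension f (a - (t + (a + b - n)) / 2).toNat (b - (t + (a + b - n)) / 2).toNat
    ((t - (a + b - n)) / 2).toNat ((t + (a + b - n)) / 2).toNat

theorem octahedronValue_eq (f : ℕ × ℕ → ℝ) {n a b t : ℤ} {x y z w : ℕ}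
    (hn : (x : ℤ) + y + z + w = n) (ha : a = x + w) (hb : b = y + w) (ht : t = z + w) :
    octahedronValue f n a b t = octahedronExtension f x y z w := by
  unfold octahedronValue
  congr 1 <;> omega

theorem octahedronExtension_of_face (f : ℕ × ℕ → ℝ) {x y z w : ℕ} (h : z = 0 ∨ w = 0) :
    octahedronExtension f x y z w = f (x + w, y + w) := by
  rcases z with _ | z
  · rw [octahedronExtension]
  · obtain rfl : w = 0 := by omega
    rw [octahedronExtension]
    rfl

/-- Lying on or above the initial surface gives `z, w ≥ 0`; lying at least 2 below the cone leaves
room for `x, y ≥ 0`. So the rule is only invoked inside the tetrahedron. -/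
theorem octahedronRule_octahedronValue (f : ℕ × ℕ → ℝ) {n i j : ℤ} (hij : i ≤ j) :
    OctahedronRule n i j (octahedronValue f n) := by
  intro a b t h1 h2 h3
  have h4 := coneHeight_le_abs n i j a b
  have h5 := le_max_left (a + b - n) (n - a - b)
  have h6 := le_max_right (a + b - n) (n - a - b)
  rw [← startHeight] at h5 h6
  -- The point at height `t` is `[x + 1, y + 1, z, w]` with `z = c = (t - (a + b - n)) / 2` and `w =
  -- (t + (a + b - n)) / 2`.
  obtain ⟨c, hc⟩ := h3
  obtain ⟨z, hz⟩ := Int.eq_ofNat_of_zero_le (show 0 ≤ c by omega)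
  obtain ⟨w, hw⟩ := Int.eq_ofNat_of_zero_le (show 0 ≤ c + (a + b - n) by omega)
  obtain ⟨x, hx⟩ := Int.eq_ofNat_of_zero_le (show 0 ≤ a - 1 - w by omega)
  obtain ⟨y, hy⟩ := Int.eq_ofNat_of_zero_le (show 0 ≤ b - 1 - w by omega)
  rw [octahedronValue_eq f (x := x) (y := y) (z := z + 1) (w := w + 1)
      (by push_cast; omega) (by push_cast; omega) (by push_cast; omega) (by push_cast; omega),
    octahedronValue_eq f (a := a) (b := b + 1) (x := x) (y := y + 1) (z := z) (w := w + 1)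
      (by push_cast; omega) (by push_cast; omega) (by push_cast; omega) (by push_cast; omega),
    octahedronValue_eq f (a := a) (b := b - 1) (x := x + 1) (y := y) (z := z + 1) (w := w)
      (by push_cast; omega) (by push_cast; omega) (by omega) (by push_cast; omega),
    octahedronValue_eq f (a := a + 1) (b := b) (x := x + 1) (y := y) (z := z) (w := w + 1)
      (by push_cast; omega) (by push_cast; omega) (by push_cast; omega) (by push_cast; omega),
    octahedronValue_eq f (a := a - 1) (b := b) (x := x) (y := y + 1) (z := z + 1) (w := w)
      (by push_cast; omega) (by omega) (by push_cast; omega) (by push_cast; omega),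
    octahedronValue_eq f (a := a) (b := b) (t := t) (x := x + 1) (y := y + 1) (z := z) (w := w)
      (by push_cast; omega) (by push_cast; omega) (by push_cast; omega) (by omega),
    octahedronExtension,
    add_comm (octahedronExtension f (x + 1) y (z + 1) w)]

theorem octahedronValue_startHeight (f : ℕ × ℕ → ℝ) {n i j a b : ℤ} (h : InHex n i j a b)
    (hij : i ≤ j) :
    octahedronValue f n a b (startHeight n a b) = f (a.toNat, b.toNat) := by
  unfold InHex at h
  rcases le_total n (a + b) with h0 | h0
  · rw [startHeight_of_le h0, octahedronValue_eq f (x := (n - b).toNat) (y := (n - a).toNat)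
      (z := 0) (w := (a + b - n).toNat) (by omega) (by omega) (by omega) (by omega),
      octahedronExtension_of_face f (Or.inl rfl)]
    congr 2 <;> omega
  · rw [startHeight_of_ge h0, octahedronValue_eq f (x := a.toNat) (y := b.toNat)
      (z := (n - a - b).toNat) (w := 0) (by omega) (by omega) (by omega) (by omega),
      octahedronExtension_of_face f (Or.inr rfl)]
    rfl

theorem matchingWeight_octahedronValue (f : ℕ × ℕ → ℝ) {n i j : ℤ} (hij : i ≤ j)
    (X Y : ℤ → ℤ → ℤ) :
    matchingWeight n i j (fun a b => octahedronValue f n a b (startHeight n a b))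
      (startHeight n) X Y =
    matchingWeight n i j (fun a b => f (a.toNat, b.toNat)) (startHeight n) X Y :=
  Finset.sum_congr rfl fun p hp => by
    simp only [octahedronValue_startHeight f ((mem_hexFinset hij).1 hp) hij]

/-- The octahedron extension of arbitrary data is the maximum of the weights of the tilings of the
excavation hexagon. -/
theorem isGreatest_tilingWeight {n i j : ℕ} (hi : 0 < i) (hij : i ≤ j) (hj : j < n)
    (f : ℕ × ℕ → ℝ) :
    IsGreatest {x | ∃ Ξ, IsLozengeTiling n (i, j) Ξ ∧ x = tilingWeight n (i, j) Ξ f}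
      (octahedronExtension f 0 (j - i) (n - j) i) := by
  have hi' : (0 : ℤ) < i := by exact_mod_cast hi
  have hij' : (i : ℤ) ≤ j := by exact_mod_cast hij
  have hj' : (j : ℤ) < n := by exact_mod_cast hj
  have key := isMaxWeight hi' hij' hj' (octahedronRule_octahedronValue f hij')
    (isSurface_startHeight n i j)
  -- The apex of the cone is the point `[0, j - i, n - j, i]` of the face `T`.
  rw [octahedronValue_eq f (x := 0) (y := j - i) (z := n - j) (w := i) (by omega) (by omega)
    (by omega) (by omega)] at key
  obtain ⟨hle, X, Y, hXY, heq⟩ := key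
  constructor
  · obtain ⟨Ξ, hΞ, rfl, rfl⟩ := hXY.exists_tiling hi hij hj
    refine ⟨Ξ, hΞ, ?_⟩
    have := hΞ.two_mul_tilingWeight hi hij hj f
    rw [matchingWeight_octahedronValue f hij'] at heq
    linarith
  · rintro _ ⟨Ξ, hΞ, rfl⟩
    have h1 := hle _ _ ((hΞ.isTilingIndicator hij hj).isMatched hi' hj')
    rw [matchingWeight_octahedronValue f hij'] at h1
    have := hΞ.two_mul_tilingWeight hi hij hj f
    linarith

/-! ### Independence of the auxiliary tuple -/

theorem tilingWeight_add {n : ℕ} (v : ℕ × ℕ) (Ξ : Finset Tile) (f f' : ℕ × ℕ → ℝ) :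
    tilingWeight n v Ξ (f + f') = tilingWeight n v Ξ f + tilingWeight n v Ξ f' := by
  have h : ∀ t : Tile, t.weight (f + f') = t.weight f + t.weight f' := by
    rintro (⟨a, b⟩ | ⟨a, b⟩ | ⟨a, b⟩ | ⟨⟨a, b⟩ | ⟨a, b⟩⟩) <;>
      simp only [Tile.weight, Pi.add_apply, smul_eq_mul] <;> ring
  simp only [tilingWeight, h, Finset.sum_add_distrib, hexagonWeight, Pi.add_apply, smul_eq_mul]
  ring

theorem tilingFunctional_apply (n : ℕ) (v : ℕ × ℕ) (Ξ : Finset Tile)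
    (g : GTArray n × GTArray n) :
    tilingFunctional n v Ξ g = tilingWeight n v Ξ (squareData 0 g.1 g.2) := by
  have h : ∀ t : Tile, t.weight (squareFunctional n) g = t.weight (squareData 0 g.1 g.2) := by
    rintro (⟨a, b⟩ | ⟨a, b⟩ | ⟨a, b⟩ | ⟨⟨a, b⟩ | ⟨a, b⟩⟩) <;> rfl
  simp only [tilingFunctional, tilingWeight, LinearMap.add_apply, LinearMap.sum_apply, h]
  rfl

/-- The contribution of the auxiliary tuple to the data on the square. -/
noncomputable def gapData {n : ℕ} (γ : Fin n → ℝ) (p : ℕ × ℕ) : ℝ :=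
  partialSum γ (max p.2 (n - p.1)) - ∑ l, γ l

theorem partialSum_add {n : ℕ} (Λ Λ' : Fin n → ℝ) (j : ℕ) :
    partialSum (Λ + Λ') j = partialSum Λ j + partialSum Λ' j :=
  Finset.sum_add_distrib

theorem partialSum_self {n : ℕ} (Λ : Fin n → ℝ) : partialSum Λ n = ∑ l, Λ l := by
  unfold partialSum
  rw [Finset.filter_true_of_mem fun l _ => l.2]

/-- The tuple `γ` enters additively, through its first `p.2` entries on `U` and its first `n - p.1`
entries on `U'`; in both cases the index is the larger of the two. -/
theorem squareData_eq {n : ℕ} (γ : Fin n → ℝ) (g₁ g₂ : GTArray n) :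
    squareData γ g₁ g₂ = squareData 0 g₁ g₂ + gapData γ := by
  have h0 : ∀ k, partialSum (0 : Fin n → ℝ) k = 0 := fun k => Finset.sum_const_zero
  funext p
  simp only [squareData, gapData, hiveOf, partialSum_add, h0, Pi.add_apply, Pi.zero_apply,
    Finset.sum_const_zero]
  split_ifs with h
  · rw [max_eq_left (by omega)]
    ring
  · rw [max_eq_right (by omega)]
    ring

theorem gapData_neg {n : ℕ} (γ : Fin n → ℝ) : gapData (-γ) = -gapData γ := by
  funext p
  simp only [gapData, partialSum, Pi.neg_apply, Finset.sum_neg_distrib]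
  ring

/-- On both faces the index in `gapData` is `n - x`. Each alternative of the rule pairs a point at
`x` with one at `x + 1`, so a function of `x` alone makes them equal and the rule preserves it. -/
theorem octahedronExtension_gapData {n : ℕ} (γ : Fin n → ℝ) (x y z w : ℕ)
    (h : x + y + z + w = n) :
    octahedronExtension (gapData γ) x y z w = partialSum γ (n - x) - ∑ l, γ l := by
  induction hk : z + w using Nat.strong_induction_on generalizing x y z w with
  | _ k ih =>
    by_cases h0 : z = 0 ∨ w = 0
    · rw [octahedronExtension_of_face _ h0, gapData]
      congr 2
      simp only
      omega
    · obtain ⟨z, rfl⟩ := Nat.exists_eq_succ_of_ne_zero (fun hz => h0 (Or.inl hz))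
      obtain ⟨w, rfl⟩ := Nat.exists_eq_succ_of_ne_zero (fun hw => h0 (Or.inr hw))
      rw [octahedronExtension,
        ih _ (by omega) (x + 1) y (z + 1) w (by omega) rfl,
        ih _ (by omega) x (y + 1) z (w + 1) (by omega) rfl,
        ih _ (by omega) (x + 1) y z (w + 1) (by omega) rfl,
        ih _ (by omega) x (y + 1) (z + 1) w (by omega) rfl,
        ih _ (by omega) (x + 1) (y + 1) z w (by omega) rfl, max_self]
      ring

/-- At `x = 0` the extension of `gapData γ` vanishes, so all tiling weights of `gapData γ` are at
most 0. The same holds for `-γ`, and the weight is additive, so they are 0. -/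
theorem tilingWeight_gapData {n i j : ℕ} (hi : 0 < i) (hij : i ≤ j) (hj : j < n) {Ξ : Finset Tile}
    (hΞ : IsLozengeTiling n (i, j) Ξ) (γ : Fin n → ℝ) :
    tilingWeight n (i, j) Ξ (gapData γ) = 0 := by
  have key : ∀ γ : Fin n → ℝ, tilingWeight n (i, j) Ξ (gapData γ) ≤ 0 := fun γ => by
    have := (isGreatest_tilingWeight hi hij hj (gapData γ)).2 ⟨Ξ, hΞ, rfl⟩
    rwa [octahedronExtension_gapData γ _ _ _ _ (by omega), Nat.sub_zero, partialSum_self,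
      sub_self] at this
  have h0 := tilingWeight_add (n := n) (i, j) Ξ (gapData γ) (gapData (-γ))
  have h1 := tilingWeight_add (n := n) (i, j) Ξ 0 0
  rw [add_zero] at h1
  rw [gapData_neg, add_neg_cancel] at h0
  have h2 := key (-γ)
  rw [gapData_neg] at h2
  linarith [key γ]

theorem tilingFunctional_eq_tilingWeight {n i j : ℕ} (hi : 0 < i) (hij : i ≤ j) (hj : j < n)
    {Ξ : Finset Tile} (hΞ : IsLozengeTiling n (i, j) Ξ) (γ : Fin n → ℝ) (g₁ g₂ : GTArray n) :
    tilingFunctional n (i, j) Ξ (g₁, g₂) = tilingWeight n (i, j) Ξ (squareData γ g₁ g₂) := by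
  rw [tilingFunctional_apply, squareData_eq γ, tilingWeight_add,
    tilingWeight_gapData hi hij hj hΞ, add_zero]

theorem squareFunctional_eq_squareData {n i j : ℕ} (h : i = 0 ∨ j = n) (hj : j ≤ n)
    (γ : Fin n → ℝ) (g₁ g₂ : GTArray n) :
    squareFunctional n (i, j) (g₁, g₂) = squareData γ g₁ g₂ (i, j) := by
  have h0 : gapData γ (i, j) = 0 := by
    have : max j (n - i) = n := by omega
    rw [gapData, this, partialSum_self, sub_self]
  rw [squareData_eq γ, Pi.add_apply, h0, add_zero]
  rfl

theorem octahedronExtension_boundary (f : ℕ × ℕ → ℝ) {n i j : ℕ} (h : i = 0 ∨ j = n) (hij : i ≤ j) :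
    octahedronExtension f 0 (j - i) (n - j) i = f (i, j) := by
  rw [octahedronExtension_of_face f (by omega), zero_add, Nat.sub_add_cancel hij]

end Excavation

theorem theorem2 (n : ℕ) (hn : 2 ≤ n) (v : Excavation.Triangle n) :
    -- the tilings, and hence the functionals, are finite in number
    {Ξ : Finset Excavation.Tile | Excavation.IsLozengeTiling n v.1 Ξ}.Finite ∧
    (Excavation.excavationFamily n v.1).Finite ∧
    -- the functionals are computed from the data `k̃` of any auxiliary tuple `γ`
    (∀ (γ : Fin n → ℝ) (g₁ g₂ : Excavation.GTArray n),
      (Excavation.IsInterior n v.1 → ∀ Ξ : Finset Excavation.Tile,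
        Excavation.IsLozengeTiling n v.1 Ξ →
          Excavation.tilingFunctional n v.1 Ξ (g₁, g₂) =
            Excavation.tilingWeight n v.1 Ξ (Excavation.squareData γ g₁ g₂)) ∧
      (¬ Excavation.IsInterior n v.1 →
        Excavation.squareFunctional n v.1 (g₁, g₂) = Excavation.squareData γ g₁ g₂ v.1)) ∧
    -- the excavation formula
    (∀ (g₁ g₂ : Excavation.GTArray n), Excavation.IsGT g₁ → Excavation.IsGT g₂ →
      ∀ (h : Excavation.Triangle n → ℝ) (g : Excavation.GTArray n),
        Excavation.IsOct g₁ g₂ h g →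
          IsGreatest ((fun w => w (g₁, g₂)) '' Excavation.excavationFamily n v.1) (h v)) := by
  open Excavation in
  obtain ⟨⟨i, j⟩, hij, hj⟩ := v
  simp only at hij hj
  have hfin := finite_setOf_isLozengeTiling n (i, j)
  have hint : IsInterior n (i, j) → 0 < i ∧ j < n := fun h => ⟨h.1, h.2.2.2⟩
  -- Since `i ≤ j ≤ n`, the case `j = 0` gives `i = 0` and the case `i = n` gives `j = n`.
  have hbd : ¬ IsInterior n (i, j) → i = 0 ∨ j = n := fun h => by
    unfold IsInterior at h
    simp only at h
    omega
  have hindep : ∀ (γ : Fin n → ℝ) (g₁ g₂ : GTArray n), (IsInterior n (i, j) → ∀ Ξ : Finset Tile,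
        IsLozengeTiling n (i, j) Ξ → tilingFunctional n (i, j) Ξ (g₁, g₂) =
          tilingWeight n (i, j) Ξ (squareData γ g₁ g₂)) ∧
      (¬ IsInterior n (i, j) →
        squareFunctional n (i, j) (g₁, g₂) = squareData γ g₁ g₂ (i, j)) := fun γ g₁ g₂ =>
    ⟨fun h Ξ hΞ => tilingFunctional_eq_tilingWeight (hint h).1 hij (hint h).2 hΞ γ g₁ g₂,
      fun h => squareFunctional_eq_squareData (hbd h) hj γ g₁ g₂⟩
  refine ⟨hfin, ?_, hindep, ?_⟩
  · unfold excavationFamily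
    split_ifs
    · refine (hfin.image (tilingFunctional n (i, j))).subset ?_
      rintro _ ⟨Ξ, hΞ, rfl⟩
      exact ⟨Ξ, hΞ, rfl⟩
    · exact Set.finite_singleton _
  · rintro g₁ g₂ - - h g ⟨γ, -, hγ⟩
    have hv : h ⟨(i, j), hij, hj⟩ =
        octahedronExtension (squareData γ g₁ g₂) 0 (j - i) (n - j) i := by
      have h1 : h = (octWith γ g₁ g₂).1 := congrArg Prod.fst hγ
      rw [h1]
      exact if_pos hij
    rw [hv]
    unfold excavationFamily
    split_ifs with hI
    -- By independence of `γ`, the values of the functionals are the tiling weights of the data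
    -- built from the given `γ`.
    · convert isGreatest_tilingWeight (hint hI).1 hij (hint hI).2 (squareData γ g₁ g₂) using 1
      ext x
      constructor
      · rintro ⟨_, ⟨Ξ, hΞ, rfl⟩, rfl⟩
        exact ⟨Ξ, hΞ, (hindep γ g₁ g₂).1 hI Ξ hΞ⟩
      · rintro ⟨Ξ, hΞ, rfl⟩
        exact ⟨_, ⟨Ξ, hΞ, rfl⟩, (hindep γ g₁ g₂).1 hI Ξ hΞ⟩
    · rw [octahedronExtension_boundary _ (hbd hI) hij, Set.image_singleton,
        (hindep γ g₁ g₂).2 hI]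
      exact isGreatest_singleton
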